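/- Let $T\subset D=\mathbb G_m^n$ be a split subtorus over $\mathbb Z$, $G=D/T$, with cocharacter lattices $\mathfrak t_{\mathbb Z}\subset\mathfrak d_{\mathbb Z}=\mathbb Z^n$ and $\mathfrak g_{\mathbb Z}=\mathbb Z^n/\mathfrak t_{\mathbb Z}$. Write $x|_T\in\mathfrak t_{\mathbb Z}^*$ for the restriction to $T$ of a character $x\in\mathbb Z^n$ of $D$, and $\epsilon_1,\dots,\epsilon_n$ for the coordinate characters. Assume that $T\subset D$ is unimodular (any coordinate cocharacters whose images form a $\mathbb Q$-basis of $\mathfrak g_{\mathbb Q}$ have images forming a $\mathbb Z$-basis of $\mathfrak g_{\mathbb Z}$), and let $\alpha\in\mathfrak t_{\mathbb Z}^*$ be generic (if $\alpha$ lies in the $\mathbb Q$-span of $\{\epsilon_i|_T : i\in J\}$, then this set spans $\mathfrak t_{\mathbb Q}^*$). Let $$\mathfrak M=\operatorname{Proj}\Big(\mathbb Z[z_1,\dots,z_n,w_1,\dots,w_n,t]^T\big/\big\langle \textstyle\sum_i\chi_i z_iw_i : \chi\in\mathfrak t_{\mathbb Z}\big\rangle\Big),$$ where $z_i,w_i,t$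 have $T$-weights $\epsilon_i|_T,-\epsilon_i|_T,-\alpha$ and the grading is the degree in $t$. For a character $\chi$ of $T$ let $\ell(\chi)$ be the associated line bundle on $\mathfrak M$, whose sections are the $T$-semi-invariant functions of weight $\chi$; it is equivariant for the action of $\mathbb S=\mathbb G_m$ that scales all $z_i$ and $w_i$ with weight one. For $x\in\mathbb Z^n$ put $m^p(x)=\prod_{x_i>0}z_i^{x_i}\prod_{x_i<0}w_i^{-x_i}$; multiplication by $m^p(y-x)$ is a homomorphism $\ell(x|_T)\to\ell(y|_T)$. Let $p$ be a prime and $\lambda\in\mathfrak t_{\mathbb Z}^*$. Let $\Lambda(\lambda)$ be the set of $x\in\mathbb Z^n$ for which there is $a\in\mathbb Z^n$ with $a|_T=\lambda$ and $px_i\le a_i<px_i+p$ for all $i$, let $\bar\Lambda(\lambda)=\{x|_T : x\in\Lambda(\lambda)\}$ (a finite set), and let $\mathcal T=\bigoplus_{\chi\in\bar\Lambda(\lambda)}\ell(\chi)$. Let $S_{\mathbb Z}=\operatorname{Sym}_{\mathbb Z}(\mathfrak g_{\mathbb Z})$ and let $s_i\in S_{\mathbb Z}$ be the image of the $i$-th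 coordinate cocharacter. Let $\bar H^\lambda_{\mathbb Z}$ be the graded $S_{\mathbb Z}$-algebra generated by orthogonal idempotents $1_\chi$ ($\chi\in\bar\Lambda(\lambda)$) with sum $1$ and elements $c_{x,y}$ ($x,y\in\Lambda(\lambda)$), with relations $1_{x|_T}\,c_{x,y}=c_{x,y}=c_{x,y}\,1_{y|_T}$, $c_{x,x}=1_{x|_T}$, $c_{x+\gamma,y+\gamma}=c_{x,y}$ for $\gamma\in\mathbb Z^n$ with $\gamma|_T=0$, and $$c_{x,y}\,c_{y,u}=\prod_i s_i^{\frac12(|x_i-y_i|+|y_i-u_i|-|x_i-u_i|)}\,c_{x,u},$$ graded by $\deg 1_\chi=0$, $\deg c_{x,y}=\sum_i|x_i-y_i|$, $\deg s_i=2$. Then for every $\lambda$ the homogeneous parts of $\bar H^\lambda_{\mathbb Z}$ form a direct sum decomposition, and there is an isomorphism of graded rings $$\bar H^\lambda_{\mathbb Z}\;\cong\;\operatorname{End}_{\mathsf{Coh}(\mathfrak M)}(\mathcal T),$$ where $\operatorname{End}$ is graded by $\mathbb S$-weight and the product $fg$ in it means first $f$, then $g$. It sends $c_{x,y}$ to $m^p(y-x)\colon\ell(x|_T)\to\ell(y|_T)$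 (zero on the other summands) and $s_i$ to multiplication by $z_iw_i$. There is likewise an isomorphism of graded rings onto $\operatorname{End}(\mathcal T)$ with the usual product $f\circ g$, sending $c_{x,y}$ to $m^p(x-y)\colon\ell(y|_T)\to\ell(x|_T)$ and $s_i$ to $z_iw_i$. Moreover, suppose that $\lambda$ is smooth, that is, for all $\mu$ in a neighbourhood of $\lambda$ in $\mathfrak t^*_{\mathbb R}$ the set of $x\in\mathbb Z^n$ for which there is $a\in\mathbb R^n$ with $a|_T=\mu$ and $px_i\le a_i<px_i+p$ for all $i$ is equal to $\Lambda(\lambda)$. Then the first statement also holds for the $S_{\mathbb Z}$-algebra with the quadratic presentation: it has generators $1_\chi$ ($\chi\in\bar\Lambda(\lambda)$) of degree $0$ and $c_\chi^{\pm i}=1_{\chi\pm\epsilon_i}\,c_\chi^{\pm i}\,1_\chi$ of degree $1$ (for $\chi,\chi\pm\epsilon_i\in\bar\Lambda(\lambda)$, where $\epsilon_i$ means $\epsilon_i|_T$); the $1_\chi$ are orthogonal idempotents with sum $1$; if $\chi,\chi+\epsilon_i\in\bar\Lambda(\lambda)$, then $c^{-i}_{\chi+\epsilon_i}c^{+i}_\chi=s_i1_\chi$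 and $c^{+i}_\chi c^{-i}_{\chi+\epsilon_i}=s_i1_{\chi+\epsilon_i}$; and if $i\ne j$ and $\chi,\chi+\epsilon_i,\chi+\epsilon_j,\chi+\epsilon_i+\epsilon_j\in\bar\Lambda(\lambda)$, then $$c^{+j}_{\chi+\epsilon_i}c^{+i}_{\chi}=c^{+i}_{\chi+\epsilon_j}c^{+j}_{\chi},\qquad c^{-j}_{\chi+\epsilon_j}c^{-i}_{\chi+\epsilon_i+\epsilon_j}=c^{-i}_{\chi+\epsilon_i}c^{-j}_{\chi+\epsilon_i+\epsilon_j},\qquad c^{-j}_{\chi+\epsilon_i+\epsilon_j}c^{+i}_{\chi+\epsilon_j}=c^{+i}_\chi c^{-j}_{\chi+\epsilon_j}.$$ Here, for $x,\,y=x+\epsilon_i\in\Lambda(\lambda)$, the isomorphism sends $c^{+i}_{x|_T}$ to $m^p(x-y)\colon\ell(y|_T)\to\ell(x|_T)$, $c^{-i}_{y|_T}$ to $m^p(y-x)\colon\ell(x|_T)\to\ell(y|_T)$, and $s_i$ to $z_iw_i$. -/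

import Mathlib

noncomputable section

namespace Hypertoric

open CategoryTheory TopologicalSpace AlgebraicGeometry Opposite

section ProjTilde

variable {A : Type} [CommRing A] (𝒜 : ℕ → Submodule ℤ A) [GradedRing 𝒜]
variable {M : Type} [AddCommGroup M] [Module A M] (𝓜 : ℕ → Submodule ℤ M)

/-- The complement of the homogeneous prime ideal of a point of `Proj`. -/
abbrev ptCompl (x : ProjectiveSpectrum 𝒜) : Submonoid A :=
  x.asHomogeneousIdeal.toIdeal.primeCompl

/-- The dependent function `s` on the open set `U` is near every point given by a fraction `m / f`
with `m ∈ 𝓜 d` and `f ∈ 𝒜 d` for some `d`. -/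
def IsLocallyFraction (U : Opens (ProjectiveSpectrum 𝒜))
    (s : ∀ x : U, LocalizedModule (ptCompl 𝒜 x.1) M) : Prop :=
  ∀ x : U, ∃ V : Opens (ProjectiveSpectrum 𝒜), x.1 ∈ V ∧ ∃ hVU : V ≤ U,
    ∃ d : ℕ, ∃ m ∈ 𝓜 d, ∃ f ∈ 𝒜 d, ∀ y : V, ∃ hf : f ∈ ptCompl 𝒜 y.1,
      s ⟨y.1, hVU y.2⟩ = LocalizedModule.mk m ⟨f, hf⟩

variable [SetLike.GradedSMul 𝒜 𝓜]

/-- Sections over `U` of the sheaf on `Proj` associated with a graded module. -/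
def tildeSections (U : Opens (ProjectiveSpectrum 𝒜)) :
    AddSubgroup (∀ x : U, LocalizedModule (ptCompl 𝒜 x.1) M) where
  carrier := {s | IsLocallyFraction 𝒜 𝓜 U s}
  zero_mem' x := ⟨U, x.2, le_rfl, 0, 0, zero_mem _, 1, SetLike.GradedOne.one_mem, fun y =>
    ⟨one_mem _, by simp⟩⟩
  neg_mem' := by
    intro s hs x
    obtain ⟨V, hxV, hVU, d, m, hm, f, hf, h⟩ := hs x
    refine ⟨V, hxV, hVU, d, -m, neg_mem hm, f, hf, fun y => ?_⟩
    obtain ⟨hy, e⟩ := h y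
    exact ⟨hy, by rw [Pi.neg_apply, e, LocalizedModule.mk_neg]⟩
  add_mem' := by
    intro s t hs ht x
    obtain ⟨V, hxV, hVU, d, m, hm, f, hf, h⟩ := hs x
    obtain ⟨V', hxV', hVU', d', m', hm', f', hf', h'⟩ := ht x
    refine ⟨V ⊓ V', ⟨hxV, hxV'⟩, inf_le_left.trans hVU, d + d', f' • m + f • m', ?_, f * f',
      SetLike.GradedMul.mul_mem hf hf', fun y => ?_⟩
    · refine add_mem ?_ (SetLike.GradedSMul.smul_mem hf hm')
      rw [add_comm d d']
      exact SetLike.GradedSMul.smul_mem hf' hm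
    · obtain ⟨hy, e⟩ := h ⟨y.1, y.2.1⟩
      obtain ⟨hy', e'⟩ := h' ⟨y.1, y.2.2⟩
      refine ⟨mul_mem hy hy', ?_⟩
      rw [Pi.add_apply, e, e', LocalizedModule.mk_add_mk]
      rfl

/-- Restriction of sections. -/
def tildeRes {U V : Opens (ProjectiveSpectrum 𝒜)} (h : V ≤ U) :
    tildeSections 𝒜 𝓜 U →+ tildeSections 𝒜 𝓜 V where
  toFun s := ⟨fun x => s.1 ⟨x.1, h x.2⟩, by
    intro x
    obtain ⟨W, hxW, hWU, d, m, hm, f, hf, hh⟩ := s.2 ⟨x.1, h x.2⟩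
    exact ⟨W ⊓ V, ⟨hxW, x.2⟩, inf_le_right, d, m, hm, f, hf, fun y => hh ⟨y.1, y.2.1⟩⟩⟩
  map_zero' := rfl
  map_add' _ _ := rfl

/-- The presheaf of abelian groups underlying the sheaf associated with a graded module. -/
def tildePresheaf : (Opens (Proj 𝒜))ᵒᵖ ⥤ Ab.{0} where
  obj U := AddCommGrpCat.of (tildeSections 𝒜 𝓜 U.unop)
  map i := AddCommGrpCat.ofHom (tildeRes 𝒜 𝓜 (leOfHom i.unop))

/-- Sections of the structure sheaf of `Proj` act on sections by multiplication at every point. -/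
def tildeSMul (U : Opens (ProjectiveSpectrum 𝒜))
    (r : (ProjectiveSpectrum.Proj.structureSheaf 𝒜).1.obj (op U)) (s : tildeSections 𝒜 𝓜 U) :
    tildeSections 𝒜 𝓜 U :=
  ⟨fun x => (r.1 x).val • s.1 x, by
    intro x
    obtain ⟨V, hxV, hVU, d, m, hm, f, hf, h⟩ := s.2 x
    obtain ⟨V', hxV', i, d', a, b, hb, h'⟩ := r.2 x
    refine ⟨V ⊓ V', ⟨hxV, hxV'⟩, inf_le_left.trans hVU, d' + d, a.1 • m,
      SetLike.GradedSMul.smul_mem a.2 hm, b.1 * f, SetLike.GradedMul.mul_mem b.2 hf, fun y => ?_⟩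
    obtain ⟨hy, e⟩ := h ⟨y.1, y.2.1⟩
    have e' := h' ⟨y.1, y.2.2⟩
    refine ⟨mul_mem (hb ⟨y.1, y.2.2⟩) hy, ?_⟩
    have e'' : r.1 ⟨y.1, hVU y.2.1⟩ = _ := e'
    show (r.1 ⟨y.1, hVU y.2.1⟩).val • s.1 ⟨y.1, hVU y.2.1⟩ = _
    rw [e, e'', HomogeneousLocalization.val_mk, LocalizedModule.mk_smul_mk]
    rfl⟩

theorem tildeSMul_mul (U : Opens (ProjectiveSpectrum 𝒜))
    (r r' : (ProjectiveSpectrum.Proj.structureSheaf 𝒜).1.obj (op U)) (s : tildeSections 𝒜 𝓜 U) :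
    tildeSMul 𝒜 𝓜 U (r * r') s = tildeSMul 𝒜 𝓜 U r (tildeSMul 𝒜 𝓜 U r' s) :=
  Subtype.ext (funext fun x => by
    show (r.1 x * r'.1 x).val • s.1 x = (r.1 x).val • (r'.1 x).val • s.1 x
    rw [HomogeneousLocalization.val_mul, mul_smul])

theorem add_tildeSMul (U : Opens (ProjectiveSpectrum 𝒜))
    (r r' : (ProjectiveSpectrum.Proj.structureSheaf 𝒜).1.obj (op U)) (s : tildeSections 𝒜 𝓜 U) :
    tildeSMul 𝒜 𝓜 U (r + r') s = tildeSMul 𝒜 𝓜 U r s + tildeSMul 𝒜 𝓜 U r' s :=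
  Subtype.ext (funext fun x => by
    show (r.1 x + r'.1 x).val • s.1 x = (r.1 x).val • s.1 x + (r'.1 x).val • s.1 x
    rw [HomogeneousLocalization.val_add, add_smul])

instance tildeModule (U : (Opens (Proj 𝒜))ᵒᵖ) :
    Module ((Proj 𝒜).ringCatSheaf.obj.obj U) ((tildePresheaf 𝒜 𝓜).obj U) where
  smul r s := tildeSMul 𝒜 𝓜 U.unop r s
  one_smul s := Subtype.ext (funext fun x => by
    show HomogeneousLocalization.val 1 • s.1 x = s.1 x
    rw [HomogeneousLocalization.val_one, one_smul])
  mul_smul r r' s := tildeSMul_mul 𝒜 𝓜 U.unop r r' s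
  smul_zero r := Subtype.ext (funext fun x => smul_zero _)
  smul_add r s s' := Subtype.ext (funext fun x => smul_add _ _ _)
  add_smul r r' s := add_tildeSMul 𝒜 𝓜 U.unop r r' s
  zero_smul s := Subtype.ext (funext fun x => by
    show HomogeneousLocalization.val 0 • s.1 x = 0
    rw [HomogeneousLocalization.val_zero, zero_smul])

/-- Being locally a fraction is a local condition. -/
def fractionPredicate : TopCat.LocalPredicate
    (fun x : ProjectiveSpectrum.top 𝒜 => LocalizedModule (ptCompl 𝒜 x) M) where
  pred {U} s := IsLocallyFraction 𝒜 𝓜 U s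
  res := by
    intro V U i s hs x
    obtain ⟨W, hxW, hWU, d, m, hm, f, hf, hh⟩ := hs (i x)
    exact ⟨W ⊓ V, ⟨hxW, x.2⟩, inf_le_right, d, m, hm, f, hf, fun y => hh ⟨y.1, y.2.1⟩⟩
  locality := by
    intro U s hs x
    obtain ⟨V, hxV, i, hV⟩ := hs x
    obtain ⟨W, hxW, hWV, d, m, hm, f, hf, hh⟩ := hV ⟨x.1, hxV⟩
    exact ⟨W, hxW, hWV.trans (leOfHom i), d, m, hm, f, hf, hh⟩

/-- The sheaf of modules on `Proj 𝒜` associated with the graded module `⨁ d, 𝓜 d`. -/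
def tilde : (Proj 𝒜).Modules where
  val := PresheafOfModules.ofPresheaf (tildePresheaf 𝒜 𝓜) fun _ _ _ _ _ => rfl
  isSheaf := (TopCat.Presheaf.isSheaf_iff_isSheaf_comp (forget AddCommGrpCat) _).2
    (TopCat.subsheafToTypes (fractionPredicate 𝒜 𝓜)).2

variable {𝒜} {𝓜}
variable {N : Type} [AddCommGroup N] [Module A N] {𝓝 : ℕ → Submodule ℤ N}
  [SetLike.GradedSMul 𝒜 𝓝]

/-- The map on sections induced by a homomorphism of graded modules. -/
def tildeSectionsMap (g : M →ₗ[A] N) (hg : ∀ d, ∀ m ∈ 𝓜 d, g m ∈ 𝓝 d)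
    (U : Opens (ProjectiveSpectrum 𝒜)) : tildeSections 𝒜 𝓜 U →+ tildeSections 𝒜 𝓝 U where
  toFun s := ⟨fun x => LocalizedModule.map (ptCompl 𝒜 x.1) g (s.1 x), by
    intro x
    obtain ⟨V, hxV, hVU, d, m, hm, f, hf, h⟩ := s.2 x
    refine ⟨V, hxV, hVU, d, g m, hg d m hm, f, hf, fun y => ?_⟩
    obtain ⟨hy, e⟩ := h y
    refine ⟨hy, ?_⟩
    show LocalizedModule.map (ptCompl 𝒜 y.1) g (s.1 ⟨y.1, hVU y.2⟩) = _
    rw [e, LocalizedModule.map_mk]⟩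
  map_zero' := Subtype.ext (funext fun x => map_zero _)
  map_add' s t := Subtype.ext (funext fun x => map_add _ _ _)

/-- The morphism of sheaves of modules induced by a homomorphism of graded modules. -/
def tildeMap (g : M →ₗ[A] N) (hg : ∀ d, ∀ m ∈ 𝓜 d, g m ∈ 𝓝 d) : tilde 𝒜 𝓜 ⟶ tilde 𝒜 𝓝 where
  val := PresheafOfModules.homMk
    { app U := AddCommGrpCat.ofHom (tildeSectionsMap g hg U.unop) }
    fun U r s => Subtype.ext (funext fun x => map_smul _ _ _)

end ProjTilde

section Rings

variable {n : ℕ}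

/-- Variables: the coordinates `z i`, the dual coordinates `w i`, and the extra variable `t`. -/
inductive HVar (n : ℕ)
  | z (i : Fin n)
  | w (i : Fin n)
  | t

/-- The restriction of characters of the torus `D` of diagonal matrices to the subtorus `T` with
cocharacter lattice `L`. -/
def charRes (L : Submodule ℤ (Fin n → ℤ)) : (Fin n → ℤ) →ₗ[ℤ] Module.Dual ℤ L :=
  LinearMap.mk₂ ℤ (fun x v => ∑ i, x i * v.1 i)
    (fun x y v => by simp [add_mul, Finset.sum_add_distrib])
    (fun c x v => by simp [Finset.mul_sum, mul_assoc])
    (fun x v w => by simp [mul_add, Finset.sum_add_distrib])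
    (fun c x v => by simp [Finset.mul_sum, mul_left_comm])

variable (L : Submodule ℤ (Fin n → ℤ)) (α : Module.Dual ℤ L)

/-- The `T`-weights of the variables. -/
def wtT : HVar n → Module.Dual ℤ L
  | .z i => charRes L (Pi.single i 1)
  | .w i => -charRes L (Pi.single i 1)
  | .t => -α

/-- The degree in the variable `t`. -/
def degt : HVar n → ℕ
  | .z _ => 0
  | .w _ => 0
  | .t => 1

/-- The `𝕊`-weights of the variables: `𝕊 = 𝔾ₘ` scales all `z i` and all `w i` with weight one. -/
def wtS : HVar n → ℕ
  | .z _ => 1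
  | .w _ => 1
  | .t => 0

/-- The ring `ℤ[z₁, …, zₙ, w₁, …, wₙ, t]`. -/
abbrev Poly (n : ℕ) : Type := MvPolynomial (HVar n) ℤ

/-- The `T`-semi-invariant polynomials of weight `χ`. -/
abbrev polyT (χ : Module.Dual ℤ L) : Submodule ℤ (Poly n) :=
  MvPolynomial.weightedHomogeneousSubmodule ℤ (wtT L α) χ

/-- The polynomials that are homogeneous of degree `d` in `t`. -/
abbrev polyt (d : ℕ) : Submodule ℤ (Poly n) :=
  MvPolynomial.weightedHomogeneousSubmodule ℤ degt d

/-- The polynomials of `𝕊`-weight `e`. -/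
abbrev polyS (e : ℕ) : Submodule ℤ (Poly n) :=
  MvPolynomial.weightedHomogeneousSubmodule ℤ wtS e

/-- The ring of `T`-invariant polynomials. -/
def invariants : Subalgebra ℤ (Poly n) where
  carrier := {f | f ∈ polyT L α 0}
  mul_mem' {f g} hf hg := by
    have := MvPolynomial.IsWeightedHomogeneous.mul hf hg
    rw [add_zero] at this
    exact this
  add_mem' hf hg := (polyT L α 0).add_mem hf hg
  algebraMap_mem' r := MvPolynomial.isWeightedHomogeneous_C _ _

/-- The moment map: the cocharacter `χ` is sent to `∑ i, χ i * z i * w i`. -/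
def moment (χ : Fin n → ℤ) : Poly n :=
  ∑ i, MvPolynomial.C (χ i) * (MvPolynomial.X (.z i) * MvPolynomial.X (.w i))

theorem moment_mem (χ : Fin n → ℤ) : moment χ ∈ invariants L α := by
  refine Subalgebra.sum_mem _ fun i _ => Subalgebra.mul_mem _ (Subalgebra.algebraMap_mem _ _) ?_
  have := MvPolynomial.IsWeightedHomogeneous.mul
    (MvPolynomial.isWeightedHomogeneous_X ℤ (wtT L α) (.z i))
    (MvPolynomial.isWeightedHomogeneous_X ℤ (wtT L α) (.w i))
  have h : wtT L α (.z i) + wtT L α (.w i) = 0 := by simp [wtT]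
  rw [h] at this
  exact this

theorem moment_mem_polyt (χ : Fin n → ℤ) : moment χ ∈ polyt 0 := by
  refine Submodule.sum_mem _ fun i _ => ?_
  have := MvPolynomial.IsWeightedHomogeneous.mul
    (MvPolynomial.isWeightedHomogeneous_C (degt (n := n)) (χ i))
    (MvPolynomial.IsWeightedHomogeneous.mul
    (MvPolynomial.isWeightedHomogeneous_X ℤ degt (.z i))
    (MvPolynomial.isWeightedHomogeneous_X ℤ degt (.w i)))
  simpa [degt] using this

/-- The ideal of the ring of invariants generated by the image of the moment map. -/
def momentIdealInv : Ideal (invariants L α) :=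
  Ideal.span {f | ∃ χ ∈ L, f.1 = moment χ}

/-- The ideal of the polynomial ring generated by the image of the moment map. -/
def momentIdeal : Ideal (Poly n) :=
  Ideal.span {f | ∃ χ ∈ L, f = moment χ}

/-- The ring `ℤ[z, w, t]^T / ⟨μ*(χ)⟩`. -/
def CoordRing : Type := invariants L α ⧸ momentIdealInv L α

instance : CommRing (CoordRing L α) :=
  inferInstanceAs (CommRing (invariants L α ⧸ momentIdealInv L α))

/-- The class of an invariant polynomial. -/
def coordMk : invariants L α →+* CoordRing L α := Ideal.Quotient.mk (momentIdealInv L α)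

/-- The grading of `CoordRing` by the degree in `t`. -/
def coordGrading (d : ℕ) : Submodule ℤ (CoordRing L α) :=
  ((polyt d).comap (invariants L α).val.toLinearMap).map
    (coordMk L α).toAddMonoidHom.toIntLinearMap

/-- The ring `ℤ[z, w, t] / ⟨μ*(χ)⟩` of functions on `μ⁻¹(0) × 𝔸¹`. -/
def TotalRing : Type := Poly n ⧸ momentIdeal L

instance : CommRing (TotalRing L) := inferInstanceAs (CommRing (Poly n ⧸ momentIdeal L))

/-- The class of a polynomial. -/
def totalMk : Poly n →+* TotalRing L := Ideal.Quotient.mk (momentIdeal L)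

theorem momentIdealInv_le :
    momentIdealInv L α ≤ (momentIdeal L).comap (invariants L α).val.toRingHom := by
  refine Ideal.span_le.2 ?_
  rintro f ⟨χ, hχ, e⟩
  exact Ideal.subset_span ⟨χ, hχ, e⟩

instance coordAlgebra : Algebra (CoordRing L α) (TotalRing L) :=
  (Ideal.quotientMap (momentIdeal L) (invariants L α).val.toRingHom
    (momentIdealInv_le L α)).toAlgebra

/-- Elements of `TotalRing` of `T`-weight `χ` and degree `d` in `t`. -/
def semiInv (χ : Module.Dual ℤ L) (d : ℕ) : Submodule ℤ (TotalRing L) :=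
  (polyT L α χ ⊓ polyt d).map (totalMk L).toAddMonoidHom.toIntLinearMap

instance semiInv_gradedSMul (χ : Module.Dual ℤ L) :
    SetLike.GradedSMul (coordGrading L α) (semiInv L α χ) where
  smul_mem := by
    rintro i j _ _ ⟨f, hf, rfl⟩ ⟨g, hg, rfl⟩
    refine ⟨f.1 * g, ⟨?_, ?_⟩, ?_⟩
    · have := MvPolynomial.IsWeightedHomogeneous.mul f.2 hg.1
      rw [zero_add] at this
      exact this
    · exact MvPolynomial.IsWeightedHomogeneous.mul hf hg.2
    · rfl

instance coord_gradedMonoid : SetLike.GradedMonoid (coordGrading L α) where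
  one_mem := ⟨1, MvPolynomial.isWeightedHomogeneous_one _ _, rfl⟩
  mul_mem := by
    rintro i j _ _ ⟨f, hf, rfl⟩ ⟨g, hg, rfl⟩
    exact ⟨f * g, MvPolynomial.IsWeightedHomogeneous.mul hf hg, rfl⟩

/-- A family of submodules with projections onto its members is a direct sum decomposition. -/
theorem isInternal_of_proj {R : Type} [AddCommGroup R] (ℛ : ℕ → Submodule ℤ R)
    (π : ℕ → R →ₗ[ℤ] R) (h₁ : ∀ d, ∀ x ∈ ℛ d, π d x = x)
    (h₂ : ∀ d e, e ≠ d → ∀ x ∈ ℛ e, π d x = 0) (h₃ : ⨆ d, ℛ d = ⊤) :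
    DirectSum.IsInternal ℛ := by
  rw [DirectSum.isInternal_submodule_iff_iSupIndep_and_iSup_eq_top]
  refine ⟨fun d => ?_, h₃⟩
  rw [Submodule.disjoint_def]
  intro x hx hx'
  have hle : ⨆ e, ⨆ (_ : e ≠ d), ℛ e ≤ LinearMap.ker (π d) :=
    iSup_le fun e => iSup_le fun he y hy => h₂ d e he y hy
  rw [← h₁ d x hx]
  exact hle hx'

/-- The grading of the ring of invariants by the degree in `t`. -/
def invGrading (d : ℕ) : Submodule ℤ (invariants L α) :=
  (polyt d).comap (invariants L α).val.toLinearMap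

instance inv_gradedMonoid : SetLike.GradedMonoid (invGrading L α) where
  one_mem := MvPolynomial.isWeightedHomogeneous_one _ _
  mul_mem _ _ _ _ hf hg := MvPolynomial.IsWeightedHomogeneous.mul hf hg

theorem component_mem (d : ℕ) (f : Poly n) (hf : f ∈ invariants L α) :
    MvPolynomial.weightedHomogeneousComponent degt d f ∈ invariants L α := by
  classical
  intro m hm
  rw [MvPolynomial.coeff_weightedHomogeneousComponent] at hm
  split_ifs at hm with h
  · exact hf hm
  · exact absurd rfl hm

theorem inv_isInternal : DirectSum.IsInternal (invGrading L α) := by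
  refine isInternal_of_proj _ (fun d => (MvPolynomial.weightedHomogeneousComponent degt d).restrict
    (p := (invariants L α).toSubmodule) (q := (invariants L α).toSubmodule)
    (component_mem L α d)) ?_ ?_ ?_
  · intro d x hx
    exact Subtype.ext (MvPolynomial.IsWeightedHomogeneous.weightedHomogeneousComponent_same hx)
  · intro d e he x hx
    exact Subtype.ext (MvPolynomial.IsWeightedHomogeneous.weightedHomogeneousComponent_ne _ hx he.symm)
  · refine eq_top_iff.2 fun f _ => ?_
    have hfin := MvPolynomial.weightedHomogeneousComponent_finsupp (w := degt) f.1
    have hf : f = ∑ d ∈ hfin.toFinset, (⟨MvPolynomial.weightedHomogeneousComponent degt d f.1,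
        component_mem L α d f.1 f.2⟩ : invariants L α) := by
      refine Subtype.ext ?_
      rw [AddSubmonoidClass.coe_finsetSum, ← finsum_eq_sum _ hfin]
      exact (MvPolynomial.finsum_weightedHomogeneousComponent degt f.1).symm
    rw [hf]
    refine Submodule.sum_mem _ fun d _ => Submodule.mem_iSup_of_mem d ?_
    exact MvPolynomial.weightedHomogeneousComponent_isWeightedHomogeneous _ _

instance invGraded : GradedRing (invGrading L α) :=
  { inv_gradedMonoid L α, (inv_isInternal L α).chooseDecomposition with }

theorem momentIdealInv_homogeneous : (momentIdealInv L α).IsHomogeneous (invGrading L α) := by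
  refine Ideal.homogeneous_span _ _ ?_
  rintro f ⟨χ, hχ, e⟩
  refine ⟨0, ?_⟩
  show f.1 ∈ polyt 0
  rw [e]
  exact moment_mem_polyt χ

/-- The projection of `CoordRing` onto its part of degree `d`. -/
def coordProj (d : ℕ) : CoordRing L α →ₗ[ℤ] CoordRing L α :=
  (QuotientAddGroup.map (momentIdealInv L α).toAddSubgroup (momentIdealInv L α).toAddSubgroup
    (GradedRing.proj (invGrading L α) d)
    (fun _ hf => momentIdealInv_homogeneous L α d hf)).toIntLinearMap

theorem coordProj_mk (d : ℕ) (f : invariants L α) :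
    coordProj L α d (coordMk L α f) = coordMk L α (GradedRing.proj (invGrading L α) d f) := rfl

theorem coord_isInternal : DirectSum.IsInternal (coordGrading L α) := by
  refine isInternal_of_proj _ (coordProj L α) ?_ ?_ ?_
  · rintro d _ ⟨f, hf, rfl⟩
    show coordProj L α d (coordMk L α f) = coordMk L α f
    rw [coordProj_mk, GradedRing.proj_apply, DirectSum.decompose_of_mem_same (invGrading L α) hf]
  · rintro d e he _ ⟨f, hf, rfl⟩
    show coordProj L α d (coordMk L α f) = 0
    rw [coordProj_mk, GradedRing.proj_apply, DirectSum.decompose_of_mem_ne (invGrading L α) hf he, map_zero]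
  · classical
    refine eq_top_iff.2 fun x _ => ?_
    obtain ⟨f, rfl⟩ := Ideal.Quotient.mk_surjective x
    have hf := DirectSum.sum_support_decompose (invGrading L α) f
    rw [← hf]
    show coordMk L α _ ∈ _
    rw [map_sum]
    exact Submodule.sum_mem _ fun d _ => Submodule.mem_iSup_of_mem d
      ⟨_, (DirectSum.decompose (invGrading L α) f d).2, rfl⟩

instance coordGraded : GradedRing (coordGrading L α) :=
  { coord_gradedMonoid L α, (coord_isInternal L α).chooseDecomposition with }

end Rings

section Weights

variable {n : ℕ} (L : Submodule ℤ (Fin n → ℤ))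
variable (p : ℕ) (lam : Module.Dual ℤ L)

/-- The set `Λ(lam)`: the vectors `x` for which some integral `a` with `a|_T = lam` satisfies
`p * x i ≤ a i < p * x i + p` for all `i`. -/
def LambdaSet : Set (Fin n → ℤ) :=
  {x | ∃ a : Fin n → ℤ, charRes L a = lam ∧ ∀ i, p * x i ≤ a i ∧ a i < p * x i + p}

/-- The set of restrictions to `T` of the elements of `Λ(lam)`; this is the quotient of `Λ(lam)` by
the relation that two elements have the same restriction to `T`. -/
def LambdaBar : Set (Module.Dual ℤ L) := charRes L '' LambdaSet L p lam

instance finite_LambdaBar : Finite (LambdaBar L p lam) := by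
  rcases Nat.eq_zero_or_pos p with rfl | hp
  · refine (Set.Finite.image _ ?_).to_subtype
    rcases Nat.eq_zero_or_pos n with rfl | hn
    · exact Set.toFinite _
    · refine Set.finite_empty.subset ?_
      rintro x ⟨a, -, h⟩
      have := h ⟨0, hn⟩
      simp only [Nat.cast_zero, zero_mul, zero_add] at this
      omega
  · have hfin : (charRes L '' Set.Icc 0 (fun _ => (p : ℤ))).Finite := (Set.finite_Icc _ _).image _
    refine ((hfin.preimage (f := fun χ : Module.Dual ℤ L => lam - (p : ℤ) • χ)
      (Function.Injective.injOn fun χ ψ h => ?_)).subset ?_).to_subtype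
    · ext v
      have h' := LinearMap.congr_fun h v
      simp only [LinearMap.sub_apply, LinearMap.smul_apply, smul_eq_mul, sub_right_inj] at h'
      exact mul_left_cancel₀ (by exact_mod_cast hp.ne') h'
    · rintro _ ⟨x, ⟨a, ha, h⟩, rfl⟩
      refine ⟨a - (p : ℤ) • x, ⟨fun i => ?_, fun i => ?_⟩, ?_⟩
      · have := h i
        simp only [Pi.zero_apply, Pi.sub_apply, Pi.smul_apply, smul_eq_mul]
        omega
      · have := h i
        simp only [Pi.sub_apply, Pi.smul_apply, smul_eq_mul]
        omega
      · rw [map_sub, map_smul, ha]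

end Weights

section Main

variable {n : ℕ} (L : Submodule ℤ (Fin n → ℤ)) (α : Module.Dual ℤ L)

/-- The hypertoric variety `𝔐` over `ℤ`. -/
abbrev hypertoric : Scheme.{0} := Proj (coordGrading L α)

/-- The line bundle on `𝔐` associated with a character `χ` of `T`: its sections over an open set
are the `T`-semi-invariant functions of weight `χ`. -/
def lineBundle (χ : Module.Dual ℤ L) : (hypertoric L α).Modules :=
  tilde (coordGrading L α) (semiInv L α χ)

theorem mul_mem_semiInv {χ ψ : Module.Dual ℤ L} {g : Poly n} (hg : g ∈ polyT L α (ψ - χ))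
    (hg' : g ∈ polyt 0) (d : ℕ) (m : TotalRing L) (hm : m ∈ semiInv L α χ d) :
    totalMk L g * m ∈ semiInv L α ψ d := by
  obtain ⟨f, hf, rfl⟩ := hm
  refine ⟨g * f, ⟨?_, ?_⟩, rfl⟩
  · have := MvPolynomial.IsWeightedHomogeneous.mul hg hf.1
    rw [sub_add_cancel] at this
    exact this
  · have := MvPolynomial.IsWeightedHomogeneous.mul hg' hf.2
    rw [zero_add] at this
    exact this

/-- Multiplication by a `T`-semi-invariant polynomial of weight `ψ - χ` in the `z i` and `w i`. -/
def mulHom {χ ψ : Module.Dual ℤ L} (g : Poly n) (hg : g ∈ polyT L α (ψ - χ))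
    (hg' : g ∈ polyt 0) : lineBundle L α χ ⟶ lineBundle L α ψ :=
  tildeMap (LinearMap.mulLeft (CoordRing L α) (totalMk L g)) (mul_mem_semiInv L α hg hg')

/-- The monomial `∏_{x i > 0} z i ^ (x i) * ∏_{x i < 0} w i ^ (-x i)`. -/
def mono (x : Fin n → ℤ) : Poly n :=
  ∏ i, (MvPolynomial.X (.z i) ^ (x i).toNat * MvPolynomial.X (.w i) ^ (-x i).toNat)

theorem mono_mem_polyT (x : Fin n → ℤ) : mono x ∈ polyT L α (charRes L x) := by
  have h := MvPolynomial.IsWeightedHomogeneous.prod (w := wtT L α) Finset.univ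
    (fun i => (MvPolynomial.X (.z i) ^ (x i).toNat *
      MvPolynomial.X (.w i) ^ (-x i).toNat : Poly n))
    (fun i => (x i).toNat • wtT L α (.z i) + (-x i).toNat • wtT L α (.w i))
    (fun i _ => .mul (.pow (MvPolynomial.isWeightedHomogeneous_X _ _ _) _)
      (.pow (MvPolynomial.isWeightedHomogeneous_X _ _ _) _))
  have e : ∑ i, ((x i).toNat • wtT L α (.z i) + (-x i).toNat • wtT L α (.w i)) =
      charRes L x := by
    conv_rhs => rw [← Finset.univ_sum_single x]
    rw [map_sum]
    refine Finset.sum_congr rfl fun i _ => ?_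
    have e1 : Pi.single (M := fun _ => ℤ) i (x i) = x i • Pi.single i 1 := by
      rw [← Pi.single_smul]; simp
    rw [e1, map_smul]
    simp only [wtT, smul_neg]
    rw [← natCast_zsmul, ← natCast_zsmul, ← sub_eq_add_neg, ← sub_smul]
    congr 1
    omega
  rw [e] at h
  exact h

theorem mono_mem_polyt (x : Fin n → ℤ) : mono x ∈ polyt 0 := by
  have h := MvPolynomial.IsWeightedHomogeneous.prod (w := degt) Finset.univ
    (fun i => (MvPolynomial.X (.z i) ^ (x i).toNat *
      MvPolynomial.X (.w i) ^ (-x i).toNat : Poly n))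
    (fun i => (x i).toNat • degt (.z i) + (-x i).toNat • degt (.w i))
    (fun i _ => .mul (.pow (MvPolynomial.isWeightedHomogeneous_X _ _ _) _)
      (.pow (MvPolynomial.isWeightedHomogeneous_X _ _ _) _))
  simpa [degt, mono] using h

/-- The homomorphism `ℓ(x) ⟶ ℓ(y)` given by multiplication by the monomial of `y - x`. -/
def monoHom (x y : Fin n → ℤ) :
    lineBundle L α (charRes L x) ⟶ lineBundle L α (charRes L y) :=
  mulHom L α (mono (y - x)) (by rw [← map_sub]; exact mono_mem_polyT L α _)
    (mono_mem_polyt _)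

/-- The function `z i * w i`. -/
def zw (i : Fin n) : Poly n := MvPolynomial.X (.z i) * MvPolynomial.X (.w i)

theorem zw_mem_polyT (i : Fin n) (χ : Module.Dual ℤ L) : zw i ∈ polyT L α (χ - χ) := by
  have := MvPolynomial.IsWeightedHomogeneous.mul
    (MvPolynomial.isWeightedHomogeneous_X ℤ (wtT L α) (.z i))
    (MvPolynomial.isWeightedHomogeneous_X ℤ (wtT L α) (.w i))
  have h : wtT L α (.z i) + wtT L α (.w i) = χ - χ := by simp [wtT]
  rw [h] at this
  exact this

theorem zw_mem_polyt (i : Fin n) : zw i ∈ polyt 0 :=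
  MvPolynomial.IsWeightedHomogeneous.mul
    (MvPolynomial.isWeightedHomogeneous_X ℤ degt (.z i))
    (MvPolynomial.isWeightedHomogeneous_X ℤ degt (.w i))

/-- Multiplication by the function `z i * w i` on `ℓ(χ)`. -/
def zwHom (χ : Module.Dual ℤ L) (i : Fin n) : lineBundle L α χ ⟶ lineBundle L α χ :=
  mulHom L α (zw i) (zw_mem_polyT L α i χ) (zw_mem_polyt i)

/-- The section `s` of `ℓ(χ)` over `U` has `𝕊`-weight `e`: near every point it is a fraction `m / f`
of `𝕊`-homogeneous elements of `𝕊`-weights `a` and `b` with `a - b = e`. -/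
def IsSHomogeneous (χ : Module.Dual ℤ L) (e : ℤ) (U : Opens (ProjectiveSpectrum (coordGrading L α)))
    (s : tildeSections (coordGrading L α) (semiInv L α χ) U) : Prop :=
  ∀ x : U, ∃ V : Opens (ProjectiveSpectrum (coordGrading L α)), x.1 ∈ V ∧ ∃ hVU : V ≤ U, ∃ d a b : ℕ, (a : ℤ) - b = e ∧
    ∃ m ∈ polyT L α χ ⊓ polyt d ⊓ polyS a, ∃ f : invariants L α, f.1 ∈ polyt d ⊓ polyS b ∧
      ∀ y : V, ∃ hf : coordMk L α f ∈ ptCompl (coordGrading L α) y.1,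
        s.1 ⟨y.1, hVU y.2⟩ = LocalizedModule.mk (totalMk L m) ⟨coordMk L α f, hf⟩

/-- A homomorphism `ℓ(χ) ⟶ ℓ(ψ)` has `𝕊`-weight `d` if it raises the `𝕊`-weights of sections
by `d`. -/
def HomHasSWeight {χ ψ : Module.Dual ℤ L} (d : ℤ) (φ : lineBundle L α χ ⟶ lineBundle L α ψ) :
    Prop :=
  ∀ (U : Opens (ProjectiveSpectrum (coordGrading L α))) (e : ℤ)
    (s : tildeSections (coordGrading L α) (semiInv L α χ) U),
    IsSHomogeneous L α χ e U s → IsSHomogeneous L α ψ (e + d) U (φ.app U s)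

variable (p : ℕ) (lam : Module.Dual ℤ L)

instance modules_hasFiniteBiproducts (X : Scheme.{0}) : Limits.HasFiniteBiproducts X.Modules :=
  Abelian.hasFiniteBiproducts

/-- The sheaf `𝒯`, the direct sum of the line bundles `ℓ(χ)` over `χ` in `LambdaBar`. Coherent
sheaves form a full subcategory of the category of sheaves of modules, so the endomorphisms of `𝒯`
as a coherent sheaf are its endomorphisms as a sheaf of modules. -/
def tilt : (hypertoric L α).Modules :=
  Limits.biproduct fun χ : LambdaBar L p lam => lineBundle L α χ.1

/-- The class of an element of `Λ(lam)`. -/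
def toBar (x : LambdaSet L p lam) : LambdaBar L p lam := ⟨charRes L x.1, x.1, x.2, rfl⟩

/-- The inclusion of a summand. -/
def tiltIncl (χ : LambdaBar L p lam) : lineBundle L α χ.1 ⟶ tilt L α p lam :=
  Limits.biproduct.ι (fun χ : LambdaBar L p lam => lineBundle L α χ.1) χ

/-- The projection onto a summand. -/
def tiltProj (χ : LambdaBar L p lam) : tilt L α p lam ⟶ lineBundle L α χ.1 :=
  Limits.biproduct.π (fun χ : LambdaBar L p lam => lineBundle L α χ.1) χ

/-- The endomorphism of `𝒯` given by the monomial of `y - x` as a map from the summand `ℓ(x)` to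
the summand `ℓ(y)`. -/
def monoEnd (x y : LambdaSet L p lam) : End (tilt L α p lam) :=
  tiltProj L α p lam (toBar L p lam x) ≫ monoHom L α x.1 y.1 ≫
    tiltIncl L α p lam (toBar L p lam y)

/-- Multiplication by the function `z i * w i` on `𝒯`. -/
def zwEnd (i : Fin n) : End (tilt L α p lam) :=
  Limits.biproduct.map fun χ : LambdaBar L p lam => zwHom L α χ.1 i

/-- The endomorphisms of `𝒯` of `𝕊`-weight `d`. -/
def endWeight (d : ℕ) : Set (End (tilt L α p lam)) :=
  {φ | ∀ χ ψ : LambdaBar L p lam,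
    HomHasSWeight L α d (tiltIncl L α p lam χ ≫ φ ≫ tiltProj L α p lam ψ)}

end Main

section Algebras

variable {n : ℕ} (L : Submodule ℤ (Fin n → ℤ)) (p : ℕ) (lam : Module.Dual ℤ L)

/-- The ring `S = U(𝔤) = Sym(𝔤)` over `ℤ`, where `𝔤 = 𝔡 / 𝔱` is the lattice `ℤⁿ / L`. -/
abbrev SymG : Type := SymmetricAlgebra ℤ ((Fin n → ℤ) ⧸ L)

/-- The image in `S` of the `i`-th coordinate cocharacter. -/
def sElt (i : Fin n) : SymG L := SymmetricAlgebra.ι ℤ _ (L.mkQ (Pi.single i 1))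

theorem toBar_add (i : Fin n) (x y : LambdaSet L p lam) (h : y.1 = x.1 + Pi.single i 1) :
    (toBar L p lam y).1 = (toBar L p lam x).1 + charRes L (Pi.single i 1) := by
  simp only [toBar, h, map_add]

instance fintypeLambdaBar : Fintype (LambdaBar L p lam) := Fintype.ofFinite _

/-- The exponent `(|x i - y i| + |y i - u i| - |x i - u i|) / 2`. -/
def eta (x y u : Fin n → ℤ) (i : Fin n) : ℕ :=
  ((x i - y i).natAbs + (y i - u i).natAbs - (x i - u i).natAbs) / 2

/-- The taxicab distance. -/
def taxi (x y : Fin n → ℤ) : ℕ := ∑ i, (x i - y i).natAbs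

/-- The generators of the algebra `H̄`: idempotents and the elements `c x y`. -/
inductive Gen
  | idem (χ : LambdaBar L p lam)
  | c (x y : LambdaSet L p lam)

open FreeAlgebra in
/-- The relations of the algebra `H̄`: the idempotents are orthogonal with sum `1`, the element
`c x y` lies between the idempotents of (the classes of) `x` and `y`, it depends only on the orbit
of the pair `(x, y)` under simultaneous translation by characters of `D / T`, and
`c x y * c y u = ∏ i, s i ^ η i • c x u`. -/
inductive Rel : FreeAlgebra (SymG L) (Gen L p lam) → FreeAlgebra (SymG L) (Gen L p lam) → Prop
  | sum_idem : Rel (∑ χ, ι _ (.idem χ)) 1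
  | idem_idem (χ) : Rel (ι _ (.idem χ) * ι _ (.idem χ)) (ι _ (.idem χ))
  | idem_ne (χ ψ) (h : χ ≠ ψ) : Rel (ι _ (.idem χ) * ι _ (.idem ψ)) 0
  | idem_c (x y) : Rel (ι _ (.idem (toBar L p lam x)) * ι _ (.c x y)) (ι _ (.c x y))
  | c_idem (x y) : Rel (ι _ (.c x y) * ι _ (.idem (toBar L p lam y))) (ι _ (.c x y))
  | c_self (x) : Rel (ι _ (.c x x)) (ι _ (.idem (toBar L p lam x)))
  | translate (x y x' y') (hx : charRes L (x'.1 - x.1) = 0) (h : x'.1 - x.1 = y'.1 - y.1) :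
      Rel (ι _ (.c x' y')) (ι _ (.c x y))
  | c_c (x y u) : Rel (ι _ (.c x y) * ι _ (.c y u))
      ((∏ i, sElt L i ^ eta x.1 y.1 u.1 i) • ι _ (.c x u))

/-- The algebra `H̄` over `S`. -/
def HBar : Type := RingQuot (Rel L p lam)

instance : Ring (HBar L p lam) := inferInstanceAs (Ring (RingQuot (Rel L p lam)))

instance : Algebra (SymG L) (HBar L p lam) :=
  inferInstanceAs (Algebra (SymG L) (RingQuot (Rel L p lam)))

/-- The image of a generator in `H̄`. -/
def HBar.gen (g : Gen L p lam) : HBar L p lam :=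
  RingQuot.mkAlgHom (SymG L) (Rel L p lam) (FreeAlgebra.ι _ g)

/-- The degrees of the generators of `H̄`. -/
def Gen.deg : Gen L p lam → ℕ
  | .idem _ => 0
  | .c x y => taxi x.1 y.1

/-- The additive span of the products, of total degree `d`, of elements `s i` of degree two and of
elements `gen g` of degree `deg g`. -/
def wordSpan {R X : Type} [Ring R] [Algebra (SymG L) R] (gen : X → R) (deg : X → ℕ) (d : ℕ) :
    Submodule ℤ R :=
  Submodule.span ℤ {r | ∃ (l : List (Fin n)) (w : List X), 2 * l.length + (w.map deg).sum = d ∧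
    r = algebraMap (SymG L) R (l.map (sElt L)).prod * (w.map gen).prod}

/-- The homogeneous part of degree `d` of `H̄`, where `s i` has degree two and `c x y` has degree
the taxicab distance of `x` and `y`. -/
def HBar.grade (d : ℕ) : Submodule ℤ (HBar L p lam) :=
  wordSpan L (HBar.gen L p lam) (Gen.deg L p lam) d

/-- The generators of the quadratic algebra: idempotents and, for neighbouring classes, the
elements `c_x^{+i}` (from the class `χ` of `x` to the class `ψ` of `x + ε_i`) and `c_x^{-i}`
(from the class `χ` of `x` to the class `ψ` of `x - ε_i`). -/
inductive QGen
  | idem (χ : LambdaBar L p lam)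
  | plus (i : Fin n) (χ ψ : LambdaBar L p lam) (h : ψ.1 = χ.1 + charRes L (Pi.single i 1))
  | minus (i : Fin n) (χ ψ : LambdaBar L p lam) (h : χ.1 = ψ.1 + charRes L (Pi.single i 1))

open FreeAlgebra in
/-- The relations of the quadratic algebra: those of a quiver with vertex set `LambdaBar`, and the
quadratic relations for crossing a wall and returning and for going around a face of
codimension two. -/
inductive QRel : FreeAlgebra (SymG L) (QGen L p lam) → FreeAlgebra (SymG L) (QGen L p lam) → Prop
  | sum_idem : QRel (∑ χ, ι _ (.idem χ)) 1
  | idem_idem (χ) : QRel (ι _ (.idem χ) * ι _ (.idem χ)) (ι _ (.idem χ))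
  | idem_ne (χ ψ) (h : χ ≠ ψ) : QRel (ι _ (.idem χ) * ι _ (.idem ψ)) 0
  | idem_plus (i χ ψ h) : QRel (ι _ (.idem ψ) * ι _ (.plus i χ ψ h)) (ι _ (.plus i χ ψ h))
  | plus_idem (i χ ψ h) : QRel (ι _ (.plus i χ ψ h) * ι _ (.idem χ)) (ι _ (.plus i χ ψ h))
  | idem_minus (i χ ψ h) : QRel (ι _ (.idem ψ) * ι _ (.minus i χ ψ h)) (ι _ (.minus i χ ψ h))
  | minus_idem (i χ ψ h) : QRel (ι _ (.minus i χ ψ h) * ι _ (.idem χ)) (ι _ (.minus i χ ψ h))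
  | minus_plus (i χ ψ h) :
      QRel (ι _ (.minus i ψ χ h) * ι _ (.plus i χ ψ h)) (sElt L i • ι _ (.idem χ))
  | plus_minus (i χ ψ h) :
      QRel (ι _ (.plus i χ ψ h) * ι _ (.minus i ψ χ h)) (sElt L i • ι _ (.idem ψ))
  | plus_plus (i j) (hij : i ≠ j) (χ χi χj χij hi hj hij' hji') :
      QRel (ι _ (.plus j χi χij hij') * ι _ (.plus i χ χi hi))
        (ι _ (.plus i χj χij hji') * ι _ (.plus j χ χj hj))
  | minus_minus (i j) (hij : i ≠ j) (χ χi χj χij hi hj hij' hji') :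
      QRel (ι _ (.minus j χj χ hj) * ι _ (.minus i χij χj hji'))
        (ι _ (.minus i χi χ hi) * ι _ (.minus j χij χi hij'))
  | minus_plus' (i j) (hij : i ≠ j) (χ χi χj χij hi hj hij' hji') :
      QRel (ι _ (.minus j χij χi hij') * ι _ (.plus i χj χij hji'))
        (ι _ (.plus i χ χi hi) * ι _ (.minus j χj χ hj))

/-- The quadratic algebra over `S`. -/
def HQuad : Type := RingQuot (QRel L p lam)

instance : Ring (HQuad L p lam) := inferInstanceAs (Ring (RingQuot (QRel L p lam)))

instance : Algebra (SymG L) (HQuad L p lam) :=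
  inferInstanceAs (Algebra (SymG L) (RingQuot (QRel L p lam)))

/-- The image of a generator in the quadratic algebra. -/
def HQuad.gen (g : QGen L p lam) : HQuad L p lam :=
  RingQuot.mkAlgHom (SymG L) (QRel L p lam) (FreeAlgebra.ι _ g)

/-- The degrees of the generators of the quadratic algebra. -/
def QGen.deg : QGen L p lam → ℕ
  | .idem _ => 0
  | .plus _ _ _ _ => 1
  | .minus _ _ _ _ => 1

/-- The homogeneous part of degree `d` of the quadratic algebra. -/
def HQuad.grade (d : ℕ) : Submodule ℤ (HQuad L p lam) :=
  wordSpan L (HQuad.gen L p lam) (QGen.deg L p lam) d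

end Algebras

section Hypotheses

variable {n : ℕ} (L : Submodule ℤ (Fin n → ℤ))

/-- The sublattice is saturated, that is, it is the cocharacter lattice of a subtorus of `D`. -/
def IsSaturated : Prop := ∀ (m : ℤ) (v : Fin n → ℤ), m ≠ 0 → m • v ∈ L → v ∈ L

open TensorProduct in
/-- Every tuple of coordinate cocharacters whose images form a `ℚ`-basis of `𝔤_ℚ` has images that
form a `ℤ`-basis of `𝔤_ℤ = ℤⁿ / L`. -/
def IsUnimodular : Prop :=
  ∀ (k : ℕ) (j : Fin k → Fin n),
    LinearIndependent ℚ (fun a => (1 : ℚ) ⊗ₜ[ℤ] L.mkQ (Pi.single (j a) 1)) →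
    Submodule.span ℚ (Set.range fun a => (1 : ℚ) ⊗ₜ[ℤ] L.mkQ (Pi.single (j a) 1)) = ⊤ →
    LinearIndependent ℤ (fun a => L.mkQ (Pi.single (j a) 1)) ∧
      Submodule.span ℤ (Set.range fun a => L.mkQ (Pi.single (j a) 1)) = ⊤

/-- The character `α` of `T` is generic: if a nonzero multiple of `α` lies in the span of the
`T`-weights of a set of coordinates, then only the trivial cocharacter of `T` is orthogonal to
these weights. -/
def IsGeneric (α : Module.Dual ℤ L) : Prop :=
  ∀ J : Set (Fin n), (∃ m : ℤ, m ≠ 0 ∧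
      m • α ∈ Submodule.span ℤ ((fun i => charRes L (Pi.single i 1)) '' J)) →
    ∀ v ∈ L, (∀ i ∈ J, v i = 0) → v = 0

/-- The set `Λ^ℝ(μ)` for a real parameter `μ`. -/
def LambdaReal (p : ℕ) (μ : L →ₗ[ℤ] ℝ) : Set (Fin n → ℤ) :=
  {x | ∃ a : Fin n → ℝ, (∀ v : L, ∑ i, a i * (v.1 i : ℝ) = μ v) ∧
    ∀ i, (p : ℝ) * x i ≤ a i ∧ a i < p * x i + p}

/-- The parameter `lam` is smooth: `Λ^ℝ(μ) = Λ(lam)` for all real `μ` in a neighbourhood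
of `lam`. -/
def IsSmooth (p : ℕ) (lam : Module.Dual ℤ L) : Prop :=
  ∃ U : Set (L → ℝ), IsOpen U ∧ (fun v => (lam v : ℝ)) ∈ U ∧
    ∀ μ : L →ₗ[ℤ] ℝ, (fun v => μ v) ∈ U → LambdaReal L p μ = LambdaSet L p lam

end Hypotheses

end Hypertoric

end

open Hypertoric

/-!
Both algebras are identified with one explicit ring of matrices. Let `R` be the total coordinate
ring `ℤ[z, w, t] / ⟨μ*(χ)⟩`, an algebra over `S = Sym(ℤⁿ / L)` through `s i ↦ z i * w i`. The
matrices in question (`semiInvMatrix`) are indexed by `LambdaBar`, and their `(χ, ψ)` entry is a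
semi-invariant of weight `ψ - χ` and degree zero in `t`.

*Geometry: the matrices are the endomorphisms of `𝒯`.* The homomorphism `toLaurent` from `R` to the
Laurent polynomials over `S` restricts functions to the stratum of the stable locus on which one
variable of each pair `z i`, `w i` is invertible. It sends the monomial of `x` to a Laurent monomial
whose coefficient is a product of forms `s i`, and it is injective on semi-invariants of a weight
that is trivial on the coordinate cocharacters in `T`. In particular the homogeneous coordinate ring
is a domain, and sections of `ℓ(χ)` are determined by their values at the generic point
(`sec_eq_zero_of_genPt`). Each lift `a` of `α` to a character of `D` gives a chart, the nonvanishing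
locus of `m^p(a) t`. Since `α` is generic and `T ⊂ D` is unimodular, the restrictions to `T` of the
coordinate characters in the support of `a` generate the character lattice, so every `ℓ(χ)` is
trivial on the chart (`exists_generator`). Hence a homomorphism `ℓ(χ) ⟶ ℓ(ψ)` is multiplication by
one fraction (`exists_multiplier`), and on the chart of `a` its denominator is a power of `m^p(a) t`
(`exists_pow_denominator`). It remains to remove the denominator, coefficient by coefficient and
prime by prime: by unimodularity the nonzero `s i` are primes of `S`, and `s i` divides `s j` only
if the coordinates `i` and `j` are parallel up to sign. For a lift `y` of `ψ - χ` with `χ`, `ψ` in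
`LambdaBar`, the entries of `y` in the coordinates parallel to the `i`-th are, up to sign, `m` or
`m + 1` for a single integer `m`, because elements of `Λ` are obtained by rounding (`inWindow_sub`). So
some lift `a` of `α` has compatible signs there, and its chart shows that the prime `s i` does not
occur in the denominator (`exists_semiInv_of_forall_chart`). Therefore every homomorphism is
multiplication by a semi-invariant (`exists_eq_mulSemi`), which is unique.

*Algebra: `H̄` is the ring of matrices.* Sending `c x y` to the matrix with the single entry
`m^p(y - x)` respects the relations. The elements `c x y`, with `x` in a set of representatives of
`LambdaBar`, span `H̄`. Their images span the ring of matrices because semi-invariants are spanned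
over `S` by monomials, and they are linearly independent because `toLaurent` sends them to distinct
Laurent monomials with nonzero coefficients. The statement for the opposite order of multiplication
follows from the anti-involution exchanging `c x y` and `c y x`.

*Gradings.* The generators go to matrices that are homogeneous for the coaction of `𝕊` on `R`, so a
faithful representation turns words of degree `d` into matrices of weight `d` and conversely
(`mem_wordSpan_iff`). Testing on a homogeneous local generator shows that a semi-invariant has
weight `d` as soon as multiplication by it raises weights by `d`.

*The quadratic presentation.* For smooth `lam`, `Λ` consists of the closed cubes that meet the
affine space of real lifts of `lam`, and the open cubes meet it as well. A segment from a point in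
the cube of `y` to an interior point of the cube of `x` leaves the cube of `y` at a point of an
intersection of walls, and all cubes across some of these walls are again in `Λ`
(`IsSmooth.mem_of_isFirst`). So two elements of `Λ` are joined by a shortest path. Moving the
starting point between two facets of the cube of `y`, one passes from one last step of such a path
to any other by squares in `Λ` (`IsSmooth.toward_induction`). Hence the quadratic relations make the
product along a shortest path depend on its endpoints only (`IsGeodesic.unique`); these products
span the quadratic algebra, and they are sent to the `c x y`.
-/

noncomputable section

namespace Hypertoric

open CategoryTheory TopologicalSpace AlgebraicGeometry Opposite

/-! ### The total coordinate ring as an algebra over the symmetric algebra -/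

theorem map_eq_sum_single {n : ℕ} {M : Type*} [AddCommGroup M] (f : (Fin n → ℤ) →ₗ[ℤ] M)
    (x : Fin n → ℤ) : f x = ∑ i, x i • f (Pi.single i 1) := by
  conv_lhs => rw [← Finset.univ_sum_single x]
  rw [map_sum]
  refine Finset.sum_congr rfl fun i _ => ?_
  rw [← map_smul, ← Pi.single_smul, smul_eq_mul, mul_one]

section Total

variable {n : ℕ} (L : Submodule ℤ (Fin n → ℤ)) (α : Module.Dual ℤ L)

/-- The moment map `v ↦ ∑ i, v i * z i * w i`, with values in the total coordinate ring. -/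
def momentHom : (Fin n → ℤ) →ₗ[ℤ] TotalRing L where
  toFun v := totalMk L (moment v)
  map_add' v w := by
    simp only [moment, Pi.add_apply, map_add, add_mul, Finset.sum_add_distrib]
  map_smul' c v := by
    simp only [moment, Pi.smul_apply, smul_eq_mul, map_mul, mul_assoc, ← Finset.mul_sum,
      RingHom.id_apply, zsmul_eq_mul]
    congr 1

theorem momentHom_single (i : Fin n) : momentHom L (Pi.single i 1) = totalMk L (zw i) := by
  show totalMk L (moment (Pi.single i 1)) = _
  congr 1
  rw [moment, Finset.sum_eq_single i]
  · simp [zw]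
  · intro j _ hj
    simp [Pi.single_eq_of_ne hj]
  · simp

theorem le_ker_momentHom : L ≤ LinearMap.ker (momentHom L) := fun v hv => by
  rw [LinearMap.mem_ker]
  exact Ideal.Quotient.eq_zero_iff_mem.2 (Ideal.subset_span ⟨v, hv, rfl⟩)

/-- The homomorphism `S → R` into the total coordinate ring that sends `s i` to `z i * w i`. -/
def symToTotal : SymG L →ₐ[ℤ] TotalRing L :=
  SymmetricAlgebra.lift (L.liftQ (momentHom L) (le_ker_momentHom L))

/-- The total coordinate ring as an `S`-algebra through `s i ↦ z i * w i`. -/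
instance symAlgebra : Algebra (SymG L) (TotalRing L) := (symToTotal L).toRingHom.toAlgebra

theorem algebraMap_sElt (i : Fin n) :
    algebraMap (SymG L) (TotalRing L) (sElt L i) = totalMk L (zw i) := by
  show symToTotal L (sElt L i) = _
  rw [symToTotal, sElt, SymmetricAlgebra.lift_ι_apply, Submodule.mkQ_apply, Submodule.liftQ_apply,
    momentHom_single]

theorem algebraMap_ι (v : Fin n → ℤ) :
    algebraMap (SymG L) (TotalRing L) (SymmetricAlgebra.ι ℤ _ (L.mkQ v)) =
      totalMk L (moment v) := by
  show symToTotal L _ = _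
  rw [symToTotal, SymmetricAlgebra.lift_ι_apply, Submodule.mkQ_apply, Submodule.liftQ_apply]
  rfl

/-- The images of the coordinate cocharacters generate `S`. -/
theorem adjoin_sElt : Algebra.adjoin ℤ (Set.range (sElt L)) = ⊤ := by
  rw [eq_top_iff]
  intro s _
  induction s using SymmetricAlgebra.induction with
  | algebraMap r => exact Subalgebra.algebraMap_mem _ r
  | ι x =>
    obtain ⟨v, rfl⟩ := L.mkQ_surjective x
    rw [map_eq_sum_single, map_sum]
    refine Subalgebra.sum_mem _ fun i _ => ?_
    rw [map_smul]
    exact Subalgebra.smul_mem _ (Algebra.subset_adjoin (Set.mem_range_self i)) _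
  | mul a b ha hb => exact Subalgebra.mul_mem _ (ha trivial) (hb trivial)
  | add a b ha hb => exact Subalgebra.add_mem _ (ha trivial) (hb trivial)

/-- The group algebra over `S` of the character lattice of `D × 𝔾ₘ`, where the second factor
records the degree in `t`. -/
abbrev Laurent : Type := AddMonoidAlgebra (SymG L) ((Fin n → ℤ) × ℤ)

variable {L} in
/-- The `j`-th coordinate cocharacter lies in `T` and pairs negatively with `α`. Then `z j`
vanishes on the stable locus, where `w j` is invertible. -/
def Flipped (j : Fin n) : Prop := ∃ h : (Pi.single j 1 : Fin n → ℤ) ∈ L, α ⟨_, h⟩ < 0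

open Classical in
variable {L} in
/-- The exponent of `s j` in the coefficient of the Laurent monomial that represents the monomial
of the integer `x` in the `j`-th pair of variables. -/
def badPart (j : Fin n) (x : ℤ) : ℕ := if Flipped α j then x.toNat else (-x).toNat

open Classical in
/-- The Laurent monomials representing the variables. One variable in each pair becomes
invertible, and the product `z j * w j` becomes `s j`. -/
def laurentVar : HVar n → Laurent L
  | .z j => .single (Pi.single j 1, 0) (if Flipped α j then sElt L j else 1)
  | .w j => .single (-Pi.single j 1, 0) (if Flipped α j then 1 else sElt L j)
  | .t => .single (0, 1) 1

theorem laurentVar_z_mul_w (j : Fin n) :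
    laurentVar L α (.z j) * laurentVar L α (.w j) = algebraMap (SymG L) (Laurent L) (sElt L j) := by
  simp only [laurentVar, AddMonoidAlgebra.single_mul_single]
  have e : ((Pi.single j 1, 0) + (-Pi.single j 1, 0) : (Fin n → ℤ) × ℤ) = 0 := by
    ext <;> simp
  rw [e]
  split_ifs <;> simp [AddMonoidAlgebra.coe_algebraMap]

theorem aeval_laurentVar_moment (v : Fin n → ℤ) :
    MvPolynomial.aeval (R := ℤ) (laurentVar L α) (moment v) =
      algebraMap (SymG L) (Laurent L) (SymmetricAlgebra.ι ℤ _ (L.mkQ v)) := by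
  rw [map_eq_sum_single]
  simp only [moment, map_sum, map_mul, MvPolynomial.aeval_X, laurentVar_z_mul_w]
  refine Finset.sum_congr rfl fun i _ => ?_
  rw [map_smul, zsmul_eq_mul, map_mul, map_intCast]
  simp [sElt]

/-- The homomorphism from the total coordinate ring to the Laurent polynomials over `S` that
restricts functions to the generic stratum of the stable locus. -/
def toLaurent : TotalRing L →+* Laurent L :=
  Ideal.Quotient.lift (momentIdeal L) (MvPolynomial.aeval (R := ℤ) (laurentVar L α)).toRingHom <| by
    intro f hf
    refine Submodule.span_induction (p := fun f _ =>
      (MvPolynomial.aeval (R := ℤ) (laurentVar L α)).toRingHom f = 0) ?_ (map_zero _) ?_ ?_ hf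
    · rintro _ ⟨v, hv, rfl⟩
      show MvPolynomial.aeval (R := ℤ) (laurentVar L α) (moment v) = 0
      rw [aeval_laurentVar_moment, Submodule.mkQ_apply, (Submodule.Quotient.mk_eq_zero L).2 hv,
        map_zero, map_zero]
    · intro x y _ _ hx hy
      rw [map_add, hx, hy, add_zero]
    · intro a x _ hx
      rw [smul_eq_mul, map_mul, hx, mul_zero]

theorem toLaurent_mk (f : Poly n) :
    toLaurent L α (totalMk L f) = MvPolynomial.aeval (R := ℤ) (laurentVar L α) f := rfl

theorem toLaurent_algebraMap (s : SymG L) :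
    toLaurent L α (algebraMap (SymG L) (TotalRing L) s) = algebraMap (SymG L) (Laurent L) s := by
  induction s using SymmetricAlgebra.induction with
  | algebraMap r =>
    have e : algebraMap ℤ (SymmetricAlgebra ℤ ((Fin n → ℤ) ⧸ L)) r = (r : SymG L) :=
      eq_intCast _ r
    rw [e, map_intCast, map_intCast, map_intCast]
  | ι x =>
    obtain ⟨v, rfl⟩ := L.mkQ_surjective x
    rw [algebraMap_ι, toLaurent_mk, aeval_laurentVar_moment]
  | mul a b ha hb => simp only [map_mul, ha, hb]
  | add a b ha hb => simp only [map_add, ha, hb]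

theorem toLaurent_smul (s : SymG L) (r : TotalRing L) :
    toLaurent L α (s • r) = s • toLaurent L α r := by
  rw [Algebra.smul_def, Algebra.smul_def, map_mul, toLaurent_algebraMap]

/-! ### Monomials -/

/-- The class of the monomial of `x` times `t ^ d`. -/
def monoT (x : Fin n → ℤ) (d : ℕ) : TotalRing L :=
  totalMk L (mono x * MvPolynomial.X .t ^ d)

/-- The coefficient of the Laurent monomial that represents `monoT x d`. -/
def laurentCoeff (x : Fin n → ℤ) : SymG L := ∏ j, sElt L j ^ badPart α j (x j)

theorem toLaurent_monoT (x : Fin n → ℤ) (d : ℕ) :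
    toLaurent L α (monoT L x d) = .single (x, (d : ℤ)) (laurentCoeff L α x) := by
  classical
  have key : ∀ j, laurentVar L α (.z j) ^ (x j).toNat * laurentVar L α (.w j) ^ (-x j).toNat =
      .single (Pi.single j (x j), 0) (sElt L j ^ badPart α j (x j)) := by
    intro j
    have e : (x j).toNat • ((Pi.single j 1, 0) : (Fin n → ℤ) × ℤ) +
        (-x j).toNat • (-Pi.single j 1, 0) = (Pi.single j (x j), 0) := by
      refine Prod.ext ?_ (by simp)
      ext k
      rcases eq_or_ne k j with rfl | hk
      · simp
        omega
      · simp [Pi.single_eq_of_ne hk]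
    simp only [laurentVar, AddMonoidAlgebra.single_pow, AddMonoidAlgebra.single_mul_single, e,
      badPart]
    split_ifs <;> simp
  have hprod : ∀ s : Finset (Fin n),
      ∏ j ∈ s, (AddMonoidAlgebra.single ((Pi.single j (x j), 0) : (Fin n → ℤ) × ℤ)
        (sElt L j ^ badPart α j (x j)) : Laurent L) =
      .single (∑ j ∈ s, Pi.single j (x j), 0) (∏ j ∈ s, sElt L j ^ badPart α j (x j)) := by
    intro s
    induction s using Finset.induction_on with
    | empty => rfl
    | insert a s ha ih =>
      rw [Finset.prod_insert ha, ih, AddMonoidAlgebra.single_mul_single, Finset.sum_insert ha,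
        Finset.prod_insert ha]
      simp
  rw [monoT, toLaurent_mk, mono]
  simp only [map_mul, map_prod, map_pow, MvPolynomial.aeval_X, key, hprod]
  rw [laurentVar, AddMonoidAlgebra.single_pow, AddMonoidAlgebra.single_mul_single,
    Finset.univ_sum_single, laurentCoeff]
  simp

/-- The exponent of `z * w` in the product of the monomials of the integers `a` and `b`. -/
def overlap (a b : ℤ) : ℕ := (a.natAbs + b.natAbs - (a + b).natAbs) / 2

/-- Where the signs of `x` and `y` differ, the product of their monomials contains pairs
`z i * w i`. -/
theorem mono_mul (x y : Fin n → ℤ) :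
    mono x * mono y = (∏ i, zw i ^ overlap (x i) (y i)) * mono (x + y) := by
  simp only [mono, ← Finset.prod_mul_distrib, zw]
  refine Finset.prod_congr rfl fun i _ => ?_
  rw [mul_pow, mul_mul_mul_comm, ← pow_add, ← pow_add, mul_mul_mul_comm, ← pow_add, ← pow_add,
    Pi.add_apply]
  have e1 : (x i).toNat + (y i).toNat = overlap (x i) (y i) + (x i + y i).toNat := by
    unfold overlap; omega
  have e2 : (-x i).toNat + (-y i).toNat = overlap (x i) (y i) + (-(x i + y i)).toNat := by
    unfold overlap; omega
  rw [e1, e2]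

theorem monoT_mul (x y : Fin n → ℤ) (d e : ℕ) :
    monoT L x d * monoT L y e =
      (∏ i, sElt L i ^ overlap (x i) (y i)) • monoT L (x + y) (d + e) := by
  rw [Algebra.smul_def, map_prod]
  simp only [map_pow, algebraMap_sElt, monoT]
  rw [← map_mul, mul_mul_mul_comm, mono_mul, ← pow_add, mul_assoc, map_mul, map_prod]
  simp only [map_pow]

theorem monoT_zero : monoT L 0 0 = 1 := by
  simp [monoT, mono]

theorem monoT_mem (x : Fin n → ℤ) (d : ℕ) :
    mono x * MvPolynomial.X .t ^ d ∈ polyT L α (charRes L x - d • α) ⊓ polyt d := by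
  constructor
  · have := MvPolynomial.IsWeightedHomogeneous.mul (mono_mem_polyT L α x)
      (.pow (MvPolynomial.isWeightedHomogeneous_X ℤ (wtT L α) .t) d)
    simpa [wtT, sub_eq_add_neg] using this
  · have := MvPolynomial.IsWeightedHomogeneous.mul (mono_mem_polyt x)
      (.pow (MvPolynomial.isWeightedHomogeneous_X ℤ degt .t) d)
    simpa [degt] using this

theorem monoT_mem_semiInv {x : Fin n → ℤ} {d : ℕ} {ξ : Module.Dual ℤ L}
    (h : charRes L x = ξ + d • α) : monoT L x d ∈ semiInv L α ξ d := by
  have := monoT_mem L α x d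
  rw [h, add_sub_cancel_right] at this
  exact ⟨_, this, rfl⟩

/-- The `𝕊`-weight of the monomial of `x`. -/
def absSum (x : Fin n → ℤ) : ℕ := ∑ i, (x i).natAbs

theorem mono_mem_polyS (x : Fin n → ℤ) (d : ℕ) :
    mono x * MvPolynomial.X .t ^ d ∈ polyS (absSum x) := by
  have h := MvPolynomial.IsWeightedHomogeneous.prod (w := wtS) Finset.univ
    (fun i => (MvPolynomial.X (.z i) ^ (x i).toNat *
      MvPolynomial.X (.w i) ^ (-x i).toNat : Poly n))
    (fun i => (x i).toNat • wtS (.z i) + (-x i).toNat • wtS (.w i))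
    (fun i _ => .mul (.pow (MvPolynomial.isWeightedHomogeneous_X _ _ _) _)
      (.pow (MvPolynomial.isWeightedHomogeneous_X _ _ _) _))
  have := MvPolynomial.IsWeightedHomogeneous.mul h
      (.pow (MvPolynomial.isWeightedHomogeneous_X ℤ wtS .t) d)
  have e : ∑ i, ((x i).toNat • wtS (.z i) + (-x i).toNat • wtS (.w i)) + d • wtS (n := n) .t =
      absSum x := by
    simp only [wtS, absSum, smul_eq_mul, mul_one, mul_zero, add_zero]
    exact Finset.sum_congr rfl fun i _ => by omega
  rw [e] at this
  exact this

/-- The variables as a disjoint union. -/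
def hvarEquiv (n : ℕ) : Fin n ⊕ Fin n ⊕ Unit ≃ HVar n where
  toFun
    | .inl i => .z i
    | .inr (.inl i) => .w i
    | .inr (.inr _) => .t
  invFun
    | .z i => .inl i
    | .w i => .inr (.inl i)
    | .t => .inr (.inr ())
  left_inv := by rintro (_ | _ | _) <;> rfl
  right_inv := by rintro (_ | _ | _) <;> rfl

instance hvarFintype (n : ℕ) : Fintype (HVar n) := Fintype.ofEquiv _ (hvarEquiv n)

@[to_additive]
theorem prod_hvar {A : Type*} [CommMonoid A] (f : HVar n → A) :
    ∏ v, f v = (∏ i, f (.z i) * f (.w i)) * f .t := by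
  rw [← (hvarEquiv n).prod_comp]
  simp [hvarEquiv, Finset.prod_mul_distrib, mul_assoc]

/-- The exponents of `D` in a monomial. -/
def expDiff (m : HVar n →₀ ℕ) (i : Fin n) : ℤ := m (.z i) - m (.w i)

theorem monomial_eq_mono (m : HVar n →₀ ℕ) :
    MvPolynomial.monomial m (1 : ℤ) =
      (∏ i, zw i ^ min (m (.z i)) (m (.w i))) * (mono (expDiff m) * MvPolynomial.X .t ^ m .t) := by
  rw [MvPolynomial.monomial_eq, map_one, one_mul, Finsupp.prod_fintype _ _ (fun _ => pow_zero _),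
    prod_hvar, ← mul_assoc, mono, ← Finset.prod_mul_distrib]
  congr 1
  refine Finset.prod_congr rfl fun i _ => ?_
  rw [zw, mul_pow, mul_mul_mul_comm, ← pow_add, ← pow_add]
  congr 2 <;> · unfold expDiff; omega

/-- The `T`-weight of a monomial, where `t` has weight `-α`. -/
theorem weight_wtT (m : HVar n →₀ ℕ) :
    Finsupp.weight (wtT L α) m = charRes L (expDiff m) - m .t • α := by
  rw [Finsupp.weight_apply,
    Finsupp.sum_fintype m (fun i c => c • wtT L α i) (fun _ => zero_smul _ _), sum_hvar]
  simp only [wtT, smul_neg, ← sub_eq_add_neg]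
  congr 1
  rw [map_eq_sum_single]
  refine Finset.sum_congr rfl fun i _ => ?_
  rw [expDiff, sub_smul, natCast_zsmul, natCast_zsmul]

theorem weight_degt (m : HVar n →₀ ℕ) : Finsupp.weight degt m = m .t := by
  rw [Finsupp.weight_apply,
    Finsupp.sum_fintype m (fun i c => c • degt i) (fun _ => zero_smul _ _), sum_hvar]
  simp [degt]

/-- The semi-invariants of weight `ξ` and of arbitrary degree in `t`. -/
def semiInvAll (ξ : Module.Dual ℤ L) : Submodule ℤ (TotalRing L) :=
  (polyT L α ξ).map (totalMk L).toAddMonoidHom.toIntLinearMap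

theorem semiInv_le (ξ : Module.Dual ℤ L) (d : ℕ) : semiInv L α ξ d ≤ semiInvAll L α ξ :=
  Submodule.map_mono inf_le_left

theorem totalMk_monomial (m : HVar n →₀ ℕ) (c : ℤ) :
    totalMk L (MvPolynomial.monomial m c) =
      ((c : SymG L) * ∏ i, sElt L i ^ min (m (.z i)) (m (.w i))) •
        monoT L (expDiff m) (m .t) := by
  have e : MvPolynomial.monomial m c = MvPolynomial.C c * MvPolynomial.monomial m 1 := by
    rw [MvPolynomial.C_mul_monomial, mul_one]
  rw [e, monomial_eq_mono, map_mul, map_mul, map_prod, Algebra.smul_def, map_mul (algebraMap _ _),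
    map_prod (algebraMap _ _), mul_assoc, monoT]
  simp only [map_pow, algebraMap_sElt, map_intCast, eq_intCast]

/-- The index set of the monomials of `T`-weight `ξ`. -/
def monoIndex (ξ : Module.Dual ℤ L) : Set ((Fin n → ℤ) × ℕ) :=
  {q | charRes L q.1 = ξ + q.2 • α}

/-- Semi-invariants are `S`-linear combinations of the monomials `monoT` of the same weight, since
in every monomial the pairs `z i * w i` can be collected into elements of `S`. -/
theorem mem_span_of_polyT {ξ : Module.Dual ℤ L} {f : Poly n} (hf : f ∈ polyT L α ξ) {T : Set ℕ}
    (hT : ∀ m ∈ f.support, m .t ∈ T) :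
    totalMk L f ∈ Submodule.span (SymG L)
      ((fun q : (Fin n → ℤ) × ℕ => monoT L q.1 q.2) '' (monoIndex L α ξ ∩ {q | q.2 ∈ T})) := by
  rw [MvPolynomial.as_sum f, map_sum]
  refine Submodule.sum_mem _ fun m hm => ?_
  rw [totalMk_monomial]
  refine Submodule.smul_mem _ _ (Submodule.subset_span ⟨(expDiff m, m .t), ⟨?_, hT m hm⟩, rfl⟩)
  have h1 := hf (MvPolynomial.mem_support_iff.1 hm)
  rw [weight_wtT] at h1
  show charRes L (expDiff m) = ξ + m .t • α
  rw [← h1, sub_add_cancel]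

theorem mem_span_of_semiInvAll {ξ : Module.Dual ℤ L} {r : TotalRing L}
    (hr : r ∈ semiInvAll L α ξ) : r ∈ Submodule.span (SymG L)
      ((fun q : (Fin n → ℤ) × ℕ => monoT L q.1 q.2) '' monoIndex L α ξ) := by
  obtain ⟨f, hf, rfl⟩ := hr
  have := mem_span_of_polyT L α hf (T := Set.univ) fun _ _ => trivial
  refine Submodule.span_mono (Set.image_mono Set.inter_subset_left) this

theorem mem_span_of_semiInv {ξ : Module.Dual ℤ L} {d : ℕ} {r : TotalRing L}
    (hr : r ∈ semiInv L α ξ d) : r ∈ Submodule.span (SymG L)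
      ((fun q : (Fin n → ℤ) × ℕ => monoT L q.1 q.2) ''
        (monoIndex L α ξ ∩ {q | q.2 ∈ ({d} : Set ℕ)})) := by
  obtain ⟨f, hf, rfl⟩ := hr
  refine mem_span_of_polyT L α hf.1 fun m hm => ?_
  have h1 := hf.2 (MvPolynomial.mem_support_iff.1 hm)
  rwa [weight_degt] at h1

end Total

/-! ### Consequences of unimodularity and genericity -/

section Lattice

variable {n : ℕ} {L : Submodule ℤ (Fin n → ℤ)} {α : Module.Dual ℤ L}

/-- The image in `ℤⁿ / L` of the `j`-th coordinate cocharacter. -/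
abbrev coch (L : Submodule ℤ (Fin n → ℤ)) (j : Fin n) : (Fin n → ℤ) ⧸ L := L.mkQ (Pi.single j 1)

theorem charRes_apply (x : Fin n → ℤ) (v : L) : charRes L x v = ∑ i, x i * v.1 i := rfl

theorem charRes_apply_single (x : Fin n → ℤ) {j : Fin n} (h : (Pi.single j 1 : Fin n → ℤ) ∈ L) :
    charRes L x ⟨_, h⟩ = x j := by
  rw [charRes_apply, Finset.sum_eq_single j]
  · simp
  · intro i _ hi
    simp [Pi.single_eq_of_ne hi]
  · simp

theorem isTorsionFree_quotient (hL : IsSaturated L) : Module.IsTorsionFree ℤ ((Fin n → ℤ) ⧸ L) := by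
  refine .mk fun m hm x y h => ?_
  have hm' : m ≠ 0 := hm.ne_zero
  rw [← sub_eq_zero]
  obtain ⟨v, hv⟩ := L.mkQ_surjective (x - y)
  rw [← hv, Submodule.mkQ_apply, Submodule.Quotient.mk_eq_zero]
  refine hL m v hm' ?_
  rw [← Submodule.Quotient.mk_eq_zero, Submodule.Quotient.mk_smul, ← Submodule.mkQ_apply, hv,
    smul_sub, sub_eq_zero]
  exact h

theorem free_quotient (hL : IsSaturated L) : Module.Free ℤ ((Fin n → ℤ) ⧸ L) :=
  have := isTorsionFree_quotient hL
  Module.free_of_finite_type_torsion_free'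

theorem isDomain_symG (hL : IsSaturated L) : IsDomain (SymG L) :=
  have := free_quotient hL
  inferInstance

theorem charRes_surjective (hL : IsSaturated L) : Function.Surjective (charRes L) := by
  intro χ
  have := free_quotient hL
  obtain ⟨h, hh⟩ := Module.projective_lifting_property L.mkQ LinearMap.id L.mkQ_surjective
  have hmem : ∀ v, (LinearMap.id - h ∘ₗ L.mkQ : (Fin n → ℤ) →ₗ[ℤ] _) v ∈ L := fun v => by
    rw [← Submodule.Quotient.mk_eq_zero, ← Submodule.mkQ_apply, LinearMap.sub_apply, map_sub]
    have := LinearMap.congr_fun hh (L.mkQ v)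
    simp only [LinearMap.comp_apply, LinearMap.id_apply] at this ⊢
    rw [this, sub_self]
  set r : (Fin n → ℤ) →ₗ[ℤ] L := (LinearMap.id - h ∘ₗ L.mkQ).codRestrict L hmem
  have hr : ∀ v : L, r v.1 = v := fun v => Subtype.ext <| by
    show v.1 - h (L.mkQ v.1) = v.1
    rw [Submodule.mkQ_apply, (Submodule.Quotient.mk_eq_zero L).2 v.2, map_zero, sub_zero]
  refine ⟨fun i => χ (r (Pi.single i 1)), LinearMap.ext fun v => ?_⟩
  rw [charRes_apply]
  conv_rhs => rw [← hr v, map_eq_sum_single]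
  rw [map_sum]
  refine Finset.sum_congr rfl fun i _ => ?_
  rw [map_smul, smul_eq_mul, mul_comm]

theorem span_coch : Submodule.span ℤ (Set.range (coch L)) = ⊤ := by
  rw [eq_top_iff]
  intro x _
  obtain ⟨v, rfl⟩ := L.mkQ_surjective x
  rw [map_eq_sum_single]
  refine Submodule.sum_mem _ fun i _ => ?_
  exact Submodule.smul_mem _ _ (Submodule.subset_span ⟨i, rfl⟩)

open TensorProduct in
/-- Linearly independent coordinate cocharacters of `D / T` extend to a `ℤ`-basis. -/
theorem exists_basis_of_linearIndepOn (hU : IsUnimodular L) {s : Set (Fin n)}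
    (hs : LinearIndepOn ℤ (coch L) s) : ∃ B : Set (Fin n), s ⊆ B ∧
      ∃ b : Module.Basis B ℤ ((Fin n → ℤ) ⧸ L), ∀ j, b j = coch L j := by
  classical
  have hsQ : LinearIndepOn ℚ (fun j => (1 : ℚ) ⊗ₜ[ℤ] coch L j) s :=
    LinearIndependent.of_isLocalizedModule ℚ (nonZeroDivisors ℤ)
      (TensorProduct.mk ℤ ℚ ((Fin n → ℤ) ⧸ L) 1) hs
  obtain ⟨B, -, hsB, hspan, hB⟩ := exists_linearIndepOn_extension hsQ (Set.subset_univ s)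
  have htop : Submodule.span ℚ ((fun j => (1 : ℚ) ⊗ₜ[ℤ] coch L j) '' B) = ⊤ := by
    rw [eq_top_iff, ← Submodule.baseChange_top (R := ℤ), ← span_coch, Submodule.baseChange_span,
      ← Set.range_comp, ← Set.image_univ]
    exact Submodule.span_le.2 hspan
  let e := Finite.equivFin B
  have hcoe : ∀ f : Fin n → ℚ ⊗[ℤ] ((Fin n → ℤ) ⧸ L),
      Set.range (fun a => f (e.symm a).1) = f '' B := fun f => by
    rw [Set.image_eq_range]
    exact e.symm.surjective.range_comp (fun b : B => f b.1)
  obtain ⟨h1, h2⟩ := hU (Nat.card B) (fun a => (e.symm a).1) (hB.comp _ e.symm.injective)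
    (by rw [hcoe fun j => (1 : ℚ) ⊗ₜ[ℤ] coch L j]; exact htop)
  have h1' : LinearIndependent ℤ (fun b : B => coch L b.1) := by
    have he : (fun b : B => coch L b.1) =
        (fun a => L.mkQ (Pi.single (e.symm a).1 1)) ∘ e :=
      funext fun b => by simp only [Function.comp_apply, Equiv.symm_apply_apply]
    rw [he]
    exact h1.comp _ e.injective
  have h2' : ⊤ ≤ Submodule.span ℤ (Set.range fun b : B => coch L b.1) := by
    rw [← h2]
    exact (congrArg _ (e.symm.surjective.range_comp (fun b : B => coch L b.1))).le
  exact ⟨B, hsB, Module.Basis.mk h1' h2', fun j => Module.Basis.mk_apply _ _ _⟩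

/-- The character of `D` with trivial restriction to `T` that corresponds to a functional
on `ℤⁿ / L`. -/
theorem charRes_functional (φ : ((Fin n → ℤ) ⧸ L) →ₗ[ℤ] ℤ) :
    charRes L (fun j => φ (coch L j)) = 0 := by
  ext v
  rw [charRes_apply, LinearMap.zero_apply]
  have : φ (L.mkQ v.1) = 0 := by
    rw [Submodule.mkQ_apply, (Submodule.Quotient.mk_eq_zero L).2 v.2, map_zero]
  rw [← this]
  rw [map_eq_sum_single, map_sum]
  refine Finset.sum_congr rfl fun i _ => ?_
  rw [map_smul, smul_eq_mul, mul_comm]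

theorem ι_injective (hL : IsSaturated L) :
    Function.Injective (SymmetricAlgebra.ι ℤ ((Fin n → ℤ) ⧸ L)) := by
  have := free_quotient hL
  rw [injective_iff_map_eq_zero]
  intro x hx
  refine (Module.forall_dual_apply_eq_zero_iff ℤ x).1 fun φ => ?_
  have := SymmetricAlgebra.lift_ι_apply
    (f := (LinearMap.toSpanSingleton ℤ (Polynomial ℤ) Polynomial.X) ∘ₗ φ) x
  rw [hx, map_zero] at this
  have h2 := congrArg (fun q => Polynomial.coeff q 1) this
  simpa using h2.symm

theorem sElt_eq_zero_iff (hL : IsSaturated L) (j : Fin n) :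
    sElt L j = 0 ↔ (Pi.single j 1 : Fin n → ℤ) ∈ L := by
  rw [sElt, (ι_injective hL).eq_iff' (map_zero _), Submodule.mkQ_apply,
    Submodule.Quotient.mk_eq_zero]

theorem linearIndepOn_singleton_coch (hL : IsSaturated L) {i : Fin n}
    (hi : (Pi.single i 1 : Fin n → ℤ) ∉ L) : LinearIndepOn ℤ (coch L) {i} := by
  have := isTorsionFree_quotient hL
  refine LinearIndepOn.singleton ?_
  exact fun h => hi ((Submodule.Quotient.mk_eq_zero L).1 h)

/-- By unimodularity, a nonzero `s i` is one of the variables in a presentation of `S` as a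
polynomial ring. -/
theorem prime_sElt (hL : IsSaturated L) (hU : IsUnimodular L) {i : Fin n}
    (hi : (Pi.single i 1 : Fin n → ℤ) ∉ L) : Prime (sElt L i) := by
  obtain ⟨B, hB, b, hb⟩ := exists_basis_of_linearIndepOn hU (linearIndepOn_singleton_coch hL hi)
  rw [← MulEquiv.prime_iff (SymmetricAlgebra.equivMvPolynomial b)]
  have : sElt L i = SymmetricAlgebra.ι ℤ _ (b ⟨i, hB rfl⟩) := by rw [hb]; rfl
  rw [this, SymmetricAlgebra.equivMvPolynomial_ι_apply]
  exact MvPolynomial.X_prime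

theorem exists_functional (hL : IsSaturated L) (hU : IsUnimodular L) {i : Fin n}
    (hi : (Pi.single i 1 : Fin n → ℤ) ∉ L) :
    ∃ φ : ((Fin n → ℤ) ⧸ L) →ₗ[ℤ] ℤ, φ (coch L i) = 1 := by
  obtain ⟨B, hB, b, hb⟩ := exists_basis_of_linearIndepOn hU (linearIndepOn_singleton_coch hL hi)
  exact ⟨b.coord ⟨i, hB rfl⟩, by rw [← hb ⟨i, hB rfl⟩]; simp⟩

/-- Divisibility between the linear forms `s i` means that the coordinate cocharacters are
parallel. -/
theorem coch_eq_smul_of_dvd (hL : IsSaturated L) {i j : Fin n}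
    {φ : ((Fin n → ℤ) ⧸ L) →ₗ[ℤ] ℤ} (hφ : φ (coch L i) = 1) (h : sElt L i ∣ sElt L j) :
    coch L j = φ (coch L j) • coch L i := by
  -- The projection along `coch L i` induces an endomorphism of `S` that kills `s i`.
  let π : ((Fin n → ℤ) ⧸ L) →ₗ[ℤ] ((Fin n → ℤ) ⧸ L) :=
    LinearMap.id - (LinearMap.toSpanSingleton ℤ _ (coch L i)) ∘ₗ φ
  have hπ : ∀ x, π x = x - φ x • coch L i := fun x => rfl
  have hs : ∀ k, SymmetricAlgebra.lift (SymmetricAlgebra.ι ℤ _ ∘ₗ π) (sElt L k) =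
      SymmetricAlgebra.ι ℤ _ (π (coch L k)) := fun k => SymmetricAlgebra.lift_ι_apply _ _
  have h0 : SymmetricAlgebra.lift (SymmetricAlgebra.ι ℤ _ ∘ₗ π) (sElt L j) = 0 := by
    obtain ⟨q, hq⟩ := h
    rw [hq, map_mul, hs, hπ, hφ, one_smul, sub_self, map_zero, zero_mul]
  rw [hs, (ι_injective hL).eq_iff' (map_zero _), hπ, sub_eq_zero] at h0
  exact h0

/-- Both of two parallel nonzero coordinate cocharacters are primitive by unimodularity, so they
agree up to sign. -/
theorem functional_eq_of_dvd (hL : IsSaturated L) (hU : IsUnimodular L) {i j : Fin n}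
    (hj : (Pi.single j 1 : Fin n → ℤ) ∉ L)
    {φ : ((Fin n → ℤ) ⧸ L) →ₗ[ℤ] ℤ} (hφ : φ (coch L i) = 1) (h : sElt L i ∣ sElt L j) :
    φ (coch L j) = 1 ∨ φ (coch L j) = -1 := by
  obtain ⟨ψ, hψ⟩ := exists_functional hL hU hj
  have := congrArg ψ (coch_eq_smul_of_dvd hL hφ h)
  rw [hψ, map_smul, smul_eq_mul] at this
  exact Int.isUnit_iff.1 (IsUnit.of_mul_eq_one _ this.symm)

/-- A vector with trivial restriction to `T` defines a functional on `ℤⁿ / L`, so its values on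
parallel coordinates are proportional. -/
theorem apply_eq_mul_of_charRes_eq_zero {γ : Fin n → ℤ} (hγ : charRes L γ = 0) {i j : Fin n}
    {c : ℤ} (h : coch L j = c • coch L i) : γ j = c * γ i := by
  have hmem : (Pi.single j 1 - c • Pi.single i 1 : Fin n → ℤ) ∈ L := by
    rw [← Submodule.Quotient.mk_eq_zero, ← Submodule.mkQ_apply, map_sub, map_smul]
    exact sub_eq_zero.2 h
  have := LinearMap.congr_fun hγ ⟨_, hmem⟩
  rw [charRes_apply, LinearMap.zero_apply] at this
  simp only [Pi.sub_apply, Pi.smul_apply, smul_eq_mul, mul_sub, Finset.sum_sub_distrib] at this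
  rw [Finset.sum_eq_single j, Finset.sum_eq_single i] at this
  · simp only [Pi.single_eq_same] at this
    linarith
  · intro k _ hk; simp [Pi.single_eq_of_ne hk]
  · simp
  · intro k _ hk; simp [Pi.single_eq_of_ne hk]
  · simp

/-- For generic `α`, the coordinates in the support of a lift of `α` separate the cocharacters of
`T`. -/
theorem eq_zero_of_support (hα : IsGeneric L α) {a : Fin n → ℤ} (ha : charRes L a = α)
    {v : Fin n → ℤ} (hv : v ∈ L) (h : ∀ j, a j ≠ 0 → v j = 0) : v = 0 := by
  refine hα {j | a j ≠ 0} ⟨1, one_ne_zero, ?_⟩ v hv h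
  rw [one_smul, ← ha, map_eq_sum_single]
  refine Submodule.sum_mem _ fun i _ => ?_
  rcases eq_or_ne (a i) 0 with h0 | h0
  · rw [h0, zero_smul]
    exact zero_mem _
  · exact Submodule.smul_mem _ _ (Submodule.subset_span ⟨i, h0, rfl⟩)

/-- A coordinate cocharacter that lies in `T` pairs nontrivially with `α`. -/
theorem generic_apply_ne_zero (hL : IsSaturated L) (hα : IsGeneric L α) {j : Fin n}
    (h : (Pi.single j 1 : Fin n → ℤ) ∈ L) : α ⟨_, h⟩ ≠ 0 := by
  intro h0
  obtain ⟨a, ha⟩ := charRes_surjective hL α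
  rw [← ha, charRes_apply_single] at h0
  have := eq_zero_of_support hα ha h fun k hk => by
    rw [Pi.single_eq_of_ne]
    rintro rfl
    exact hk h0
  simpa using congrFun this j

/-- The restrictions to `T` of the coordinate characters in the support of a lift of `α` generate
the character lattice of `T`: the action of `T` on the stable locus is free. -/
theorem exists_lift_of_support (hL : IsSaturated L) (hU : IsUnimodular L) (hα : IsGeneric L α)
    {a : Fin n → ℤ} (ha : charRes L a = α) (χ : Module.Dual ℤ L) :
    ∃ b : Fin n → ℤ, charRes L b = χ ∧ ∀ j, a j = 0 → b j = 0 := by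
  classical
  have hs : LinearIndepOn ℤ (coch L) {j | a j = 0} := by
    rw [linearIndepOn_iff']
    intro s g hsub hsum j hj
    have hv : ∑ i ∈ s, g i • (Pi.single i 1 : Fin n → ℤ) ∈ L := by
      rw [← Submodule.Quotient.mk_eq_zero, ← Submodule.mkQ_apply, map_sum, ← hsum]
      exact Finset.sum_congr rfl fun i _ => map_smul _ _ _
    have hval : ∀ k, (∑ i ∈ s, g i • (Pi.single i 1 : Fin n → ℤ)) k = if k ∈ s then g k else 0 := by
      intro k
      simp [Finset.sum_apply, Pi.single_apply]
    have h0 := eq_zero_of_support hα ha hv fun k hk => by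
      rw [hval, if_neg fun hks : k ∈ s => hk (hsub hks)]
    have := congrFun h0 j
    rwa [hval, if_pos hj] at this
  obtain ⟨B, hB, b, hb⟩ := exists_basis_of_linearIndepOn hU hs
  obtain ⟨b0, hb0⟩ := charRes_surjective hL χ
  let φ := b.constr ℤ (fun j : B => b0 j.1)
  refine ⟨b0 - fun j => φ (coch L j), ?_, fun j hj => ?_⟩
  · rw [map_sub, charRes_functional, sub_zero, hb0]
  · have : φ (coch L j) = b0 j := by
      rw [← hb ⟨j, hB hj⟩, Module.Basis.constr_basis]
    rw [Pi.sub_apply, this, sub_self]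

/-- The character `ξ` of `T` is trivial on the coordinate cocharacters that lie in `T`. -/
def IsAdmissible (ξ : Module.Dual ℤ L) : Prop :=
  ∀ (j : Fin n) (h : (Pi.single j 1 : Fin n → ℤ) ∈ L), ξ ⟨_, h⟩ = 0

/-- Every lift `y` of `ξ` has, for each prime `s i`, a lift `a` of `α` whose signs are compatible
with those of `y` in all coordinates parallel to the `i`-th. Semi-invariants of such a weight on
the stable locus have no poles along the divisors removed in passing to the stable locus. -/
def InWindow (α ξ : Module.Dual ℤ L) : Prop :=
  ∀ y : Fin n → ℤ, charRes L y = ξ → ∀ i : Fin n, (Pi.single i 1 : Fin n → ℤ) ∉ L →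
    ∃ a : Fin n → ℤ, charRes L a = α ∧ ∀ j, sElt L i ∣ sElt L j → 0 ≤ y j * a j

variable {p : ℕ} {lam : Module.Dual ℤ L}

theorem isAdmissible_sub {χ ψ : Module.Dual ℤ L} (hχ : χ ∈ LambdaBar L p lam)
    (hψ : ψ ∈ LambdaBar L p lam) : IsAdmissible (ψ - χ) := by
  obtain ⟨x, ⟨a, ha, hx⟩, rfl⟩ := hχ
  obtain ⟨y, ⟨b, hb, hy⟩, rfl⟩ := hψ
  intro j h
  have e : a j = b j := by
    rw [← charRes_apply_single a h, ← charRes_apply_single b h, ha, hb]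
  rw [LinearMap.sub_apply, charRes_apply_single, charRes_apply_single, sub_eq_zero]
  have h1 := hx j
  have h2 := hy j
  rw [e] at h1
  have l1 : (p : ℤ) * y j < p * (x j + 1) := by linarith
  have l2 : (p : ℤ) * x j < p * (y j + 1) := by linarith
  have hp : (0 : ℤ) ≤ p := Int.natCast_nonneg p
  have := lt_of_mul_lt_mul_left l1 hp
  have := lt_of_mul_lt_mul_left l2 hp
  omega

/-- On parallel coordinates the difference of two elements of `Λ` is constant up to sign and up to
an error of one, because both are obtained by rounding from vectors whose difference is constant
up to sign. -/
theorem inWindow_sub (hL : IsSaturated L) (hU : IsUnimodular L) {χ ψ : Module.Dual ℤ L}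
    (hχ : χ ∈ LambdaBar L p lam) (hψ : ψ ∈ LambdaBar L p lam) : InWindow α (ψ - χ) := by
  have hadm := isAdmissible_sub hχ hψ
  obtain ⟨x, ⟨a, ha, hx⟩, rfl⟩ := hχ
  obtain ⟨x', ⟨a', ha', hx'⟩, rfl⟩ := hψ
  intro y hy i hi
  obtain ⟨φ, hφ⟩ := exists_functional hL hU hi
  have hp : (0 : ℤ) < p := by
    have := hx i
    omega
  obtain ⟨a₀, ha₀⟩ := charRes_surjective hL α
  set t := a' i - a i with ht
  set δ := y i - (x' i - x i) with hδ
  set m := t / p + δ with hm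
  -- In the coordinates parallel to `i` the entries of `y` are `m` or `m + 1`, up to sign.
  have hval : ∀ j, sElt L i ∣ sElt L j → (Pi.single j 1 : Fin n → ℤ) ∉ L →
      m ≤ φ (coch L j) * y j ∧ φ (coch L j) * y j ≤ m + 1 := by
    intro j hij hj
    have hc := coch_eq_smul_of_dvd hL hφ hij
    have e1 := apply_eq_mul_of_charRes_eq_zero (γ := a' - a) (by rw [map_sub, ha, ha', sub_self]) hc
    have e2 := apply_eq_mul_of_charRes_eq_zero (γ := y - (x' - x))
      (by rw [map_sub, map_sub, hy, sub_self]) hc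
    simp only [Pi.sub_apply] at e1 e2
    rw [← ht] at e1
    rw [← hδ] at e2
    have h1 := hx j
    have h2 := hx' j
    have d1 : t / p * p ≤ t := Int.ediv_mul_le _ hp.ne'
    have d2 : t < (t / p + 1) * p := Int.lt_ediv_add_one_mul_self t hp
    obtain hc1 | hc1 := functional_eq_of_dvd hL hU hj hφ hij
    · rw [hc1] at e1 e2 ⊢
      have l1 : (t / p) * p < (x' j - x j + 1) * p := by nlinarith
      have l2 : (x' j - x j) * p < (t / p + 2) * p := by nlinarith
      have := lt_of_mul_lt_mul_right l1 hp.le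
      have := lt_of_mul_lt_mul_right l2 hp.le
      omega
    · rw [hc1] at e1 e2 ⊢
      have l1 : (t / p) * p < (x j - x' j + 1) * p := by nlinarith
      have l2 : (x j - x' j) * p < (t / p + 2) * p := by nlinarith
      have := lt_of_mul_lt_mul_right l1 hp.le
      have := lt_of_mul_lt_mul_right l2 hp.le
      omega
  have hzero : ∀ j, (Pi.single j 1 : Fin n → ℤ) ∈ L → y j = 0 := fun j hj => by
    rw [← charRes_apply_single y hj, hy]
    exact hadm j hj
  have habs : ∀ j, |a₀ j| ≤ ∑ k, |a₀ k| := fun j =>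
    Finset.single_le_sum (f := fun k => |a₀ k|) (fun k _ => abs_nonneg _) (Finset.mem_univ j)
  set N := ∑ k, |a₀ k|
  have hres : ∀ M : ℤ, charRes L (a₀ + M • fun j => φ (coch L j)) = α := fun M => by
    rw [map_add, map_smul, charRes_functional, smul_zero, add_zero, ha₀]
  rcases le_or_gt 0 m with hm0 | hm0
  · refine ⟨_, hres N, fun j hij => ?_⟩
    by_cases hj : (Pi.single j 1 : Fin n → ℤ) ∈ L
    · rw [hzero j hj, zero_mul]
    · have := hval j hij hj
      have hb := abs_le.1 (habs j)
      simp only [Pi.add_apply, Pi.smul_apply, smul_eq_mul]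
      obtain hc1 | hc1 := functional_eq_of_dvd hL hU hj hφ hij
      · rw [hc1] at this ⊢
        exact mul_nonneg (by linarith) (by linarith)
      · rw [hc1] at this ⊢
        exact mul_nonneg_of_nonpos_of_nonpos (by linarith) (by linarith)
  · refine ⟨_, hres (-N), fun j hij => ?_⟩
    by_cases hj : (Pi.single j 1 : Fin n → ℤ) ∈ L
    · rw [hzero j hj, zero_mul]
    · have := hval j hij hj
      have hb := abs_le.1 (habs j)
      simp only [Pi.add_apply, Pi.smul_apply, smul_eq_mul]
      obtain hc1 | hc1 := functional_eq_of_dvd hL hU hj hφ hij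
      · rw [hc1] at this ⊢
        exact mul_nonneg_of_nonpos_of_nonpos (by linarith) (by linarith)
      · rw [hc1] at this ⊢
        exact mul_nonneg (by linarith) (by linarith)

end Lattice

/-! ### Restriction to the generic stratum -/

section Restriction

variable {n : ℕ} {L : Submodule ℤ (Fin n → ℤ)} {α : Module.Dual ℤ L}

/-- In the restriction of an `S`-linear combination of monomials, the coefficients are multiplied by
the coefficients `laurentCoeff` of the restricted monomials. -/
theorem exists_coeff_of_mem_span {I : Set ((Fin n → ℤ) × ℕ)} {r : TotalRing L}
    (hr : r ∈ Submodule.span (SymG L) ((fun q : (Fin n → ℤ) × ℕ => monoT L q.1 q.2) '' I)) :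
    ∃ l : (Fin n → ℤ) × ℕ →₀ SymG L, (∀ q ∉ I, l q = 0) ∧
      r = l.sum (fun q s => s • monoT L q.1 q.2) ∧
      (∀ x (d : ℕ), (toLaurent L α r).coeff (x, (d : ℤ)) = l (x, d) * laurentCoeff L α x) ∧
      ∀ q, (toLaurent L α r).coeff q ≠ 0 → ∃ d : ℕ, (q.1, d) ∈ I ∧ q.2 = d := by
  classical
  rw [Finsupp.mem_span_image_iff_linearCombination] at hr
  obtain ⟨l, hl, rfl⟩ := hr
  have hsum : toLaurent L α (Finsupp.linearCombination (SymG L)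
      (fun q : (Fin n → ℤ) × ℕ => monoT L q.1 q.2) l) =
      ∑ q ∈ l.support, .single (q.1, (q.2 : ℤ)) (l q * laurentCoeff L α q.1) := by
    rw [Finsupp.linearCombination_apply, Finsupp.sum, map_sum]
    refine Finset.sum_congr rfl fun q _ => ?_
    rw [toLaurent_smul, toLaurent_monoT, AddMonoidAlgebra.smul_single, smul_eq_mul]
  have hcoeff : ∀ p, (toLaurent L α (Finsupp.linearCombination (SymG L)
      (fun q : (Fin n → ℤ) × ℕ => monoT L q.1 q.2) l)).coeff p =
      ∑ q ∈ l.support, if (q.1, (q.2 : ℤ)) = p then l q * laurentCoeff L α q.1 else 0 := by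
    intro p
    rw [hsum, AddMonoidAlgebra.coeff_sum, Finsupp.finsetSum_apply]
    refine Finset.sum_congr rfl fun q _ => ?_
    rw [AddMonoidAlgebra.coeff_single, Finsupp.single_apply]
  have hsupp : ∀ q ∉ I, l q = 0 := fun q hq =>
    Finsupp.notMem_support_iff.1 fun h => hq (hl h)
  refine ⟨l, hsupp, Finsupp.linearCombination_apply _ _, fun x d => ?_, fun q hq => ?_⟩
  · rw [hcoeff, Finset.sum_eq_single (x, d)]
    · simp
    · rintro ⟨x', d'⟩ _ hne
      rw [if_neg]
      rintro h
      simp only [Prod.mk.injEq, Nat.cast_inj] at h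
      exact hne (Prod.ext h.1 h.2)
    · intro h
      rw [Finsupp.notMem_support_iff.1 h]
      simp
  · rw [hcoeff] at hq
    obtain ⟨q', hq', hne⟩ := Finset.exists_ne_zero_of_sum_ne_zero hq
    have h : (q'.1, (q'.2 : ℤ)) = q := by
      by_contra h
      exact hne (if_neg h)
    rw [← h]
    exact ⟨q'.2, hl hq', rfl⟩

/-- In the coordinates `j` with `s j = 0`, an admissible weight forces the sign of `x j` for which
the exponent of `s j` vanishes. -/
theorem badPart_eq_zero {ξ : Module.Dual ℤ L} (hξ : IsAdmissible ξ)
    {x : Fin n → ℤ} {d : ℕ} (hx : charRes L x = ξ + d • α) {j : Fin n}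
    (hj : (Pi.single j 1 : Fin n → ℤ) ∈ L) : badPart α j (x j) = 0 := by
  classical
  have hxj : x j = d * α ⟨_, hj⟩ := by
    rw [← charRes_apply_single x hj, hx, LinearMap.add_apply, hξ j hj, zero_add,
      LinearMap.smul_apply, nsmul_eq_mul]
  unfold badPart
  split_ifs with h
  · obtain ⟨_, h⟩ := h
    have : x j ≤ 0 := by
      rw [hxj]
      exact mul_nonpos_of_nonneg_of_nonpos (Int.natCast_nonneg d) h.le
    omega
  · have h' : 0 ≤ α ⟨_, hj⟩ := not_lt.1 fun h' => h ⟨hj, h'⟩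
    have : 0 ≤ x j := by
      rw [hxj]
      exact mul_nonneg (Int.natCast_nonneg d) h'
    omega

/-- The multiplicative set generated by the nonzero linear forms `s j`. -/
def formSubmonoid (L : Submodule ℤ (Fin n → ℤ)) : Submonoid (SymG L) :=
  Submonoid.closure {s | ∃ j, (Pi.single j 1 : Fin n → ℤ) ∉ L ∧ s = sElt L j}

theorem sElt_mem_formSubmonoid {j : Fin n} (hj : (Pi.single j 1 : Fin n → ℤ) ∉ L) :
    sElt L j ∈ formSubmonoid L := by
  unfold formSubmonoid
  exact Submonoid.subset_closure ⟨j, hj, rfl⟩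

theorem laurentCoeff_mem {ξ : Module.Dual ℤ L} (hξ : IsAdmissible ξ)
    {x : Fin n → ℤ} {d : ℕ} (hx : charRes L x = ξ + d • α) :
    laurentCoeff L α x ∈ formSubmonoid L := by
  refine Submonoid.prod_mem _ fun j _ => ?_
  by_cases hj : (Pi.single j 1 : Fin n → ℤ) ∈ L
  · rw [badPart_eq_zero hξ hx hj, pow_zero]
    exact Submonoid.one_mem _
  · exact Submonoid.pow_mem _ (sElt_mem_formSubmonoid hj) _

theorem ne_zero_of_mem_formSubmonoid (hL : IsSaturated L) {s : SymG L}
    (hs : s ∈ formSubmonoid L) : s ≠ 0 := by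
  have := isDomain_symG hL
  refine Submonoid.closure_induction (motive := fun s _ => s ≠ 0) ?_ one_ne_zero
    (fun _ _ _ _ hx hy => mul_ne_zero hx hy) hs
  rintro _ ⟨j, hj, rfl⟩
  rwa [Ne, sElt_eq_zero_iff hL]

theorem laurentCoeff_ne_zero (hL : IsSaturated L) {ξ : Module.Dual ℤ L} (hξ : IsAdmissible ξ)
    {x : Fin n → ℤ} {d : ℕ} (hx : charRes L x = ξ + d • α) : laurentCoeff L α x ≠ 0 :=
  ne_zero_of_mem_formSubmonoid hL (laurentCoeff_mem hξ hx)

/-- Semi-invariants of an admissible weight are determined by their restriction to the generic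
stratum. -/
theorem eq_zero_of_toLaurent_eq_zero (hL : IsSaturated L) {ξ : Module.Dual ℤ L}
    (hξ : IsAdmissible ξ) {r : TotalRing L} (hr : r ∈ semiInvAll L α ξ)
    (h : toLaurent L α r = 0) : r = 0 := by
  have := isDomain_symG hL
  obtain ⟨l, hl, hsum, hcoeff, -⟩ := exists_coeff_of_mem_span (α := α) (mem_span_of_semiInvAll L α hr)
  have hl0 : l = 0 := by
    ext ⟨x, d⟩
    by_cases hq : (x, d) ∈ monoIndex L α ξ
    · have := hcoeff x d
      rw [h] at this
      simpa [laurentCoeff_ne_zero hL hξ hq] using this.symm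
    · exact hl _ hq
  rw [hsum, hl0, Finsupp.sum_zero_index]

theorem eq_of_toLaurent_eq (hL : IsSaturated L) {ξ : Module.Dual ℤ L}
    (hξ : IsAdmissible ξ) {r r' : TotalRing L} (hr : r ∈ semiInvAll L α ξ)
    (hr' : r' ∈ semiInvAll L α ξ) (h : toLaurent L α r = toLaurent L α r') : r = r' :=
  sub_eq_zero.1 (eq_zero_of_toLaurent_eq_zero hL hξ (sub_mem hr hr')
    (by rw [map_sub, h, sub_self]))

/-- For semi-invariants of arbitrary weight, the kernel of the restriction is killed by every
invariant monomial of positive degree in `t`: a monomial in the kernel has a factor `z j` or `w j`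
that vanishes on the stable locus, and the invariant monomial contains the other one. -/
theorem mul_monomial_eq_zero (hL : IsSaturated L) (hα : IsGeneric L α) {ξ : Module.Dual ℤ L}
    {r : TotalRing L} (hr : r ∈ semiInvAll L α ξ) (h : toLaurent L α r = 0)
    {m : HVar n →₀ ℕ} (hm : Finsupp.weight (wtT L α) m = 0) (hpos : m .t ≠ 0) (c : ℤ) :
    r * totalMk L (MvPolynomial.monomial m c) = 0 := by
  classical
  have := isDomain_symG hL
  obtain ⟨l, hl, hsum, hcoeff, -⟩ := exists_coeff_of_mem_span (α := α) (mem_span_of_semiInvAll L α hr)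
  rw [hsum, Finsupp.sum, Finset.sum_mul]
  refine Finset.sum_eq_zero fun q hq => ?_
  have hl0 := Finsupp.mem_support_iff.1 hq
  have hc := hcoeff q.1 q.2
  rw [h, AddMonoidAlgebra.coeff_zero, Finsupp.zero_apply, eq_comm, mul_eq_zero] at hc
  have hc' := hc.resolve_left hl0
  rw [laurentCoeff, Finset.prod_eq_zero_iff] at hc'
  obtain ⟨j, -, hj⟩ := hc'
  obtain ⟨hs, hb⟩ := pow_eq_zero_iff'.1 hj
  have hjL := (sElt_eq_zero_iff hL j).1 hs
  rw [totalMk_monomial, smul_mul_smul_comm, monoT_mul, smul_smul]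
  have hα0 := generic_apply_ne_zero hL hα hjL
  have hmj : expDiff m j = m .t * α ⟨_, hjL⟩ := by
    rw [weight_wtT, sub_eq_zero] at hm
    rw [← charRes_apply_single (expDiff m) hjL, hm, LinearMap.smul_apply, nsmul_eq_mul]
  have hov : overlap (q.1 j) (expDiff m j) ≠ 0 := by
    have htpos : (0 : ℤ) < m .t := by omega
    unfold badPart at hb
    unfold overlap
    split_ifs at hb with hf
    · have h1 : 0 < q.1 j := by omega
      have h2 : expDiff m j < 0 := by
        rw [hmj]
        obtain ⟨_, hf⟩ := hf
        exact mul_neg_of_pos_of_neg htpos hf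
      omega
    · have h1 : q.1 j < 0 := by omega
      have h2 : 0 < expDiff m j := by
        rw [hmj]
        exact mul_pos htpos (lt_of_le_of_ne (not_lt.1 fun h' => hf ⟨hjL, h'⟩) hα0.symm)
      omega
  have : ∏ i, sElt L i ^ overlap (q.1 i) (expDiff m i) = 0 :=
    Finset.prod_eq_zero (Finset.mem_univ j) (by rw [hs, zero_pow hov])
  rw [this, mul_zero, zero_smul]

/-! ### The homogeneous coordinate ring as a domain -/

attribute [local instance] MvPolynomial.weightedGradedAlgebra

open Classical in
/-- The moment ideal is generated by invariants, so it meets the ring of invariants in the ideal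
that these generate there. -/
theorem algebraMap_coord_injective :
    Function.Injective (algebraMap (CoordRing L α) (TotalRing L)) := by
  rw [injective_iff_map_eq_zero]
  intro x hx
  obtain ⟨f, rfl⟩ := Ideal.Quotient.mk_surjective x
  refine Ideal.Quotient.eq_zero_iff_mem.2 ?_
  have hf : f.1 ∈ momentIdeal L := Ideal.Quotient.eq_zero_iff_mem.1 hx
  obtain ⟨k, c, g, hsum⟩ := Submodule.mem_span_set'.1 hf
  choose χ hχ hg using fun i => (g i).2
  -- Taking the component of weight zero of the coefficients does not change the sum.
  have hcomp : f.1 = ∑ i, (DirectSum.decompose (polyT L α) (c i) 0).1 * moment (χ i) := by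
    have h0 := DirectSum.decompose_of_mem_same (polyT L α) (show f.1 ∈ polyT L α 0 from f.2)
    rw [← h0, ← hsum, DirectSum.decompose_sum, DFinsupp.finsetSum_apply,
      AddSubmonoidClass.coe_finsetSum]
    refine Finset.sum_congr rfl fun i _ => ?_
    rw [smul_eq_mul, hg i]
    exact DirectSum.coe_decompose_mul_of_right_mem_zero (polyT L α)
      (show moment (χ i) ∈ polyT L α 0 from moment_mem L α (χ i))
  have : f = ∑ i, (⟨(DirectSum.decompose (polyT L α) (c i) 0).1,
      (DirectSum.decompose (polyT L α) (c i) 0).2⟩ : invariants L α) *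
      ⟨moment (χ i), moment_mem L α (χ i)⟩ := by
    refine Subtype.ext ?_
    rw [hcomp, AddSubmonoidClass.coe_finsetSum]
    rfl
  rw [this]
  exact Ideal.sum_mem _ fun i _ => Ideal.mul_mem_left _ _ (Ideal.subset_span ⟨χ i, hχ i, rfl⟩)

theorem algebraMap_coordMk (f : invariants L α) :
    algebraMap (CoordRing L α) (TotalRing L) (coordMk L α f) = totalMk L f.1 := rfl

theorem isAdmissible_zero : IsAdmissible (0 : Module.Dual ℤ L) := fun _ _ => rfl

/-- The restriction of invariant functions to the generic stratum. -/
def coordToLaurent (L : Submodule ℤ (Fin n → ℤ)) (α : Module.Dual ℤ L) :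
    CoordRing L α →+* Laurent L :=
  (toLaurent L α).comp (algebraMap (CoordRing L α) (TotalRing L))

theorem coordToLaurent_apply (g : CoordRing L α) :
    coordToLaurent L α g = toLaurent L α (algebraMap (CoordRing L α) (TotalRing L) g) := rfl

theorem algebraMap_mem_semiInvAll (g : CoordRing L α) :
    algebraMap (CoordRing L α) (TotalRing L) g ∈ semiInvAll L α 0 := by
  obtain ⟨f, rfl⟩ := Ideal.Quotient.mk_surjective g
  exact ⟨f.1, f.2, rfl⟩

theorem coordToLaurent_injective (hL : IsSaturated L) :
    Function.Injective (coordToLaurent L α) := by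
  rw [injective_iff_map_eq_zero]
  intro g hg
  refine (injective_iff_map_eq_zero _).1 algebraMap_coord_injective g ?_
  exact eq_zero_of_toLaurent_eq_zero hL isAdmissible_zero (algebraMap_mem_semiInvAll g) hg

theorem isDomain_laurent (hL : IsSaturated L) : IsDomain (Laurent L) :=
  have := isDomain_symG hL
  inferInstance

theorem isDomain_coordRing (hL : IsSaturated L) : IsDomain (CoordRing L α) :=
  have := isDomain_laurent hL
  (coordToLaurent_injective hL).isDomain

theorem exists_coord_of_semiInv_zero {d : ℕ} {r : TotalRing L} (hr : r ∈ semiInv L α 0 d) :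
    ∃ g ∈ coordGrading L α d, algebraMap (CoordRing L α) (TotalRing L) g = r := by
  obtain ⟨f, hf, rfl⟩ := hr
  exact ⟨coordMk L α ⟨f, hf.1⟩, ⟨⟨f, hf.1⟩, hf.2, rfl⟩, rfl⟩

theorem algebraMap_mem_semiInv {d : ℕ} {g : CoordRing L α} (hg : g ∈ coordGrading L α d) :
    algebraMap (CoordRing L α) (TotalRing L) g ∈ semiInv L α 0 d := by
  obtain ⟨f, hf, rfl⟩ := hg
  exact ⟨f.1, ⟨f.2, hf⟩, rfl⟩

theorem semiInv_mul_mem {χ ψ : Module.Dual ℤ L} {d e : ℕ} {r r' : TotalRing L}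
    (hr : r ∈ semiInv L α χ d) (hr' : r' ∈ semiInv L α ψ e) :
    r * r' ∈ semiInv L α (χ + ψ) (d + e) := by
  obtain ⟨f, hf, rfl⟩ := hr
  obtain ⟨g, hg, rfl⟩ := hr'
  exact ⟨f * g, ⟨MvPolynomial.IsWeightedHomogeneous.mul hf.1 hg.1,
    MvPolynomial.IsWeightedHomogeneous.mul hf.2 hg.2⟩, rfl⟩

theorem zw_mul_mem_semiInv {χ : Module.Dual ℤ L} {d : ℕ} {r : TotalRing L} (i : Fin n)
    (hr : r ∈ semiInv L α χ d) : totalMk L (zw i) * r ∈ semiInv L α χ d :=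
  mul_mem_semiInv L α (zw_mem_polyT L α i χ) (zw_mem_polyt i) d r hr

theorem smul_mem_semiInv {χ : Module.Dual ℤ L} {d : ℕ} (s : SymG L) {r : TotalRing L}
    (hr : r ∈ semiInv L α χ d) : s • r ∈ semiInv L α χ d := by
  have hs : s ∈ Algebra.adjoin ℤ (Set.range (sElt L)) := by
    rw [adjoin_sElt]
    trivial
  induction hs using Algebra.adjoin_induction generalizing r with
  | mem x hx =>
    obtain ⟨i, rfl⟩ := hx
    rw [Algebra.smul_def, algebraMap_sElt]
    exact zw_mul_mem_semiInv i hr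
  | algebraMap k =>
    rw [algebraMap_smul]
    exact Submodule.smul_mem _ _ hr
  | add x y _ _ hx hy =>
    rw [add_smul]
    exact add_mem (hx hr) (hy hr)
  | mul x y _ _ hx hy =>
    rw [mul_smul]
    exact hx (hy hr)

/-! ### Extension of semi-invariants over the unstable locus -/

/-- A product of primes divides `X` if for each of its prime factors it divides `X` up to a cofactor
prime to this factor. -/
theorem prod_dvd_of_forall_prime {R : Type*} [CommRing R] [IsDomain R] (ps : Multiset R)
    (hps : ∀ q ∈ ps, Prime q) (X : R) (h : ∀ q ∈ ps, ∃ E, ¬ q ∣ E ∧ ps.prod ∣ X * E) :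
    ps.prod ∣ X := by
  induction ps using Multiset.induction_on generalizing X with
  | empty => simp
  | cons q ps ih =>
    rw [Multiset.prod_cons] at h ⊢
    have hq := hps q (Multiset.mem_cons_self q ps)
    obtain ⟨E, hE, hdvd⟩ := h q (Multiset.mem_cons_self q ps)
    obtain ⟨X', rfl⟩ := (hq.dvd_or_dvd ((dvd_mul_right q _).trans hdvd)).resolve_right hE
    refine mul_dvd_mul_left q (ih (fun r hr => hps r (Multiset.mem_cons_of_mem hr)) X' ?_)
    intro r hr
    obtain ⟨E, hE, hdvd⟩ := h r (Multiset.mem_cons_of_mem hr)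
    rw [mul_assoc] at hdvd
    exact ⟨E, hE, (mul_dvd_mul_iff_left hq.ne_zero).1 hdvd⟩

theorem badPart_add_le (j : Fin n) (a b : ℤ) (N : ℕ) :
    badPart α j (a + N * b) ≤ badPart α j a + N * badPart α j b := by
  classical
  unfold badPart
  split_ifs
  · zify
    rw [Int.ofNat_toNat, Int.ofNat_toNat, Int.ofNat_toNat]
    have : (N : ℤ) * b ≤ N * max b 0 := mul_le_mul_of_nonneg_left (le_max_left _ _) (by positivity)
    have h2 : (0 : ℤ) ≤ N * max b 0 := mul_nonneg (by positivity) (le_max_right _ _)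
    have := le_max_left a 0
    have := le_max_right a 0
    exact max_le (by linarith) (by linarith)
  · zify
    rw [Int.ofNat_toNat, Int.ofNat_toNat, Int.ofNat_toNat]
    have : (N : ℤ) * -b ≤ N * max (-b) 0 :=
      mul_le_mul_of_nonneg_left (le_max_left _ _) (by positivity)
    have h2 : (0 : ℤ) ≤ N * max (-b) 0 := mul_nonneg (by positivity) (le_max_right _ _)
    have := le_max_left (-a) 0
    have := le_max_right (-a) 0
    exact max_le (by linarith) (by linarith)

theorem badPart_add_eq (j : Fin n) {a b : ℤ} (N : ℕ) (h : 0 ≤ a * b) :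
    badPart α j (a + N * b) = badPart α j a + N * badPart α j b := by
  classical
  have hN : (0 : ℤ) ≤ N := Int.natCast_nonneg N
  rcases mul_nonneg_iff.1 h with ⟨ha, hb⟩ | ⟨ha, hb⟩
  · have h1 := mul_nonneg hN hb
    unfold badPart
    split_ifs
    · zify
      rw [Int.toNat_of_nonneg (by linarith), Int.toNat_of_nonneg ha, Int.toNat_of_nonneg hb]
    · rw [Int.toNat_of_nonpos (by linarith), Int.toNat_of_nonpos (by linarith),
        Int.toNat_of_nonpos (by linarith), mul_zero, add_zero]
  · have h1 := mul_nonpos_of_nonneg_of_nonpos hN hb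
    unfold badPart
    split_ifs
    · rw [Int.toNat_of_nonpos (by linarith), Int.toNat_of_nonpos (by linarith),
        Int.toNat_of_nonpos (by linarith), mul_zero, add_zero]
    · zify
      rw [Int.toNat_of_nonneg (by linarith), Int.toNat_of_nonneg (by linarith),
        Int.toNat_of_nonneg (by linarith)]
      ring

/-- The factorization of coefficients along a lift `a` of `α`. The cofactor is a product of forms
`s j` over the coordinates in which the signs of `y` and `a` are incompatible. -/
theorem laurentCoeff_mul_pow (y a : Fin n → ℤ) (N : ℕ) :
    ∃ e : Fin n → ℕ, (∀ j, 0 ≤ y j * a j → e j = 0) ∧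
      laurentCoeff L α y * laurentCoeff L α a ^ N =
        (∏ j, sElt L j ^ e j) * laurentCoeff L α (y + N • a) := by
  refine ⟨fun j => badPart α j (y j) + N * badPart α j (a j) - badPart α j (y j + N * a j),
    fun j hj => ?_, ?_⟩
  · simp only [badPart_add_eq j N hj, Nat.sub_self]
  · simp only [laurentCoeff, ← Finset.prod_pow, ← Finset.prod_mul_distrib, ← pow_mul, ← pow_add]
    refine Finset.prod_congr rfl fun j _ => ?_
    congr 1
    have := badPart_add_le (α := α) j (y j) (a j) N
    rw [Pi.add_apply, Pi.smul_apply, nsmul_eq_mul]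
    rw [Nat.sub_add_cancel this, mul_comm (badPart α j (a j))]

theorem toLaurent_monoT_pow (a : Fin n → ℤ) (N : ℕ) :
    toLaurent L α (monoT L a 1) ^ N =
      .single (N • a, (N : ℤ)) (laurentCoeff L α a ^ N) := by
  rw [toLaurent_monoT, AddMonoidAlgebra.single_pow]
  simp

/-- A quotient `B / D` of Laurent polynomials that on every chart of the stable locus is a regular
semi-invariant of weight `ξ` extends to the whole spectrum of the total coordinate ring, provided
that `ξ` lies in the window. -/
theorem exists_semiInv_of_forall_chart (hL : IsSaturated L) (hU : IsUnimodular L)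
    {ξ : Module.Dual ℤ L} (hξ : IsAdmissible ξ) (hw : InWindow α ξ) {B D : Laurent L} (hD : D ≠ 0)
    (h : ∀ a, charRes L a = α → ∃ N : ℕ, ∃ r ∈ semiInv L α ξ N,
      B * toLaurent L α (monoT L a 1) ^ N = D * toLaurent L α r) :
    ∃ r ∈ semiInv L α ξ 0, B = D * toLaurent L α r := by
  classical
  have := isDomain_symG hL
  have := isDomain_laurent hL
  obtain ⟨a₀, ha₀⟩ := charRes_surjective hL α
  obtain ⟨N₀, r₀, hr₀, hB₀⟩ := h a₀ ha₀
  obtain ⟨l₀, hl₀, -, hcoeff₀, hsupp₀⟩ :=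
    exists_coeff_of_mem_span (α := α) (mem_span_of_semiInv L α hr₀)
  have hca : ∀ a, charRes L a = α → laurentCoeff L α a ∈ formSubmonoid L := fun a ha =>
    laurentCoeff_mem isAdmissible_zero (d := 1) (by rw [ha, zero_add, one_smul])
  -- The coefficient of `r₀` at the monomial of `y + N₀ • a₀` is divisible by what is needed for the
  -- coefficient of the quotient at the monomial of `y` to come from a semi-invariant. For the prime
  -- `s i` this is seen on the chart of a lift `a` whose signs are compatible with those of `y` in
  -- the coordinates parallel to the `i`-th.
  have key : ∀ y, charRes L y = ξ → laurentCoeff L α a₀ ^ N₀ * laurentCoeff L α y ∣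
      (toLaurent L α r₀).coeff (y + N₀ • a₀, (N₀ : ℤ)) := by
    intro y hy
    have hmem : laurentCoeff L α a₀ ^ N₀ * laurentCoeff L α y ∈ formSubmonoid L :=
      Submonoid.mul_mem _ (Submonoid.pow_mem _ (hca a₀ ha₀) _)
        (laurentCoeff_mem hξ (d := 0) (by rw [hy, zero_smul, add_zero]))
    obtain ⟨ps, hps, hprod⟩ := Submonoid.exists_multiset_of_mem_closure hmem
    rw [← hprod]
    refine prod_dvd_of_forall_prime ps ?_ _ ?_
    · intro q hq
      obtain ⟨i, hi, rfl⟩ := hps q hq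
      exact prime_sElt hL hU hi
    intro q hq
    obtain ⟨i, hi, rfl⟩ := hps q hq
    rw [hprod]
    obtain ⟨a, ha, hcompat⟩ := hw y hy i hi
    obtain ⟨N, r, hr, hB⟩ := h a ha
    obtain ⟨l, hl, -, hcoeff, -⟩ :=
      exists_coeff_of_mem_span (α := α) (mem_span_of_semiInv L α hr)
    obtain ⟨e, he, hfac⟩ := laurentCoeff_mul_pow (L := L) (α := α) y a N
    refine ⟨∏ j, sElt L j ^ e j, fun hdvd => ?_, ?_⟩
    · obtain ⟨j, -, hj⟩ := (prime_sElt hL hU hi).exists_mem_finset_dvd hdvd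
      have hej : e j ≠ 0 := fun h0 => by
        rw [h0, pow_zero] at hj
        exact (prime_sElt hL hU hi).not_dvd_one hj
      exact hej (he j (hcompat j ((prime_sElt hL hU hi).dvd_of_dvd_pow hj)))
    -- Comparison of the chart of `a` with the chart of `a₀`.
    have hcross : toLaurent L α r * toLaurent L α (monoT L a₀ 1) ^ N₀ =
        toLaurent L α r₀ * toLaurent L α (monoT L a 1) ^ N := by
      refine mul_left_cancel₀ hD ?_
      rw [← mul_assoc, ← mul_assoc, ← hB, ← hB₀]
      ring
    rw [toLaurent_monoT_pow, toLaurent_monoT_pow] at hcross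
    have hc := congrArg (fun q => AddMonoidAlgebra.coeff q
      ((y + N • a, (N : ℤ)) + (N₀ • a₀, (N₀ : ℤ)))) hcross
    simp only [AddMonoidAlgebra.coeff_mul_single_add] at hc
    have hswap : (y + N • a, (N : ℤ)) + (N₀ • a₀, (N₀ : ℤ)) =
        (y + N₀ • a₀, (N₀ : ℤ)) + (N • a, (N : ℤ)) := by
      rw [Prod.mk_add_mk, Prod.mk_add_mk, add_right_comm, add_comm (N : ℤ)]
    rw [hswap, AddMonoidAlgebra.coeff_mul_single_add, hcoeff] at hc
    set X := (toLaurent L α r₀).coeff (y + N₀ • a₀, (N₀ : ℤ))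
    refine ⟨l (y + N • a, N), mul_right_cancel₀ (b := laurentCoeff L α (y + N • a)) ?_ ?_⟩
    · refine laurentCoeff_ne_zero hL hξ (d := N) ?_
      rw [map_add, map_nsmul, hy, ha]
    · rw [mul_assoc, ← hfac]
      linear_combination -(laurentCoeff L α y) * hc
  -- The quotients `f y` are the coefficients of the extension.
  choose! f hf using key
  have hy : ∀ q ∈ (toLaurent L α r₀).coeff.support,
      charRes L (q.1 - N₀ • a₀) = ξ ∧ q.2 = N₀ := by
    intro q hq
    obtain ⟨d, ⟨hd, hd'⟩, hd''⟩ := hsupp₀ q (Finsupp.mem_support_iff.1 hq)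
    obtain rfl : d = N₀ := hd'
    refine ⟨?_, hd''⟩
    have : charRes L q.1 = ξ + d • α := hd
    rw [map_sub, map_nsmul, ha₀, this, add_sub_cancel_right]
  refine ⟨∑ q ∈ (toLaurent L α r₀).coeff.support,
    f (q.1 - N₀ • a₀) • monoT L (q.1 - N₀ • a₀) 0, ?_, ?_⟩
  · refine Submodule.sum_mem _ fun q hq => smul_mem_semiInv _ (monoT_mem_semiInv L α ?_)
    rw [(hy q hq).1, zero_smul, add_zero]
  · have hF : toLaurent L α (monoT L a₀ 1) ^ N₀ ≠ 0 := by
      rw [toLaurent_monoT_pow]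
      intro h0
      have := congrArg (fun q => AddMonoidAlgebra.coeff q (N₀ • a₀, (N₀ : ℤ))) h0
      simp only [AddMonoidAlgebra.coeff_single, Finsupp.single_eq_same, AddMonoidAlgebra.coeff_zero,
        Finsupp.zero_apply] at this
      exact ne_zero_of_mem_formSubmonoid hL (Submonoid.pow_mem _ (hca a₀ ha₀) _) this
    refine mul_right_cancel₀ hF ?_
    rw [hB₀, mul_assoc]
    congr 1
    rw [map_sum, Finset.sum_mul]
    conv_lhs => rw [← AddMonoidAlgebra.sum_coeff_single (toLaurent L α r₀), Finsupp.sum]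
    refine Finset.sum_congr rfl fun q hq => ?_
    rw [toLaurent_smul, toLaurent_monoT, toLaurent_monoT_pow, AddMonoidAlgebra.smul_single,
      AddMonoidAlgebra.single_mul_single]
    have h1 := hf _ (hy q hq).1
    rw [sub_add_cancel, ← (hy q hq).2] at h1
    congr 1
    · refine Prod.ext ?_ ?_
      · simp
      · simp [(hy q hq).2]
    · rw [h1, smul_eq_mul]
      ring

end Restriction

/-! ### Sections of the line bundles and the generic point -/

section Sections

variable {n : ℕ} {L : Submodule ℤ (Fin n → ℤ)} {α : Module.Dual ℤ L}

/-- The points of the hypertoric variety. -/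
abbrev HPoint (L : Submodule ℤ (Fin n → ℤ)) (α : Module.Dual ℤ L) : Type :=
  ProjectiveSpectrum (coordGrading L α)

/-- Sections of the line bundle `ℓ(χ)`. -/
abbrev Sec (χ : Module.Dual ℤ L) (U : Opens (HPoint L α)) : Type :=
  tildeSections (coordGrading L α) (semiInv L α χ) U

/-- The action of a homomorphism of line bundles on sections. -/
def secMap {χ ψ : Module.Dual ℤ L} (φ : lineBundle L α χ ⟶ lineBundle L α ψ)
    (U : Opens (HPoint L α)) (s : Sec χ U) : Sec ψ U := φ.app U s

theorem hom_ext_secMap {χ ψ : Module.Dual ℤ L} {φ φ' : lineBundle L α χ ⟶ lineBundle L α ψ}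
    (h : ∀ U (s : Sec χ U), secMap φ U s = secMap φ' U s) : φ = φ' := by
  refine Scheme.Modules.hom_ext _ _ fun U => ?_
  ext s
  exact h U s

theorem secMap_smul {χ ψ : Module.Dual ℤ L} (φ : lineBundle L α χ ⟶ lineBundle L α ψ)
    (U : Opens (HPoint L α))
    (r : (ProjectiveSpectrum.Proj.structureSheaf (coordGrading L α)).1.obj (op U)) (s : Sec χ U) :
    secMap φ U (tildeSMul (coordGrading L α) (semiInv L α χ) U r s) =
      tildeSMul (coordGrading L α) (semiInv L α ψ) U r (secMap φ U s) :=
  Scheme.Modules.Hom.app_smul φ r s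

theorem secMap_res {χ ψ : Module.Dual ℤ L} (φ : lineBundle L α χ ⟶ lineBundle L α ψ)
    {U V : Opens (HPoint L α)} (h : V ≤ U) (s : Sec χ U) :
    secMap φ V (tildeRes (coordGrading L α) (semiInv L α χ) h s) =
      tildeRes (coordGrading L α) (semiInv L α ψ) h (secMap φ U s) := by
  have := φ.mapPresheaf.naturality (X := op U) (Y := op V) (homOfLE h).op
  exact ConcreteCategory.congr_hom this s

/-- Multiplication by a semi-invariant of degree zero in `t`. -/
def mulSemi {χ ψ : Module.Dual ℤ L} (r : TotalRing L) (hr : r ∈ semiInv L α (ψ - χ) 0) :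
    lineBundle L α χ ⟶ lineBundle L α ψ :=
  tildeMap (LinearMap.mulLeft (CoordRing L α) r) fun d m hm => by
    have := semiInv_mul_mem hr hm
    rwa [sub_add_cancel, zero_add] at this

theorem secMap_mulSemi {χ ψ : Module.Dual ℤ L} (r : TotalRing L)
    (hr : r ∈ semiInv L α (ψ - χ) 0) (U : Opens (HPoint L α)) (s : Sec χ U) (x : U) :
    (secMap (mulSemi (α := α) r hr) U s).1 x =
      LocalizedModule.map (ptCompl (coordGrading L α) x.1)
        (LinearMap.mulLeft (CoordRing L α) r) (s.1 x) := rfl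

theorem secMap_mulSemi_mk {χ ψ : Module.Dual ℤ L} {r : TotalRing L}
    (hr : r ∈ semiInv L α (ψ - χ) 0) {U : Opens (HPoint L α)} {s : Sec χ U} {x : U}
    {m : TotalRing L} {f : ptCompl (coordGrading L α) x.1} (h : s.1 x = LocalizedModule.mk m f) :
    (secMap (mulSemi (α := α) r hr) U s).1 x = LocalizedModule.mk (r * m) f := by
  rw [secMap_mulSemi, h, LocalizedModule.map_mk]
  rfl

/-- The section given by a fraction of homogeneous elements whose denominator does not vanish. -/
def fracSec {χ : Module.Dual ℤ L} {d : ℕ} {m : TotalRing L} (hm : m ∈ semiInv L α χ d)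
    {f : CoordRing L α} (hf : f ∈ coordGrading L α d) (U : Opens (HPoint L α))
    (hU : ∀ y : U, f ∈ ptCompl (coordGrading L α) y.1) : Sec (α := α) χ U :=
  ⟨fun y => LocalizedModule.mk m ⟨f, hU y⟩,
    fun x => ⟨U, x.2, le_rfl, d, m, hm, f, hf, fun y => ⟨hU y, rfl⟩⟩⟩

/-- The function given by a fraction of homogeneous elements whose denominator does not vanish. -/
def fracFun {d : ℕ} {g f : CoordRing L α} (hg : g ∈ coordGrading L α d)
    (hf : f ∈ coordGrading L α d) (U : Opens (HPoint L α))
    (hU : ∀ y : U, f ∈ ptCompl (coordGrading L α) y.1) :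
    (ProjectiveSpectrum.Proj.structureSheaf (coordGrading L α)).1.obj (op U) :=
  ⟨fun y => HomogeneousLocalization.mk ⟨d, ⟨g, hg⟩, ⟨f, hf⟩, hU y⟩,
    fun x => ⟨U, x.2, 𝟙 _, d, ⟨g, hg⟩, ⟨f, hf⟩, hU, fun _ => rfl⟩⟩

theorem fracFun_smul {χ : Module.Dual ℤ L} {d : ℕ} {g f : CoordRing L α}
    (hg : g ∈ coordGrading L α d) (hf : f ∈ coordGrading L α d) {U : Opens (HPoint L α)}
    (hU : ∀ y : U, f ∈ ptCompl (coordGrading L α) y.1) {s : Sec χ U} {x : U} {m : TotalRing L}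
    {f' : ptCompl (coordGrading L α) x.1} (h : s.1 x = LocalizedModule.mk m f') :
    (tildeSMul (coordGrading L α) (semiInv L α χ) U (fracFun hg hf U hU) s).1 x =
      LocalizedModule.mk (g • m) (⟨f, hU x⟩ * f') := by
  show ((fracFun hg hf U hU).1 x).val • s.1 x = _
  have e : (fracFun hg hf U hU).1 x = HomogeneousLocalization.mk ⟨d, ⟨g, hg⟩, ⟨f, hf⟩, hU x⟩ := rfl
  rw [h, e, HomogeneousLocalization.val_mk, LocalizedModule.mk_smul_mk]

/-- The invariant function of degree one in `t` given by a lift of `α`. -/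
def chartElt (a : Fin n → ℤ) (ha : charRes L a = α) : CoordRing L α :=
  coordMk L α ⟨mono a * MvPolynomial.X .t ^ 1, by
    have := (monoT_mem L α a 1).1
    rwa [ha, one_smul, sub_self] at this⟩

theorem chartElt_mem (a : Fin n → ℤ) (ha : charRes L a = α) :
    chartElt a ha ∈ coordGrading L α 1 :=
  ⟨_, (monoT_mem L α a 1).2, rfl⟩

theorem algebraMap_chartElt (a : Fin n → ℤ) (ha : charRes L a = α) :
    algebraMap (CoordRing L α) (TotalRing L) (chartElt a ha) = monoT L a 1 := rfl

theorem coordToLaurent_chartElt (a : Fin n → ℤ) (ha : charRes L a = α) :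
    coordToLaurent L α (chartElt a ha) = toLaurent L α (monoT L a 1) := rfl

theorem toLaurent_monoT_ne_zero (hL : IsSaturated L) {ξ : Module.Dual ℤ L} (hξ : IsAdmissible ξ)
    {x : Fin n → ℤ} {d : ℕ} (hx : charRes L x = ξ + d • α) : toLaurent L α (monoT L x d) ≠ 0 := by
  rw [toLaurent_monoT]
  intro h0
  have := congrArg (fun q => AddMonoidAlgebra.coeff q (x, (d : ℤ))) h0
  simp only [AddMonoidAlgebra.coeff_single, Finsupp.single_eq_same, AddMonoidAlgebra.coeff_zero,
    Finsupp.zero_apply] at this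
  exact laurentCoeff_ne_zero hL hξ hx this

theorem chartElt_ne_zero (hL : IsSaturated L) (a : Fin n → ℤ) (ha : charRes L a = α) :
    chartElt a ha ≠ 0 := by
  intro h
  have := coordToLaurent_chartElt a ha
  rw [h, map_zero] at this
  exact toLaurent_monoT_ne_zero hL isAdmissible_zero (d := 1)
    (by rw [ha, zero_add, one_smul]) this.symm

/-- The generic point. -/
def genPt (hL : IsSaturated L) (α : Module.Dual ℤ L) : HPoint L α where
  asHomogeneousIdeal := ⊥
  isPrime := by
    have := isDomain_coordRing (α := α) hL
    exact Ideal.isPrime_bot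
  not_irrelevant_le h := by
    obtain ⟨a, ha⟩ := charRes_surjective hL α
    have := h (HomogeneousIdeal.mem_irrelevant_of_mem (coordGrading L α) one_pos
      (chartElt_mem a ha))
    exact chartElt_ne_zero hL a ha ((Submodule.mem_bot _).1 this)

theorem mem_ptCompl_genPt (hL : IsSaturated L) {f : CoordRing L α} :
    f ∈ ptCompl (coordGrading L α) (genPt hL α) ↔ f ≠ 0 :=
  not_congr (Submodule.mem_bot _)

/-- The generic point lies in every nonempty open set. -/
theorem genPt_mem (hL : IsSaturated L) {U : Opens (HPoint L α)} {x : HPoint L α} (hx : x ∈ U) :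
    genPt hL α ∈ U := by
  have hle : genPt hL α ≤ x := by
    rw [← ProjectiveSpectrum.as_ideal_le_as_ideal]
    exact (bot_le : (⊥ : Ideal (CoordRing L α)) ≤ _)
  have hcl := (ProjectiveSpectrum.le_iff_mem_closure _ _ _).1 hle
  obtain ⟨y, hyU, hy⟩ := mem_closure_iff.1 hcl U U.isOpen hx
  rwa [← Set.mem_singleton_iff.1 hy]

theorem toLaurent_smul_coord (g : CoordRing L α) (m : TotalRing L) :
    toLaurent L α (g • m) = coordToLaurent L α g * toLaurent L α m := by
  rw [Algebra.smul_def, map_mul, coordToLaurent_apply]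

/-- At every point some invariant monomial of positive degree in `t` does not vanish. -/
theorem exists_monomial_notMem (x : HPoint L α) : ∃ (m : HVar n →₀ ℕ) (c : ℤ),
    Finsupp.weight (wtT L α) m = 0 ∧ m .t ≠ 0 ∧ ∃ g ∈ ptCompl (coordGrading L α) x,
      algebraMap (CoordRing L α) (TotalRing L) g = totalMk L (MvPolynomial.monomial m c) := by
  by_contra! hcon
  refine x.not_irrelevant_le ?_
  rw [HomogeneousIdeal.irrelevant_le]
  rintro d hd _ ⟨f, hf, rfl⟩
  have hmon : ∀ m ∈ f.1.support, MvPolynomial.monomial m (f.1.coeff m) ∈ polyT L α 0 := by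
    intro m hm
    exact MvPolynomial.isWeightedHomogeneous_monomial _ _ _
      (f.2 (MvPolynomial.mem_support_iff.1 hm))
  have hsum : f = ∑ m ∈ f.1.support.attach,
      (⟨_, hmon m.1 m.2⟩ : invariants L α) := by
    refine Subtype.ext ?_
    rw [AddSubmonoidClass.coe_finsetSum, Finset.sum_attach f.1.support
      (fun m => MvPolynomial.monomial m (f.1.coeff m))]
    exact MvPolynomial.as_sum f.1
  show coordMk L α f ∈ x.asHomogeneousIdeal.toIdeal
  rw [hsum, map_sum]
  refine Ideal.sum_mem _ fun m _ => ?_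
  by_contra hnot
  have hm := MvPolynomial.mem_support_iff.1 m.2
  refine hcon m.1 (f.1.coeff m.1) (f.2 hm) ?_ _ hnot rfl
  have := hf hm
  rw [weight_degt] at this
  rw [this]
  exact hd.ne'

/-- A fraction vanishes at the generic point only if its numerator restricts to zero; the converse
holds at every point and is `mk_eq_zero_of_toLaurent`. -/
theorem toLaurent_eq_zero_of_mk (hL : IsSaturated L) {m : TotalRing L}
    {f : ptCompl (coordGrading L α) (genPt hL α)} (h : LocalizedModule.mk m f = 0) :
    toLaurent L α m = 0 := by
  have := isDomain_laurent hL
  rw [← LocalizedModule.zero_mk 1, LocalizedModule.mk_eq] at h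
  obtain ⟨u, hu⟩ := h
  rw [smul_zero, smul_zero, one_smul, Submonoid.smul_def] at hu
  have h2 := congrArg (toLaurent L α) hu
  rw [toLaurent_smul_coord, map_zero] at h2
  refine (mul_eq_zero.1 h2).resolve_left fun h3 => ?_
  exact (mem_ptCompl_genPt hL).1 u.2 ((injective_iff_map_eq_zero _).1 (coordToLaurent_injective hL) _ h3)

theorem mk_eq_zero_of_toLaurent (hL : IsSaturated L) (hα : IsGeneric L α) {ξ : Module.Dual ℤ L}
    {m : TotalRing L} (hm : m ∈ semiInvAll L α ξ) (h : toLaurent L α m = 0) (x : HPoint L α)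
    (f : ptCompl (coordGrading L α) x) : LocalizedModule.mk m f = 0 := by
  obtain ⟨v, c, hw, hpos, g, hg, he⟩ := exists_monomial_notMem x
  rw [← LocalizedModule.zero_mk 1, LocalizedModule.mk_eq]
  refine ⟨⟨g, hg⟩, ?_⟩
  rw [smul_zero, smul_zero, one_smul, Submonoid.smul_def, Algebra.smul_def, he, mul_comm]
  exact mul_monomial_eq_zero hL hα hm h hw hpos c

/-- Fractions that agree at the generic point have restrictions that agree after
cross-multiplication. -/
theorem toLaurent_of_mk_eq (hL : IsSaturated L) {m m' : TotalRing L}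
    {f f' : ptCompl (coordGrading L α) (genPt hL α)}
    (h : LocalizedModule.mk m f = LocalizedModule.mk m' f') :
    coordToLaurent L α f'.1 * toLaurent L α m = coordToLaurent L α f.1 * toLaurent L α m' := by
  have := isDomain_laurent hL
  obtain ⟨u, hu⟩ := LocalizedModule.mk_eq.1 h
  simp only [Submonoid.smul_def] at hu
  have h2 := congrArg (toLaurent L α) hu
  simp only [toLaurent_smul_coord] at h2
  refine mul_left_cancel₀ (fun h3 => ?_) h2
  exact (mem_ptCompl_genPt hL).1 u.2 ((injective_iff_map_eq_zero _).1 (coordToLaurent_injective hL) _ h3)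

/-- Sections of the line bundles are determined by their values at the generic point. -/
theorem sec_eq_zero_of_genPt (hL : IsSaturated L) (hα : IsGeneric L α) {χ : Module.Dual ℤ L}
    {U : Opens (HPoint L α)} (s : Sec χ U) (h : ∀ hη : genPt hL α ∈ U, s.1 ⟨_, hη⟩ = 0) :
    s = 0 := by
  refine Subtype.ext (funext fun x => ?_)
  obtain ⟨V, hxV, hVU, d, m, hm, f, hf, hfrac⟩ := s.2 x
  have hηV := genPt_mem hL hxV
  obtain ⟨h1, e1⟩ := hfrac ⟨_, hηV⟩
  obtain ⟨h2, e2⟩ := hfrac ⟨_, hxV⟩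
  rw [h] at e1
  have h0 := toLaurent_eq_zero_of_mk hL e1.symm
  exact e2.trans (mk_eq_zero_of_toLaurent hL hα (semiInv_le L α χ d hm) h0 _ _)

theorem sec_ext_genPt (hL : IsSaturated L) (hα : IsGeneric L α) {χ : Module.Dual ℤ L}
    {U : Opens (HPoint L α)} {s s' : Sec χ U}
    (h : ∀ hη : genPt hL α ∈ U, s.1 ⟨_, hη⟩ = s'.1 ⟨_, hη⟩) : s = s' :=
  sub_eq_zero.1 (sec_eq_zero_of_genPt hL hα (s - s') fun hη => sub_eq_zero.2 (h hη))

/-! ### Homomorphisms of line bundles -/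

/-- Local generators of `ℓ(χ)` and of its inverse on the chart given by a lift `a` of `α`: the
exponents have support in the support of `a`, and adding a multiple of `a` aligns their signs with
those of `a`. -/
theorem exists_generator (hL : IsSaturated L) (hU : IsUnimodular L) (hα : IsGeneric L α)
    {a : Fin n → ℤ} (ha : charRes L a = α) (χ : Module.Dual ℤ L) :
    ∃ (j : ℕ) (x y : Fin n → ℤ), charRes L x = χ + j • α ∧ charRes L y = -χ + j • α ∧
      monoT L x j * monoT L y j = monoT L a 1 ^ (j + j) := by
  obtain ⟨b, hb, hsupp⟩ := exists_lift_of_support hL hU hα ha χ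
  set j := ∑ i, (b i).natAbs with hj
  have hpow : ∀ N : ℕ, monoT L a 1 ^ N = monoT L (N • a) N := by
    intro N
    induction N with
    | zero => rw [pow_zero, zero_smul, monoT_zero]
    | succ N ih =>
      rw [pow_succ, ih, monoT_mul]
      have : ∏ i, sElt L i ^ overlap ((N • a) i) (a i) = 1 := by
        refine Finset.prod_eq_one fun i _ => ?_
        have : overlap ((N • a) i) (a i) = 0 := by
          rw [Pi.smul_apply, nsmul_eq_mul]
          unfold overlap
          have h1 : ((N : ℤ) * a i + a i) = (N + 1 : ℕ) * a i := by push_cast; ring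
          rw [h1, Int.natAbs_mul, Int.natAbs_mul]
          simp only [Int.natAbs_natCast]
          rw [Nat.succ_mul, Nat.sub_self]
        rw [this, pow_zero]
      rw [this, one_smul, succ_nsmul]
  refine ⟨j, b + j • a, -b + j • a, by rw [map_add, map_nsmul, hb, ha],
    by rw [map_add, map_neg, map_nsmul, hb, ha], ?_⟩
  rw [monoT_mul, hpow, add_nsmul]
  have hsum : b + j • a + (-b + j • a) = j • a + j • a := by abel
  have : ∏ i, sElt L i ^ overlap ((b + j • a) i) ((-b + j • a) i) = 1 := by
    refine Finset.prod_eq_one fun i _ => ?_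
    have hij : (b i).natAbs ≤ j :=
      Finset.single_le_sum (f := fun k => (b k).natAbs) (fun k _ => Nat.zero_le _)
        (Finset.mem_univ i)
    have : overlap ((b + j • a) i) ((-b + j • a) i) = 0 := by
      rw [Pi.add_apply, Pi.add_apply, Pi.smul_apply, Pi.neg_apply, nsmul_eq_mul]
      unfold overlap
      rcases lt_trichotomy (a i) 0 with h | h | h
      · have : (j : ℤ) * a i ≤ j * (-1) :=
          mul_le_mul_of_nonneg_left (by omega) (Int.natCast_nonneg j)
        generalize (j : ℤ) * a i = q at *
        omega
      · rw [h, hsupp i h]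
        simp
      · have : (j : ℤ) * 1 ≤ j * a i :=
          mul_le_mul_of_nonneg_left (by omega) (Int.natCast_nonneg j)
        generalize (j : ℤ) * a i = q at *
        omega
    rw [this, pow_zero]
  rw [this, one_smul, hsum]

set_option maxHeartbeats 1000000 in
/-- A homomorphism of line bundles acts at the generic point as multiplication by a fraction. -/
theorem exists_multiplier (hL : IsSaturated L) (hU : IsUnimodular L) (hα : IsGeneric L α)
    {χ ψ : Module.Dual ℤ L} (φ : lineBundle L α χ ⟶ lineBundle L α ψ) :
    ∃ k, ∃ m₁ ∈ semiInv L α (ψ - χ) k, ∃ g₁ ∈ coordGrading L α k,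
      g₁ ∈ ptCompl (coordGrading L α) (genPt hL α) ∧
      ∀ (U : Opens (HPoint L α)) (s : Sec χ U) (hη : genPt hL α ∈ U),
        ∃ d, ∃ m ∈ semiInv L α χ d, ∃ f ∈ coordGrading L α d,
        ∃ hf : f ∈ ptCompl (coordGrading L α) (genPt hL α),
        ∃ hfg : f * g₁ ∈ ptCompl (coordGrading L α) (genPt hL α),
          s.1 ⟨_, hη⟩ = LocalizedModule.mk m ⟨f, hf⟩ ∧
          (secMap φ U s).1 ⟨_, hη⟩ = LocalizedModule.mk (m₁ * m) ⟨f * g₁, hfg⟩ := by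
  obtain ⟨a, ha⟩ := charRes_surjective hL α
  obtain ⟨j, x, y, hx, hy, hxy⟩ := exists_generator hL hU hα ha χ
  set f₀ := chartElt a ha with hf₀
  have hf₀j : f₀ ^ j ∈ coordGrading L α j := by
    have := SetLike.pow_mem_graded j (chartElt_mem a ha)
    rwa [smul_eq_mul, mul_one] at this
  set U₀ := ProjectiveSpectrum.basicOpen (coordGrading L α) f₀
  have hU₀ : ∀ z : U₀, f₀ ^ j ∈ ptCompl (coordGrading L α) z.1 := fun z =>
    Submonoid.pow_mem (ptCompl (coordGrading L α) z.1) z.2 j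
  have hη₀ : genPt hL α ∈ U₀ := (mem_ptCompl_genPt hL).2 (chartElt_ne_zero hL a ha)
  have hA := monoT_mem_semiInv L α hx
  have hA' := monoT_mem_semiInv L α hy
  set u₀ : Sec χ U₀ := fracSec hA hf₀j U₀ hU₀
  -- The image of the generator `u₀`.
  obtain ⟨V₀, hV₀, hVU₀, d₀, m₀, hm₀, g₀, hg₀, hfrac₀⟩ := (secMap φ U₀ u₀).2 ⟨_, hη₀⟩
  obtain ⟨hg₀η, e₀⟩ := hfrac₀ ⟨_, hV₀⟩
  refine ⟨j + d₀, monoT L y j * m₀, ?_, f₀ ^ j * g₀, SetLike.mul_mem_graded hf₀j hg₀,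
    mul_mem (hU₀ ⟨_, hη₀⟩) hg₀η, ?_⟩
  · have := semiInv_mul_mem hA' hm₀
    rwa [neg_add_eq_sub] at this
  intro U s hη
  obtain ⟨V, hV, hVU, d, m, hm, f, hf, hfrac⟩ := s.2 ⟨_, hη⟩
  obtain ⟨hfη, e⟩ := hfrac ⟨_, hV⟩
  have hmA : m * monoT L y j ∈ semiInv L α 0 (d + j) := by
    have := semiInv_mul_mem hm hA'
    rwa [add_neg_cancel] at this
  obtain ⟨c, hc, hce⟩ := exists_coord_of_semiInv_zero hmA
  have hηW : genPt hL α ∈ V ⊓ U₀ := ⟨hV, hη₀⟩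
  have hW : ∀ z : (V ⊓ U₀ : Opens (HPoint L α)), f * f₀ ^ j ∈ ptCompl (coordGrading L α) z.1 :=
    fun z => mul_mem (hfrac ⟨z.1, z.2.1⟩).1 (hU₀ ⟨z.1, z.2.2⟩)
  have hfg : f * f₀ ^ j ∈ coordGrading L α (d + j) := SetLike.mul_mem_graded hf hf₀j
  -- Near the generic point, `s` is a multiple of the generator.
  have hs : tildeRes (coordGrading L α) (semiInv L α χ) (inf_le_left.trans hVU) s =
      tildeSMul (coordGrading L α) (semiInv L α χ) (V ⊓ U₀) (fracFun hc hfg _ hW)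
        (tildeRes (coordGrading L α) (semiInv L α χ) inf_le_right u₀) := by
    refine Subtype.ext (funext fun z => ?_)
    obtain ⟨hfz, ez⟩ := hfrac ⟨z.1, z.2.1⟩
    rw [fracFun_smul (m := monoT L x j) (f' := ⟨f₀ ^ j, hU₀ ⟨z.1, z.2.2⟩⟩) hc hfg hW rfl]
    refine ez.trans ?_
    rw [LocalizedModule.mk_eq]
    refine ⟨1, ?_⟩
    simp only [one_smul, Submonoid.smul_def, Submonoid.coe_mul, Algebra.smul_def, map_mul, hce,
      map_pow, hf₀, algebraMap_chartElt]
    linear_combination (-(algebraMap (CoordRing L α) (TotalRing L) f) * m) * hxy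
  have hs' := congrArg (secMap φ (V ⊓ U₀)) hs
  rw [secMap_res, secMap_smul, secMap_res] at hs'
  have hs'' := congrFun (congrArg Subtype.val hs') ⟨_, hηW⟩
  rw [fracFun_smul (m := m₀) (f' := ⟨g₀, hg₀η⟩) hc hfg hW e₀] at hs''
  refine ⟨d, m, hm, f, hf, hfη, mul_mem hfη (mul_mem (hU₀ ⟨_, hη₀⟩) hg₀η), e, ?_⟩
  refine Eq.trans hs'' ?_
  congr 1
  · rw [Algebra.smul_def, hce]
    ring
  · exact Subtype.ext (mul_assoc _ _ _)

/-- A section over the chart of a homogeneous element `f` is a fraction whose denominator is a power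
of `f`: the denominators of the section generate an ideal whose radical contains `f`. -/
theorem exists_pow_denominator (hL : IsSaturated L) {ψ : Module.Dual ℤ L} {f : CoordRing L α}
    (hf : f ∈ coordGrading L α 1)
    (s : Sec ψ (ProjectiveSpectrum.basicOpen (coordGrading L α) f))
    (hη : genPt hL α ∈ ProjectiveSpectrum.basicOpen (coordGrading L α) f)
    {m : TotalRing L} {g : ptCompl (coordGrading L α) (genPt hL α)}
    (h : s.1 ⟨_, hη⟩ = LocalizedModule.mk m g) :
    ∃ N, ∃ r ∈ semiInv L α ψ N, coordToLaurent L α f ^ N * toLaurent L α m =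
      toLaurent L α r * coordToLaurent L α g.1 := by
  classical
  -- The homogeneous denominators `b` for which the value of `s` at the generic point is `r / b`.
  let Q : ℕ → Set (CoordRing L α) := fun d => {b | b ∈ coordGrading L α d ∧
    ∃ r ∈ semiInv L α ψ d, coordToLaurent L α b * toLaurent L α m =
      toLaurent L α r * coordToLaurent L α g.1}
  let I : Ideal (CoordRing L α) := Ideal.span {b | ∃ d, b ∈ Q d}
  have hI : I.IsHomogeneous (coordGrading L α) :=
    Ideal.homogeneous_span _ _ fun b ⟨d, hb⟩ => ⟨d, hb.1⟩
  have hrad : f ∈ I.radical := by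
    rw [hI.radical_eq, Submodule.mem_sInf]
    rintro J ⟨hJ, hIJ, hprime⟩
    by_contra hfJ
    -- A homogeneous prime that contains `I` but not `f` is a point of the chart, and the
    -- denominator of `s` near this point lies in `I`.
    let y : HPoint L α := ⟨⟨J, hJ⟩, hprime, fun hle => hfJ (hle
      (HomogeneousIdeal.mem_irrelevant_of_mem (coordGrading L α) one_pos hf))⟩
    obtain ⟨V, hyV, hVU, d, m', hm', b, hb, hfrac⟩ := s.2 ⟨y, hfJ⟩
    have hηV := genPt_mem hL hyV
    obtain ⟨h1, e1⟩ := hfrac ⟨_, hηV⟩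
    obtain ⟨h2, -⟩ := hfrac ⟨_, hyV⟩
    refine h2 (hIJ (Ideal.subset_span ⟨d, hb, m', hm', ?_⟩))
    have := toLaurent_of_mk_eq hL (h.symm.trans e1)
    rw [this, mul_comm]
  obtain ⟨N, hN⟩ := hrad
  obtain ⟨k, c, b, hsum⟩ := Submodule.mem_span_set'.1 hN
  choose d hb r hr he using fun i => (b i).2
  have hfN : f ^ N ∈ coordGrading L α N := by
    have := SetLike.pow_mem_graded N hf
    rwa [smul_eq_mul, mul_one] at this
  -- The component of degree `N` of an expression of `f ^ N` in terms of denominators.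
  have hcomp : f ^ N = ∑ i, if d i ≤ N then
      (DirectSum.decompose (coordGrading L α) (c i) (N - d i)).1 * (b i).1 else 0 := by
    rw [← DirectSum.decompose_of_mem_same (coordGrading L α) hfN, ← hsum,
      DirectSum.decompose_sum, DFinsupp.finsetSum_apply, AddSubmonoidClass.coe_finsetSum]
    refine Finset.sum_congr rfl fun i _ => ?_
    rw [smul_eq_mul, DirectSum.coe_decompose_mul_of_right_mem _ _ (hb i)]
  refine ⟨N, ∑ i, if d i ≤ N then
      (DirectSum.decompose (coordGrading L α) (c i) (N - d i)).1 • r i else 0, ?_, ?_⟩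
  · refine Submodule.sum_mem _ fun i _ => ?_
    split_ifs with hi
    · have := SetLike.GradedSMul.smul_mem
        (DirectSum.decompose (coordGrading L α) (c i) (N - d i)).2 (hr i)
      rwa [vadd_eq_add, Nat.sub_add_cancel hi] at this
    · exact zero_mem _
  · rw [← map_pow, hcomp, map_sum, map_sum, Finset.sum_mul, Finset.sum_mul]
    refine Finset.sum_congr rfl fun i _ => ?_
    split_ifs
    · rw [map_mul, toLaurent_smul_coord, mul_assoc, he i, mul_assoc]
    · simp

/-- Every homomorphism between the line bundles of two weights whose difference lies in the window
is multiplication by a semi-invariant polynomial. -/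
theorem exists_eq_mulSemi (hL : IsSaturated L) (hU : IsUnimodular L) (hα : IsGeneric L α)
    {χ ψ : Module.Dual ℤ L} (hadm : IsAdmissible (ψ - χ)) (hw : InWindow α (ψ - χ))
    (φ : lineBundle L α χ ⟶ lineBundle L α ψ) :
    ∃ r, ∃ hr : r ∈ semiInv L α (ψ - χ) 0, φ = mulSemi r hr := by
  have := isDomain_laurent hL
  obtain ⟨k, m₁, hm₁, g₁, hg₁, hg₁η, hmult⟩ := exists_multiplier hL hU hα φ
  have hne : ∀ f ∈ ptCompl (coordGrading L α) (genPt hL α), coordToLaurent L α f ≠ 0 :=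
    fun f hf h0 => (mem_ptCompl_genPt hL).1 hf
      ((injective_iff_map_eq_zero _).1 (coordToLaurent_injective hL) _ h0)
  obtain ⟨r, hr, hB⟩ := exists_semiInv_of_forall_chart hL hU hadm hw
    (B := toLaurent L α m₁) (D := coordToLaurent L α g₁) (hne g₁ hg₁η) (by
      intro a ha
      obtain ⟨j, x, y, hx, hy, hxy⟩ := exists_generator hL hU hα ha χ
      have hfj : chartElt a ha ^ j ∈ coordGrading L α j := by
        have := SetLike.pow_mem_graded j (chartElt_mem a ha)
        rwa [smul_eq_mul, mul_one] at this
      have hUa : ∀ z : ProjectiveSpectrum.basicOpen (coordGrading L α) (chartElt a ha),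
        chartElt a ha ^ j ∈ ptCompl (coordGrading L α) z.1 := fun z =>
          Submonoid.pow_mem (ptCompl (coordGrading L α) z.1) z.2 j
      have hη : genPt hL α ∈ ProjectiveSpectrum.basicOpen (coordGrading L α) (chartElt a ha) :=
        (mem_ptCompl_genPt hL).2 (chartElt_ne_zero hL a ha)
      obtain ⟨d, m, hm, f, hf, hfη, hfg, e1, e2⟩ :=
        hmult _ (fracSec (monoT_mem_semiInv L α hx) hfj _ hUa) hη
      obtain ⟨N, r, hr, hN⟩ := exists_pow_denominator hL (chartElt_mem a ha) _ hη e2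
      have e3 := toLaurent_of_mk_eq hL
        (show LocalizedModule.mk (monoT L x j) ⟨_, hUa ⟨_, hη⟩⟩ = _ from e1)
      refine ⟨N + (j + j), r * (monoT L y j * monoT L a 1 ^ j), ?_, ?_⟩
      · have h1 : monoT L a 1 ^ j ∈ semiInv L α 0 j := by
          rw [← algebraMap_chartElt a ha, ← map_pow]
          exact algebraMap_mem_semiInv hfj
        have := semiInv_mul_mem hr (semiInv_mul_mem (monoT_mem_semiInv L α hy) h1)
        rwa [add_zero, ← sub_eq_add_neg] at this
      · refine mul_left_cancel₀ (hne f hfη) ?_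
        have hxy' := congrArg (toLaurent L α) hxy
        simp only [map_mul, map_pow, coordToLaurent_chartElt] at hxy' hN e3 ⊢
        set F := toLaurent L α (monoT L a 1)
        set X := toLaurent L α (monoT L x j)
        set Y := toLaurent L α (monoT L y j)
        rw [pow_add]
        linear_combination (Y * F ^ j) * hN + (toLaurent L α m₁ * F ^ N * Y) * e3 -
          (coordToLaurent L α f * toLaurent L α m₁ * F ^ N) * hxy')
  refine ⟨r, hr, hom_ext_secMap fun U s => sec_ext_genPt hL hα fun hη => ?_⟩
  obtain ⟨d, m, hm, f, hf, hfη, hfg, e1, e2⟩ := hmult U s hη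
  rw [e2, secMap_mulSemi_mk hr e1, ← sub_eq_zero, sub_eq_add_neg, ← LocalizedModule.mk_neg,
    LocalizedModule.mk_add_mk]
  refine mk_eq_zero_of_toLaurent hL hα (ξ := ψ) ?_ ?_ _ _
  · simp only [Submonoid.smul_def, Algebra.smul_def]
    have h1 := semiInv_mul_mem (algebraMap_mem_semiInv hf) (semiInv_mul_mem hm₁ hm)
    have h2 := semiInv_mul_mem (algebraMap_mem_semiInv (SetLike.mul_mem_graded hf hg₁))
      (semiInv_mul_mem hr hm)
    rw [zero_add, sub_add_cancel] at h1 h2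
    rw [mul_neg]
    exact add_mem (semiInv_le L α _ _ h1) (neg_mem (semiInv_le L α _ _ h2))
  · simp only [Submonoid.smul_def, map_add, map_neg, toLaurent_smul_coord, map_mul, smul_neg, hB]
    ring

/-- Multiplication by a semi-invariant determines it. -/
theorem mulSemi_injective (hL : IsSaturated L) (hU : IsUnimodular L) (hα : IsGeneric L α)
    {χ ψ : Module.Dual ℤ L} (hadm : IsAdmissible (ψ - χ)) {r r' : TotalRing L}
    (hr : r ∈ semiInv L α (ψ - χ) 0) (hr' : r' ∈ semiInv L α (ψ - χ) 0)
    (h : (mulSemi r hr : lineBundle L α χ ⟶ lineBundle L α ψ) = mulSemi r' hr') : r = r' := by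
  have := isDomain_laurent hL
  obtain ⟨a, ha⟩ := charRes_surjective hL α
  obtain ⟨j, x, y, hx, hy, hxy⟩ := exists_generator hL hU hα ha χ
  have hfj : chartElt a ha ^ j ∈ coordGrading L α j := by
    have := SetLike.pow_mem_graded j (chartElt_mem a ha)
    rwa [smul_eq_mul, mul_one] at this
  have hUa : ∀ z : ProjectiveSpectrum.basicOpen (coordGrading L α) (chartElt a ha),
    chartElt a ha ^ j ∈ ptCompl (coordGrading L α) z.1 := fun z =>
      Submonoid.pow_mem (ptCompl (coordGrading L α) z.1) z.2 j
  have hη : genPt hL α ∈ ProjectiveSpectrum.basicOpen (coordGrading L α) (chartElt a ha) :=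
    (mem_ptCompl_genPt hL).2 (chartElt_ne_zero hL a ha)
  set u : Sec χ _ := fracSec (monoT_mem_semiInv L α hx) hfj _ hUa
  have hu : u.1 ⟨_, hη⟩ = LocalizedModule.mk (monoT L x j) ⟨_, hUa ⟨_, hη⟩⟩ := rfl
  have e := congrArg (fun φ => (secMap φ _ u).1 ⟨_, hη⟩) h
  simp only [secMap_mulSemi_mk hr hu, secMap_mulSemi_mk hr' hu] at e
  have e2 := toLaurent_of_mk_eq hL e
  have hne : coordToLaurent L α (chartElt a ha ^ j) ≠ 0 := fun h0 =>
    (mem_ptCompl_genPt hL).1 (hUa ⟨_, hη⟩)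
      ((injective_iff_map_eq_zero _).1 (coordToLaurent_injective hL) _ h0)
  have e3 := mul_left_cancel₀ hne e2
  rw [map_mul, map_mul] at e3
  refine eq_of_toLaurent_eq hL hadm (semiInv_le L α _ _ hr) (semiInv_le L α _ _ hr')
    (mul_right_cancel₀ (fun h0 => ?_) e3)
  have hxy' := congrArg (toLaurent L α) hxy
  rw [map_mul, h0, zero_mul, map_pow] at hxy'
  refine pow_ne_zero _ ?_ hxy'.symm
  rw [← coordToLaurent_chartElt a ha]
  exact fun h0 => chartElt_ne_zero hL a ha
    ((injective_iff_map_eq_zero _).1 (coordToLaurent_injective hL) _ h0)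

end Sections

/-! ### Weights for the scaling action -/

section Weights

variable {n : ℕ} (L : Submodule ℤ (Fin n → ℤ)) (α : Module.Dual ℤ L)

/-- The coaction of `𝕊` on the polynomial ring with values in the total coordinate ring. -/
def polyCoact : Poly n →ₐ[ℤ] Polynomial (TotalRing L) :=
  MvPolynomial.aeval fun v => Polynomial.X ^ wtS v * Polynomial.C (totalMk L (MvPolynomial.X v))

theorem polyCoact_monomial (m : HVar n →₀ ℕ) (c : ℤ) :
    polyCoact L (MvPolynomial.monomial m c) = Polynomial.X ^ Finsupp.weight wtS m *
      Polynomial.C (totalMk L (MvPolynomial.monomial m c)) := by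
  rw [polyCoact, MvPolynomial.aeval_monomial, MvPolynomial.monomial_eq]
  simp only [Finsupp.prod, mul_pow, Finset.prod_mul_distrib, ← pow_mul, Finset.prod_pow_eq_pow_sum,
    Finsupp.weight_apply, Finsupp.sum, map_mul, map_prod, map_pow, smul_eq_mul]
  rw [mul_left_comm, Finset.sum_congr rfl fun v _ => mul_comm (wtS v) (m v)]
  congr 2

theorem polyCoact_of_mem {d : ℕ} {f : Poly n} (hf : f ∈ polyS d) :
    polyCoact L f = Polynomial.X ^ d * Polynomial.C (totalMk L f) := by
  rw [MvPolynomial.as_sum f, map_sum, map_sum, map_sum, Finset.mul_sum]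
  refine Finset.sum_congr rfl fun m hm => ?_
  rw [polyCoact_monomial, hf (MvPolynomial.mem_support_iff.1 hm)]

theorem moment_mem_polyS (v : Fin n → ℤ) : moment v ∈ polyS 2 := by
  refine Submodule.sum_mem _ fun i _ => ?_
  have := MvPolynomial.IsWeightedHomogeneous.mul
    (MvPolynomial.isWeightedHomogeneous_C (wtS (n := n)) (v i))
    (MvPolynomial.IsWeightedHomogeneous.mul
    (MvPolynomial.isWeightedHomogeneous_X ℤ wtS (.z i))
    (MvPolynomial.isWeightedHomogeneous_X ℤ wtS (.w i)))
  simpa [wtS] using this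

/-- The coaction of `𝕊` on the total coordinate ring. -/
def coact : TotalRing L →+* Polynomial (TotalRing L) :=
  Ideal.Quotient.lift (momentIdeal L) (polyCoact L).toRingHom <| by
    intro f hf
    refine Submodule.span_induction (p := fun f _ => (polyCoact L).toRingHom f = 0)
      ?_ (map_zero _) ?_ ?_ hf
    · rintro _ ⟨v, hv, rfl⟩
      show polyCoact L (moment v) = 0
      have : totalMk L (moment v) = 0 := le_ker_momentHom L hv
      rw [polyCoact_of_mem L (moment_mem_polyS v), this, map_zero, mul_zero]
    · intro f g _ _ hf hg
      rw [map_add, hf, hg, add_zero]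
    · intro a f _ hf
      rw [smul_eq_mul, map_mul, hf, mul_zero]

theorem coact_mk (f : Poly n) : coact L (totalMk L f) = polyCoact L f := rfl

theorem coact_mk_of_mem {d : ℕ} {f : Poly n} (hf : f ∈ polyS d) :
    coact L (totalMk L f) = Polynomial.X ^ d * Polynomial.C (totalMk L f) :=
  polyCoact_of_mem L hf

theorem coeff_coact_mk (f : Poly n) (d : ℕ) : (coact L (totalMk L f)).coeff d =
    totalMk L (MvPolynomial.weightedHomogeneousComponent wtS d f) := by
  classical
  rw [coact_mk]
  induction f using MvPolynomial.induction_on' with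
  | monomial m c =>
    have hm := MvPolynomial.isWeightedHomogeneous_monomial (w := wtS) m c rfl
    rw [polyCoact_monomial, mul_comm, Polynomial.coeff_C_mul_X_pow]
    split_ifs with h
    · rw [h, hm.weightedHomogeneousComponent_same]
    · rw [hm.weightedHomogeneousComponent_ne _ h, map_zero]
  | add f g hf hg => rw [map_add, Polynomial.coeff_add, hf, hg, map_add, map_add]

theorem component_mem_polyT {ξ : Module.Dual ℤ L} {f : Poly n} (hf : f ∈ polyT L α ξ) (d : ℕ) :
    MvPolynomial.weightedHomogeneousComponent wtS d f ∈ polyT L α ξ := by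
  classical
  intro m hm
  rw [MvPolynomial.coeff_weightedHomogeneousComponent] at hm
  split_ifs at hm
  · exact hf hm
  · exact absurd rfl hm

theorem component_mem_polyt {e : ℕ} {f : Poly n} (hf : f ∈ polyt e) (d : ℕ) :
    MvPolynomial.weightedHomogeneousComponent wtS d f ∈ polyt e := by
  classical
  intro m hm
  rw [MvPolynomial.coeff_weightedHomogeneousComponent] at hm
  split_ifs at hm
  · exact hf hm
  · exact absurd rfl hm

variable {L α}

theorem coeff_coact_mem {ξ : Module.Dual ℤ L} {e : ℕ} {r : TotalRing L} (hr : r ∈ semiInv L α ξ e)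
    (d : ℕ) : (coact L r).coeff d ∈ semiInv L α ξ e := by
  obtain ⟨f, hf, rfl⟩ := hr
  exact ⟨_, ⟨component_mem_polyT L α hf.1 d, component_mem_polyt hf.2 d⟩, (coeff_coact_mk L f d).symm⟩

variable (L) in
/-- The elements of the total coordinate ring of `𝕊`-weight `d`. -/
def weightPart (d : ℕ) : Submodule ℤ (TotalRing L) :=
  (polyS d).map (totalMk L).toAddMonoidHom.toIntLinearMap

theorem coact_of_mem {d : ℕ} {r : TotalRing L} (hr : r ∈ weightPart L d) :
    coact L r = Polynomial.X ^ d * Polynomial.C r := by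
  obtain ⟨f, hf, rfl⟩ := hr
  exact coact_mk_of_mem L hf

theorem exists_of_coact_eq {ξ : Module.Dual ℤ L} {e d : ℕ} {r : TotalRing L}
    (hr : r ∈ semiInv L α ξ e) (h : coact L r = Polynomial.X ^ d * Polynomial.C r) :
    ∃ f ∈ polyT L α ξ ⊓ polyt e ⊓ polyS d, totalMk L f = r := by
  obtain ⟨f, hf, rfl⟩ := hr
  refine ⟨MvPolynomial.weightedHomogeneousComponent wtS d f,
    ⟨⟨component_mem_polyT L α hf.1 d, component_mem_polyt hf.2 d⟩,
      MvPolynomial.weightedHomogeneousComponent_isWeightedHomogeneous _ _⟩, ?_⟩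
  have h' : coact L (totalMk L f) = Polynomial.X ^ d * Polynomial.C (totalMk L f) := h
  rw [← coeff_coact_mk, h', mul_comm, Polynomial.coeff_C_mul_X_pow, if_pos rfl]
  rfl

theorem mem_weightPart_iff {ξ : Module.Dual ℤ L} {e d : ℕ} {r : TotalRing L}
    (hr : r ∈ semiInv L α ξ e) :
    r ∈ weightPart L d ↔ coact L r = Polynomial.X ^ d * Polynomial.C r := by
  refine ⟨coact_of_mem, fun h => ?_⟩
  obtain ⟨f, hf, rfl⟩ := exists_of_coact_eq hr h
  exact ⟨f, hf.2, rfl⟩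

variable (L α) in
/-- The coaction of `𝕊` followed by the restriction to the generic stratum. -/
def laurentCoact : TotalRing L →+* Polynomial (Laurent L) :=
  (Polynomial.mapRingHom (toLaurent L α)).comp (coact L)

theorem laurentCoact_of_mem {d : ℕ} {r : TotalRing L} (hr : r ∈ weightPart L d) :
    laurentCoact L α r = Polynomial.X ^ d * Polynomial.C (toLaurent L α r) := by
  simp [laurentCoact, coact_of_mem hr]

theorem eval_one_laurentCoact (r : TotalRing L) :
    (laurentCoact L α r).eval 1 = toLaurent L α r := by
  obtain ⟨f, rfl⟩ : ∃ f, totalMk L f = r := Ideal.Quotient.mk_surjective r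
  have : (Polynomial.evalRingHom 1).comp ((laurentCoact L α).comp (totalMk L)) =
      (toLaurent L α).comp (totalMk L) := by
    refine MvPolynomial.ringHom_ext (fun c => ?_) fun v => ?_
    · simp
    · have hv : totalMk L (MvPolynomial.X v) ∈ weightPart L (wtS v) :=
        ⟨_, MvPolynomial.isWeightedHomogeneous_X ℤ wtS v, rfl⟩
      simp only [RingHom.comp_apply, laurentCoact_of_mem hv]
      simp
  exact congrArg (fun φ => φ f) this

theorem monoT_mem_weightPart (x : Fin n → ℤ) (d : ℕ) : monoT L x d ∈ weightPart L (absSum x) :=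
  ⟨_, mono_mem_polyS x d, rfl⟩

theorem homHasSWeight_mulSemi {χ ψ : Module.Dual ℤ L} {d : ℕ} {r : TotalRing L}
    (hr : r ∈ semiInv L α (ψ - χ) 0) (h : r ∈ weightPart L d) :
    HomHasSWeight L α d (mulSemi r hr : lineBundle L α χ ⟶ lineBundle L α ψ) := by
  obtain ⟨g, hg, rfl⟩ := exists_of_coact_eq hr (coact_of_mem h)
  intro U e s hs x
  obtain ⟨V, hxV, hVU, k, a, b, hab, m, hm, f, hf, hfrac⟩ := hs x
  refine ⟨V, hxV, hVU, k, a + d, b, by push_cast; linarith, g * m, ⟨⟨?_, ?_⟩, ?_⟩, f, hf,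
    fun y => ?_⟩
  · have := MvPolynomial.IsWeightedHomogeneous.mul hg.1.1 hm.1.1
    rwa [sub_add_cancel] at this
  · have := MvPolynomial.IsWeightedHomogeneous.mul hg.1.2 hm.1.2
    rwa [zero_add] at this
  · rw [add_comm]
    exact MvPolynomial.IsWeightedHomogeneous.mul hg.2 hm.2
  · obtain ⟨hy, ey⟩ := hfrac y
    refine ⟨hy, ?_⟩
    have := secMap_mulSemi_mk hr (x := ⟨y.1, hVU y.2⟩) ey
    rwa [← map_mul] at this

theorem isSHomogeneous_fracSec {χ : Module.Dual ℤ L} {d a b : ℕ} {m : Poly n}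
    (hm : m ∈ polyT L α χ ⊓ polyt d ⊓ polyS a) {f : invariants L α}
    (hf : f.1 ∈ polyt d ⊓ polyS b) (hm' : totalMk L m ∈ semiInv L α χ d)
    (hf' : coordMk L α f ∈ coordGrading L α d) (U : Opens (HPoint L α))
    (hU : ∀ y : U, coordMk L α f ∈ ptCompl (coordGrading L α) y.1) :
    IsSHomogeneous L α χ ((a : ℤ) - b) U (fracSec hm' hf' U hU) :=
  fun z => ⟨U, z.2, le_rfl, d, a, b, rfl, m, hm, f, hf, fun y => ⟨hU y, rfl⟩⟩

/-- Every `ℓ(χ)` has a homogeneous section near the generic point that does not vanish there. -/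
theorem exists_homogeneous_section (hL : IsSaturated L) (hU : IsUnimodular L)
    (hα : IsGeneric L α) (χ : Module.Dual ℤ L) :
    ∃ (U : Opens (HPoint L α)) (hη : genPt hL α ∈ U) (u : Sec χ U) (a b : ℕ) (m : TotalRing L)
      (f : ptCompl (coordGrading L α) (genPt hL α)), m ∈ weightPart L a ∧
      algebraMap (CoordRing L α) (TotalRing L) f.1 ∈ weightPart L b ∧ toLaurent L α m ≠ 0 ∧
      u.1 ⟨_, hη⟩ = LocalizedModule.mk m f ∧ IsSHomogeneous L α χ ((a : ℤ) - b) U u := by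
  have := isDomain_laurent hL
  obtain ⟨a, ha⟩ := charRes_surjective hL α
  obtain ⟨j, x, y, hx, hy, hxy⟩ := exists_generator hL hU hα ha χ
  have hinv : mono a * MvPolynomial.X .t ^ 1 ∈ polyT L α 0 := by
    have := (monoT_mem L α a 1).1
    rwa [ha, one_smul, sub_self] at this
  obtain ⟨f, hf, hfe⟩ : ∃ f : invariants L α, f.1 ∈ polyt j ⊓ polyS (j * absSum a) ∧
      coordMk L α f = chartElt a ha ^ j := by
    refine ⟨(⟨_, hinv⟩ : invariants L α) ^ j, ⟨?_, ?_⟩, map_pow _ _ _⟩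
    · have := MvPolynomial.IsWeightedHomogeneous.pow (monoT_mem L α a 1).2 j
      rwa [smul_eq_mul, mul_one] at this
    · exact MvPolynomial.IsWeightedHomogeneous.pow (mono_mem_polyS a 1) j
  obtain ⟨m, hm, hme⟩ : ∃ m, m ∈ polyT L α χ ⊓ polyt j ⊓ polyS (absSum x) ∧
      totalMk L m = monoT L x j := by
    refine ⟨_, ⟨⟨?_, (monoT_mem L α x j).2⟩, mono_mem_polyS x j⟩, rfl⟩
    have := (monoT_mem L α x j).1
    rwa [hx, add_sub_cancel_right] at this
  have hUa : ∀ z : ProjectiveSpectrum.basicOpen (coordGrading L α) (chartElt a ha),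
      coordMk L α f ∈ ptCompl (coordGrading L α) z.1 := fun z => by
    rw [hfe]
    exact Submonoid.pow_mem (ptCompl (coordGrading L α) z.1) z.2 j
  have hη : genPt hL α ∈ ProjectiveSpectrum.basicOpen (coordGrading L α) (chartElt a ha) :=
    (mem_ptCompl_genPt hL).2 (chartElt_ne_zero hL a ha)
  refine ⟨_, hη, fracSec ⟨m, hm.1, rfl⟩ ⟨f, hf.1, rfl⟩ _ hUa, absSum x,
    j * absSum a, totalMk L m, ⟨_, hUa ⟨_, hη⟩⟩, ⟨m, hm.2, rfl⟩, ?_, ?_, rfl,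
    isSHomogeneous_fracSec hm hf _ _ _ hUa⟩
  · rw [algebraMap_coordMk]
    exact ⟨f.1, hf.2, rfl⟩
  · intro h0
    have hxy' := congrArg (toLaurent L α) hxy
    rw [map_mul, ← hme, h0, zero_mul, map_pow] at hxy'
    refine pow_ne_zero _ ?_ hxy'.symm
    rw [← coordToLaurent_chartElt a ha]
    exact fun h0 => chartElt_ne_zero hL a ha
      ((injective_iff_map_eq_zero _).1 (coordToLaurent_injective hL) _ h0)

/-- Cancellation step in the proof of `mem_weightPart_of_homHasSWeight`: `q` is the coaction on a
semi-invariant `r`, `cr` the constant polynomial of the restriction of `r`, and the other letters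
are powers of the variable and constants coming from two expressions for the image of a section. -/
theorem weight_cancel {P : Type*} [CommRing P] {b' cF q a cM b cc a' cm d cr : P}
    (h : b' * cF * (q * (a * cM)) = b * cc * (a' * cm)) (h₁ : cF * (cr * cM) = cc * cm)
    (h₂ : b * a' = b' * a * d) : b' * a * (cF * cM) * q = b' * a * (cF * cM) * (d * cr) := by
  linear_combination h - b' * a * d * h₁ + cc * cm * h₂

/-- Multiplication by a semi-invariant raises weights by `d` only if the semi-invariant has
weight `d`: it suffices to look at the image of a homogeneous section. -/
theorem mem_weightPart_of_homHasSWeight (hL : IsSaturated L) (hU : IsUnimodular L)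
    (hα : IsGeneric L α) {χ ψ : Module.Dual ℤ L} (hadm : IsAdmissible (ψ - χ)) {d : ℕ}
    {r : TotalRing L} (hr : r ∈ semiInv L α (ψ - χ) 0)
    (h : HomHasSWeight L α d (mulSemi r hr : lineBundle L α χ ⟶ lineBundle L α ψ)) :
    r ∈ weightPart L d := by
  have := isDomain_laurent hL
  obtain ⟨U, hη, u, a, b, M, c, hM, hc, hM0, hu, huS⟩ := exists_homogeneous_section hL hU hα χ
  have hne : ∀ f ∈ ptCompl (coordGrading L α) (genPt hL α), coordToLaurent L α f ≠ 0 :=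
    fun f hf h0 => (mem_ptCompl_genPt hL).1 hf
      ((injective_iff_map_eq_zero _).1 (coordToLaurent_injective hL) _ h0)
  obtain ⟨V, hηV, hVU, k, a', b', hab, m, hm, f, hf, hfrac⟩ := h _ _ u huS ⟨_, hη⟩
  obtain ⟨hfη, ef⟩ := hfrac ⟨_, hηV⟩
  have e1 := (secMap_mulSemi_mk hr hu).symm.trans ef
  have e2 := toLaurent_of_mk_eq hL e1
  have hfw : algebraMap (CoordRing L α) (TotalRing L) (coordMk L α f) ∈ weightPart L b' := by
    rw [algebraMap_coordMk]
    exact ⟨_, hf.2, rfl⟩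
  have hmw : totalMk L m ∈ weightPart L a' := ⟨_, hm.2, rfl⟩
  have hdeg : b + a' = b' + a + d := by
    have : (a' : ℤ) - b' = (a : ℤ) - b + d := hab
    omega
  have hf0 := hne _ hfη
  generalize coordMk L α f = F at *
  generalize totalMk L m = m' at *
  obtain ⟨w, hw⟩ := LocalizedModule.mk_eq.1 e1
  simp only [Submonoid.smul_def, Algebra.smul_def] at hw
  have hw' := congrArg (laurentCoact L α) hw
  simp only [map_mul (laurentCoact L α), laurentCoact_of_mem hfw, laurentCoact_of_mem hc,
    laurentCoact_of_mem hmw, laurentCoact_of_mem hM] at hw'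
  have hw0 : laurentCoact L α (algebraMap (CoordRing L α) (TotalRing L) w.1) ≠ 0 := by
    intro h0
    have h1 := eval_one_laurentCoact (α := α) (algebraMap (CoordRing L α) (TotalRing L) w.1)
    rw [h0, Polynomial.eval_zero] at h1
    exact hne _ w.2 h1.symm
  have hw2 := mul_left_cancel₀ hw0 hw'
  rw [map_mul] at e2
  have key : laurentCoact L α r = Polynomial.X ^ d * Polynomial.C (toLaurent L α r) := by
    have hK : (Polynomial.X ^ (b' + a) * Polynomial.C (coordToLaurent L α F *
        toLaurent L α M) : Polynomial (Laurent L)) ≠ 0 :=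
      mul_ne_zero (pow_ne_zero _ Polynomial.X_ne_zero)
        (Polynomial.C_ne_zero.2 (mul_ne_zero hf0 hM0))
    refine mul_left_cancel₀ hK ?_
    have e3 := congrArg (Polynomial.C (R := Laurent L)) e2
    simp only [← coordToLaurent_apply] at hw2
    simp only [map_mul] at e3 ⊢
    have e4 : (Polynomial.X ^ b * Polynomial.X ^ a' : Polynomial (Laurent L)) =
        Polynomial.X ^ b' * Polynomial.X ^ a * Polynomial.X ^ d := by
      rw [← pow_add, ← pow_add, ← pow_add, hdeg]
    rw [pow_add]
    exact weight_cancel (P := Polynomial (Laurent L)) hw2 e3 e4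
  refine (mem_weightPart_iff hr).2 (Polynomial.ext fun i => ?_)
  have hci := congrArg (fun q => Polynomial.coeff q i) key
  simp only [laurentCoact, RingHom.comp_apply, Polynomial.coe_mapRingHom, Polynomial.coeff_map] at hci
  rw [Polynomial.X_pow_mul_C, Polynomial.coeff_C_mul_X_pow] at hci
  rw [Polynomial.X_pow_mul_C, Polynomial.coeff_C_mul_X_pow]
  refine eq_of_toLaurent_eq hL hadm (semiInv_le L α _ _ (coeff_coact_mem hr i)) ?_ ?_
  · split_ifs
    · exact semiInv_le L α _ _ hr
    · exact zero_mem _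
  · rw [hci]
    split_ifs
    · rfl
    · rw [map_zero]

end Weights

/-! ### Algebras given by generators and relations -/

section Generators

variable {S R X : Type*} [CommRing S] [Ring R] [Algebra S R] {gen : X → R}

/-- A submodule that contains `1` and is stable under right multiplication by generators of the
algebra is everything. -/
theorem submodule_eq_top_of_mul_mem (hgen : Algebra.adjoin S (Set.range gen) = ⊤)
    {M : Submodule S R} (h1 : (1 : R) ∈ M) (hM : ∀ m ∈ M, ∀ g, m * gen g ∈ M) : M = ⊤ := by
  have key : ∀ r ∈ Algebra.adjoin S (Set.range gen), ∀ m ∈ M, m * r ∈ M := by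
    intro r hr
    induction hr using Algebra.adjoin_induction with
    | mem r hr =>
      obtain ⟨g, rfl⟩ := hr
      exact fun m hm => hM m hm g
    | algebraMap s =>
      intro m hm
      rw [← Algebra.commutes, ← Algebra.smul_def]
      exact M.smul_mem s hm
    | add r r' _ _ hr hr' =>
      intro m hm
      rw [mul_add]
      exact M.add_mem (hr m hm) (hr' m hm)
    | mul r r' _ _ hr hr' =>
      intro m hm
      rw [← mul_assoc]
      exact hr' _ (hr m hm)
  refine eq_top_iff.2 fun r _ => ?_
  rw [← one_mul r]
  exact key r (hgen ▸ Algebra.mem_top) 1 h1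

theorem adjoin_mkAlgHom_ι (rel : FreeAlgebra S X → FreeAlgebra S X → Prop) :
    Algebra.adjoin S (Set.range fun g => RingQuot.mkAlgHom S rel (FreeAlgebra.ι S g)) = ⊤ := by
  have h : (Set.range fun g => RingQuot.mkAlgHom S rel (FreeAlgebra.ι S g)) =
      RingQuot.mkAlgHom S rel '' Set.range (FreeAlgebra.ι S) := by
    rw [← Set.range_comp]
    rfl
  rw [h, ← AlgHom.map_adjoin, FreeAlgebra.adjoin_range_ι, Algebra.map_top, AlgHom.range_eq_top]
  exact RingQuot.mkAlgHom_surjective S rel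

end Generators

/-! ### The set `Λ` -/

section LambdaSet

variable {n : ℕ} {L : Submodule ℤ (Fin n → ℤ)} {p : ℕ} {lam : Module.Dual ℤ L}

/-- The set `Λ` is stable under translation by characters of `D` that are trivial on `T`. -/
theorem mem_LambdaSet_iff {x : Fin n → ℤ} :
    x ∈ LambdaSet L p lam ↔ charRes L x ∈ LambdaBar L p lam := by
  refine ⟨fun h => ⟨x, h, rfl⟩, ?_⟩
  rintro ⟨y, ⟨a, ha, hay⟩, hxy⟩
  refine ⟨a + (p : ℤ) • (x - y), ?_, fun i => ?_⟩
  · rw [map_add, map_smul, map_sub, hxy, sub_self, smul_zero, add_zero, ha]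
  · have := hay i
    simp only [Pi.add_apply, Pi.smul_apply, Pi.sub_apply, smul_eq_mul]
    constructor <;> nlinarith

variable (L p lam) in
/-- A representative in `Λ` of an element of `LambdaBar`. -/
def barRep (χ : LambdaBar L p lam) : LambdaSet L p lam := ⟨χ.2.choose, χ.2.choose_spec.1⟩

theorem charRes_barRep (χ : LambdaBar L p lam) : charRes L (barRep L p lam χ).1 = χ.1 :=
  χ.2.choose_spec.2

theorem toBar_barRep (χ : LambdaBar L p lam) : toBar L p lam (barRep L p lam χ) = χ :=
  Subtype.ext (charRes_barRep χ)

theorem toBar_eq_iff {x y : LambdaSet L p lam} :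
    toBar L p lam x = toBar L p lam y ↔ charRes L x.1 = charRes L y.1 := Subtype.ext_iff

/-- The translate of an element of `Λ` by a vector whose restriction to `T` is trivial. -/
def translateBy (γ : Fin n → ℤ) (hγ : charRes L γ = 0) (x : LambdaSet L p lam) :
    LambdaSet L p lam :=
  ⟨x.1 + γ, mem_LambdaSet_iff.2 (by rw [map_add, hγ, add_zero]; exact ⟨x.1, x.2, rfl⟩)⟩

theorem eta_eq_overlap (x y u : Fin n → ℤ) (i : Fin n) :
    eta x y u i = overlap ((y - x) i) ((u - y) i) := by
  simp only [eta, overlap, Pi.sub_apply]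
  omega

theorem eta_swap (x y u : Fin n → ℤ) (i : Fin n) : eta x y u i = eta u y x i := by
  simp only [eta]
  omega

end LambdaSet

/-! ### The algebra `H̄` as an algebra of matrices -/

section HBarMatrix

variable {n : ℕ} {L : Submodule ℤ (Fin n → ℤ)} {p : ℕ} {lam : Module.Dual ℤ L}

open HBar in
theorem HBar.gen_idem_mul_c (x y : LambdaSet L p lam) :
    gen L p lam (.idem (toBar L p lam x)) * gen L p lam (.c x y) = gen L p lam (.c x y) := by
  have := RingQuot.mkAlgHom_rel (SymG L) (Rel.idem_c x y)
  rw [map_mul] at this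
  exact this

open HBar in
theorem HBar.gen_c_mul_idem (x y : LambdaSet L p lam) :
    gen L p lam (.c x y) * gen L p lam (.idem (toBar L p lam y)) = gen L p lam (.c x y) := by
  have := RingQuot.mkAlgHom_rel (SymG L) (Rel.c_idem x y)
  rw [map_mul] at this
  exact this

open HBar in
theorem HBar.gen_c_self (x : LambdaSet L p lam) :
    gen L p lam (.c x x) = gen L p lam (.idem (toBar L p lam x)) :=
  RingQuot.mkAlgHom_rel _ (Rel.c_self x)

open HBar in
theorem HBar.gen_idem_mul_idem {χ ψ : LambdaBar L p lam} (h : χ ≠ ψ) :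
    gen L p lam (.idem χ) * gen L p lam (.idem ψ) = 0 := by
  have := RingQuot.mkAlgHom_rel (SymG L) (Rel.idem_ne χ ψ h)
  rw [map_mul, map_zero] at this
  exact this

open HBar in
theorem HBar.gen_idem_mul_self (χ : LambdaBar L p lam) :
    gen L p lam (.idem χ) * gen L p lam (.idem χ) = gen L p lam (.idem χ) := by
  have := RingQuot.mkAlgHom_rel (SymG L) (Rel.idem_idem χ)
  rw [map_mul] at this
  exact this

open HBar in
theorem HBar.sum_gen_idem : ∑ χ, gen L p lam (.idem χ) = 1 := by
  have := RingQuot.mkAlgHom_rel (SymG L) (Rel.sum_idem (L := L) (p := p) (lam := lam))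
  rw [map_sum, map_one] at this
  exact this

open HBar in
theorem HBar.gen_c_mul_c (x y u : LambdaSet L p lam) :
    gen L p lam (.c x y) * gen L p lam (.c y u) =
      (∏ i, sElt L i ^ eta x.1 y.1 u.1 i) • gen L p lam (.c x u) := by
  have := RingQuot.mkAlgHom_rel (SymG L) (Rel.c_c x y u)
  rw [map_mul, map_smul] at this
  exact this

open HBar in
theorem HBar.gen_c_translate {x y x' y' : LambdaSet L p lam} (hx : charRes L (x'.1 - x.1) = 0)
    (h : x'.1 - x.1 = y'.1 - y.1) : gen L p lam (.c x' y') = gen L p lam (.c x y) :=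
  RingQuot.mkAlgHom_rel _ (Rel.translate x y x' y' hx h)

theorem HBar.adjoin_gen : Algebra.adjoin (SymG L) (Set.range (HBar.gen L p lam)) = ⊤ :=
  adjoin_mkAlgHom_ι (Rel L p lam)

open HBar in
/-- As a module, `H̄` is spanned by the elements `c x y` where `x` runs through a set of
representatives of `LambdaBar`. -/
theorem HBar.span_gen_c : Submodule.span (SymG L) (Set.range fun q : LambdaBar L p lam ×
    LambdaSet L p lam => gen L p lam (.c (barRep L p lam q.1) q.2)) = ⊤ := by
  refine submodule_eq_top_of_mul_mem HBar.adjoin_gen ?_ ?_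
  · rw [← sum_gen_idem]
    refine Submodule.sum_mem _ fun χ _ => Submodule.subset_span ⟨(χ, barRep L p lam χ), ?_⟩
    exact (gen_c_self _).trans (by rw [toBar_barRep])
  · intro m hm g
    induction hm using Submodule.span_induction with
    | zero => rw [zero_mul]; exact zero_mem _
    | add a b _ _ ha hb => rw [add_mul]; exact add_mem ha hb
    | smul s a _ ha => rw [smul_mul_assoc]; exact Submodule.smul_mem _ s ha
    | mem m hm =>
      obtain ⟨⟨χ, y⟩, rfl⟩ := hm
      cases g with
      | idem ψ =>
        by_cases h : toBar L p lam y = ψ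
        · subst h
          exact (gen_c_mul_idem (barRep L p lam χ) y).symm ▸ Submodule.subset_span ⟨(χ, y), rfl⟩
        · show gen L p lam (.c (barRep L p lam χ) y) * gen L p lam (.idem ψ) ∈ _
          rw [← gen_c_mul_idem, mul_assoc, gen_idem_mul_idem h, mul_zero]
          exact zero_mem _
      | c y' u =>
        show gen L p lam (.c (barRep L p lam χ) y) * gen L p lam (.c y' u) ∈ _
        by_cases h : toBar L p lam y = toBar L p lam y'
        · have hγ : charRes L (y.1 - y'.1) = 0 := by
            rw [map_sub, toBar_eq_iff.1 h, sub_self]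
          have e : gen L p lam (.c y (translateBy (y.1 - y'.1) hγ u)) = gen L p lam (.c y' u) :=
            gen_c_translate hγ (by simp [translateBy])
          rw [← e, gen_c_mul_c]
          exact Submodule.smul_mem _ _ (Submodule.subset_span ⟨(χ, _), rfl⟩)
        · rw [← gen_c_mul_idem, ← gen_idem_mul_c y', mul_assoc,
            ← mul_assoc (gen L p lam (.idem (toBar L p lam y))), gen_idem_mul_idem h, zero_mul,
            mul_zero]
          exact zero_mem _

instance decidableEqLambdaBar : DecidableEq (LambdaBar L p lam) := Classical.decEq _

variable (L p lam) in
/-- Matrices over the total coordinate ring indexed by `LambdaBar`. -/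
abbrev BarMatrix : Type := Matrix (LambdaBar L p lam) (LambdaBar L p lam) (TotalRing L)

variable (L p lam) in
/-- The matrices representing the generators of `H̄`. -/
def genMatrix : Gen L p lam → BarMatrix L p lam
  | .idem χ => Matrix.single χ χ 1
  | .c x y => Matrix.single (toBar L p lam x) (toBar L p lam y) (monoT L (y.1 - x.1) 0)

theorem prod_eta_smul_monoT (x y u : Fin n → ℤ) :
    monoT L (y - x) 0 * monoT L (u - y) 0 = (∏ i, sElt L i ^ eta x y u i) • monoT L (u - x) 0 := by
  rw [monoT_mul, add_zero, add_comm (y - x), sub_add_sub_cancel]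
  congr 1
  exact Finset.prod_congr rfl fun i _ => by rw [eta_eq_overlap]

variable (L p lam) in
/-- The representation of `H̄` by matrices: `c x y` acts by the monomial of `y - x`. -/
def hbarToMatrix : HBar L p lam →ₐ[SymG L] BarMatrix L p lam :=
  RingQuot.liftAlgHom (SymG L) ⟨FreeAlgebra.lift (SymG L) (genMatrix L p lam), by
    intro a b h
    induction h with
    | sum_idem =>
      rw [map_sum, map_one]
      simp only [FreeAlgebra.lift_ι_apply, genMatrix]
      ext χ ψ
      rw [Matrix.sum_apply, Matrix.one_apply]
      simp [Matrix.single_apply, ite_and]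
    | idem_idem χ => simp [genMatrix]
    | idem_ne χ ψ h => simp [genMatrix, h]
    | idem_c x y => simp [genMatrix]
    | c_idem x y => simp [genMatrix]
    | c_self x => simp [genMatrix, monoT_zero]
    | translate x y x' y' hx h =>
      have e1 : toBar L p lam x' = toBar L p lam x := by
        rw [toBar_eq_iff, ← sub_eq_zero, ← map_sub, hx]
      have e2 : toBar L p lam y' = toBar L p lam y := by
        rw [toBar_eq_iff, ← sub_eq_zero, ← map_sub, ← h, hx]
      have e3 : y'.1 - x'.1 = y.1 - x.1 := by
        rw [sub_eq_sub_iff_sub_eq_sub, ← h]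
      simp only [FreeAlgebra.lift_ι_apply, genMatrix, e1, e2, e3]
    | c_c x y u =>
      simp only [map_mul, map_smul, FreeAlgebra.lift_ι_apply, genMatrix,
        Matrix.single_mul_single_same, prod_eta_smul_monoT, Matrix.smul_single]⟩

theorem hbarToMatrix_gen (g : Gen L p lam) :
    hbarToMatrix L p lam (HBar.gen L p lam g) = genMatrix L p lam g := by
  show RingQuot.liftAlgHom (SymG L) _ (RingQuot.mkAlgHom _ _ _) = _
  rw [RingQuot.liftAlgHom_mkAlgHom_apply, FreeAlgebra.lift_ι_apply]

variable (α : Module.Dual ℤ L)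

/-- The matrices of the elements `c x y`, with `x` in a set of representatives, are linearly
independent: distinct ones have distinct Laurent monomials in the same entry, with nonzero
coefficients since differences of elements of `LambdaBar` are admissible. -/
theorem linearIndependent_genMatrix (hL : IsSaturated L) :
    LinearIndependent (SymG L) fun q : LambdaBar L p lam × LambdaSet L p lam =>
      genMatrix L p lam (.c (barRep L p lam q.1) q.2) := by
  have := isDomain_symG hL
  rw [linearIndependent_iff]
  intro l hl
  ext ⟨χ, y⟩
  -- The weight `ψ - χ` of an entry does not involve `α`, so the restriction for `α = 0` can be
  -- used.
  have h1 := congrArg (fun F : BarMatrix L p lam =>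
    (toLaurent L 0 (F χ (toBar L p lam y))).coeff (y.1 - (barRep L p lam χ).1, 0)) hl
  simp only [Finsupp.linearCombination_apply, Finsupp.sum, Matrix.sum_apply, map_sum,
    Matrix.smul_apply, toLaurent_smul, AddMonoidAlgebra.coeff_sum, Finsupp.coe_finsetSum,
    Finset.sum_apply, AddMonoidAlgebra.coeff_smul, Finsupp.smul_apply, Matrix.zero_apply, map_zero,
    AddMonoidAlgebra.coeff_zero, Finsupp.zero_apply] at h1
  rw [Finset.sum_eq_single (χ, y)] at h1
  · simp only [genMatrix, toBar_barRep, Matrix.single_apply_same, toLaurent_monoT,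
      AddMonoidAlgebra.coeff_single, Nat.cast_zero, Finsupp.single_eq_same, smul_eq_mul] at h1
    refine (mul_eq_zero.1 h1).resolve_right ?_
    refine laurentCoeff_ne_zero hL (d := 0) (isAdmissible_sub χ.2 (toBar L p lam y).2) ?_
    rw [zero_smul, add_zero, map_sub, charRes_barRep]
    rfl
  · rintro ⟨χ', y'⟩ - hne
    simp only [genMatrix, toBar_barRep]
    rw [Matrix.single_apply]
    split_ifs with h
    · obtain ⟨rfl, hy⟩ := h
      rw [toLaurent_monoT, AddMonoidAlgebra.coeff_single, Finsupp.single_apply, if_neg, smul_zero]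
      intro he
      refine hne (Prod.ext rfl (Subtype.ext ?_))
      simpa using congrArg Prod.fst he
    · rw [map_zero, AddMonoidAlgebra.coeff_zero, Finsupp.zero_apply, smul_zero]
  · intro h
    rw [Finsupp.notMem_support_iff.1 h, zero_smul]

theorem injective_of_linearIndependent {S M N ι : Type*} [Ring S] [AddCommGroup M] [Module S M]
    [AddCommGroup N] [Module S N] {v : ι → M} (hv : Submodule.span S (Set.range v) = ⊤)
    (f : M →ₗ[S] N) (hf : LinearIndependent S fun i => f (v i)) : Function.Injective f := by
  refine (injective_iff_map_eq_zero f).2 fun x hx => ?_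
  obtain ⟨c, rfl⟩ := (Finsupp.mem_span_range_iff_exists_finsupp (R := S) (v := v)).1
    (hv ▸ Submodule.mem_top (x := x))
  have : c = 0 := by
    refine linearIndependent_iff.1 hf c ?_
    rw [Finsupp.linearCombination_apply, ← hx, map_finsuppSum]
    simp only [map_smul]
  rw [this, Finsupp.sum_zero_index]

theorem hbarToMatrix_injective (hL : IsSaturated L) :
    Function.Injective (hbarToMatrix L p lam) := by
  refine injective_of_linearIndependent HBar.span_gen_c (hbarToMatrix L p lam).toLinearMap ?_
  have := linearIndependent_genMatrix (p := p) (lam := lam) hL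
  simpa only [AlgHom.toLinearMap_apply, hbarToMatrix_gen] using this

variable (L p lam) in
/-- The matrices whose entries are semi-invariants of the weights of homomorphisms between the line
bundles. -/
def semiInvMatrix : Subalgebra (SymG L) (BarMatrix L p lam) where
  carrier := {F | ∀ χ ψ : LambdaBar L p lam, F χ ψ ∈ semiInv L α (ψ.1 - χ.1) 0}
  mul_mem' {F G} hF hG χ ψ := by
    rw [Matrix.mul_apply]
    refine Submodule.sum_mem _ fun ξ _ => ?_
    have := semiInv_mul_mem (hF χ ξ) (hG ξ ψ)
    rwa [add_comm, sub_add_sub_cancel] at this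
  add_mem' hF hG χ ψ := add_mem (hF χ ψ) (hG χ ψ)
  algebraMap_mem' s χ ψ := by
    rw [Matrix.algebraMap_matrix_apply]
    split_ifs with h
    · subst h
      rw [Algebra.algebraMap_eq_smul_one, sub_self, ← monoT_zero]
      exact smul_mem_semiInv s (monoT_mem_semiInv L α (by simp))
    · exact zero_mem _

theorem genMatrix_c_mem (x y : LambdaSet L p lam) :
    genMatrix L p lam (.c x y) ∈ semiInvMatrix L p lam α := by
  intro χ ψ
  rw [genMatrix, Matrix.single_apply]
  split_ifs with h
  · obtain ⟨rfl, rfl⟩ := h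
    refine monoT_mem_semiInv L α ?_
    rw [zero_smul, add_zero, map_sub]
    rfl
  · exact zero_mem _

/-- The monomials of weight `ψ - χ` are the entries of the matrices of `c x y` with `x` and `y` over
`χ` and `ψ`, so the latter span all matrices of semi-invariants. -/
theorem range_hbarToMatrix : (hbarToMatrix L p lam).range = semiInvMatrix L p lam α := by
  refine le_antisymm ?_ fun F hF => ?_
  · rintro _ ⟨h, rfl⟩
    have hh : h ∈ Submodule.span (SymG L) (Set.range fun q : LambdaBar L p lam ×
      LambdaSet L p lam => HBar.gen L p lam (.c (barRep L p lam q.1) q.2)) := by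
      rw [HBar.span_gen_c]
      trivial
    induction hh using Submodule.span_induction with
    | zero => exact (map_zero (hbarToMatrix L p lam)).symm ▸ zero_mem (semiInvMatrix L p lam α)
    | add a b _ _ ha hb =>
      exact (map_add (hbarToMatrix L p lam) a b).symm ▸ add_mem (S := Subalgebra _ _) ha hb
    | smul s a _ ha =>
      exact (map_smul (hbarToMatrix L p lam) s a).symm ▸ Subalgebra.smul_mem _ ha s
    | mem h hh =>
      obtain ⟨q, rfl⟩ := hh
      show hbarToMatrix L p lam (HBar.gen L p lam _) ∈ _
      rw [hbarToMatrix_gen]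
      exact genMatrix_c_mem α _ _
  · rw [Matrix.matrix_eq_sum_single F]
    refine Subalgebra.sum_mem _ fun χ _ => Subalgebra.sum_mem _ fun ψ _ => ?_
    have h := mem_span_of_semiInv L α (hF χ ψ)
    generalize F χ ψ = r at h
    induction h using Submodule.span_induction with
    | zero => rw [Matrix.single_zero]; exact zero_mem _
    | add a b _ _ ha hb => rw [Matrix.single_add]; exact add_mem ha hb
    | smul s a _ ha => rw [← Matrix.smul_single]; exact Subalgebra.smul_mem _ ha s
    | mem r hr =>
      obtain ⟨⟨q, d⟩, ⟨hq, hd⟩, rfl⟩ := hr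
      obtain rfl : d = 0 := hd
      have hq' : charRes L q = ψ.1 - χ.1 := by
        have : charRes L q = ψ.1 - χ.1 + 0 • α := hq
        rwa [zero_smul, add_zero] at this
      have hy : charRes L ((barRep L p lam χ).1 + q) = ψ.1 := by
        rw [map_add, charRes_barRep, hq', add_sub_cancel]
      refine ⟨HBar.gen L p lam (.c (barRep L p lam χ)
        ⟨(barRep L p lam χ).1 + q, mem_LambdaSet_iff.2 (hy.symm ▸ ψ.2)⟩), ?_⟩
      show hbarToMatrix L p lam _ = _
      rw [hbarToMatrix_gen, genMatrix, toBar_barRep]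
      have : toBar L p lam ⟨(barRep L p lam χ).1 + q, mem_LambdaSet_iff.2 (hy.symm ▸ ψ.2)⟩ = ψ :=
        Subtype.ext hy
      rw [this]
      simp

end HBarMatrix

/-! ### Endomorphisms of the tilting sheaf as matrices -/

section EndMatrix

variable {n : ℕ} {L : Submodule ℤ (Fin n → ℤ)} {α : Module.Dual ℤ L} {p : ℕ}
  {lam : Module.Dual ℤ L}

theorem mulSemi_add {χ ψ : Module.Dual ℤ L} {r r' : TotalRing L} (hr : r ∈ semiInv L α (ψ - χ) 0)
    (hr' : r' ∈ semiInv L α (ψ - χ) 0) :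
    (mulSemi (r + r') (add_mem hr hr') : lineBundle L α χ ⟶ lineBundle L α ψ) =
      mulSemi r hr + mulSemi r' hr' := by
  refine hom_ext_secMap fun U s => Subtype.ext (funext fun x => ?_)
  show LocalizedModule.map _ (LinearMap.mulLeft (CoordRing L α) (r + r')) (s.1 x) =
    LocalizedModule.map _ (LinearMap.mulLeft (CoordRing L α) r) (s.1 x) +
      LocalizedModule.map _ (LinearMap.mulLeft (CoordRing L α) r') (s.1 x)
  induction s.1 x using LocalizedModule.induction_on with
  | h m f =>
    simp only [LocalizedModule.map_mk, LinearMap.mulLeft_apply, add_mul]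
    rw [LocalizedModule.mk_add_mk, ← smul_add, LocalizedModule.mk_cancel_common_left]

theorem mulSemi_congr {χ ψ : Module.Dual ℤ L} {r r' : TotalRing L} (h : r = r')
    (hr : r ∈ semiInv L α (ψ - χ) 0) :
    (mulSemi r hr : lineBundle L α χ ⟶ lineBundle L α ψ) = mulSemi r' (h ▸ hr) := by
  subst h
  rfl

theorem mulSemi_zero (χ ψ : Module.Dual ℤ L) :
    (mulSemi 0 (zero_mem _) : lineBundle L α χ ⟶ lineBundle L α ψ) = 0 := by
  have h := mulSemi_add (α := α) (χ := χ) (ψ := ψ) (zero_mem _) (zero_mem _)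
  rw [mulSemi_congr (add_zero 0)] at h
  exact left_eq_add.1 h

theorem mulSemi_comp {χ ψ ξ : Module.Dual ℤ L} {r r' : TotalRing L}
    (hr : r ∈ semiInv L α (ψ - χ) 0) (hr' : r' ∈ semiInv L α (ξ - ψ) 0) :
    (mulSemi r hr : lineBundle L α χ ⟶ lineBundle L α ψ) ≫
      (mulSemi r' hr' : lineBundle L α ψ ⟶ lineBundle L α ξ) = mulSemi (r * r') (by
        have := semiInv_mul_mem hr hr'
        rwa [add_comm, sub_add_sub_cancel] at this) := by
  refine hom_ext_secMap fun U s => Subtype.ext (funext fun x => ?_)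
  show LocalizedModule.map _ (LinearMap.mulLeft (CoordRing L α) r')
      (LocalizedModule.map _ (LinearMap.mulLeft (CoordRing L α) r) (s.1 x)) =
    LocalizedModule.map _ (LinearMap.mulLeft (CoordRing L α) (r * r')) (s.1 x)
  induction s.1 x using LocalizedModule.induction_on with
  | h m f =>
    simp only [LocalizedModule.map_mk, LinearMap.mulLeft_apply]
    rw [mul_assoc, mul_left_comm]

theorem mulSemi_one (χ : Module.Dual ℤ L) (h : (1 : TotalRing L) ∈ semiInv L α (χ - χ) 0) :
    (mulSemi 1 h : lineBundle L α χ ⟶ lineBundle L α χ) = 𝟙 _ := by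
  refine hom_ext_secMap fun U s => Subtype.ext (funext fun x => ?_)
  show LocalizedModule.map _ (LinearMap.mulLeft (CoordRing L α) 1) (s.1 x) = s.1 x
  induction s.1 x using LocalizedModule.induction_on with
  | h m f => simp only [LocalizedModule.map_mk, LinearMap.mulLeft_apply, one_mul]

theorem mulSemi_sum {χ ψ : Module.Dual ℤ L} {ι : Type*} (T : Finset ι) (r : ι → TotalRing L)
    (hr : ∀ i, r i ∈ semiInv L α (ψ - χ) 0) :
    (mulSemi (∑ i ∈ T, r i) (Submodule.sum_mem _ fun i _ => hr i) :
      lineBundle L α χ ⟶ lineBundle L α ψ) = ∑ i ∈ T, mulSemi (r i) (hr i) := by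
  classical
  induction T using Finset.induction_on with
  | empty =>
    exact (mulSemi_congr Finset.sum_empty _).trans ((mulSemi_zero χ ψ).trans Finset.sum_empty.symm)
  | insert i T hi ih =>
    refine (mulSemi_congr (Finset.sum_insert hi) _).trans ?_
    rw [mulSemi_add (hr i) (Submodule.sum_mem _ fun i _ => hr i), ih, Finset.sum_insert hi]

/-- The component of an endomorphism between two summands. -/
def tiltComponent (χ ψ : LambdaBar L p lam) (φ : tilt L α p lam ⟶ tilt L α p lam) :
    lineBundle L α χ.1 ⟶ lineBundle L α ψ.1 :=
  tiltIncl L α p lam χ ≫ φ ≫ tiltProj L α p lam ψ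

theorem tilt_hom_ext {φ φ' : tilt L α p lam ⟶ tilt L α p lam}
    (h : ∀ χ ψ, tiltComponent χ ψ φ = tiltComponent χ ψ φ') : φ = φ' := by
  refine Limits.biproduct.hom_ext' _ _ fun χ => Limits.biproduct.hom_ext _ _ fun ψ => ?_
  exact (Category.assoc _ _ _).trans ((h χ ψ).trans (Category.assoc _ _ _).symm)

theorem tilt_total : ∑ χ, tiltProj L α p lam χ ≫ tiltIncl L α p lam χ = 𝟙 (tilt L α p lam) :=
  Limits.biproduct.total

theorem tiltComponent_comp (χ ψ : LambdaBar L p lam) (φ φ' : tilt L α p lam ⟶ tilt L α p lam) :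
    tiltComponent χ ψ (φ ≫ φ') = ∑ ξ, tiltComponent χ ξ φ ≫ tiltComponent ξ ψ φ' := by
  have h : φ ≫ φ' = φ ≫ (∑ ξ, tiltProj L α p lam ξ ≫ tiltIncl L α p lam ξ) ≫ φ' := by
    rw [tilt_total, Category.id_comp]
  rw [h]
  simp only [tiltComponent, Preadditive.comp_sum, Preadditive.sum_comp, Category.assoc]

theorem tiltIncl_tiltProj (χ : LambdaBar L p lam) :
    tiltIncl L α p lam χ ≫ tiltProj L α p lam χ = 𝟙 _ :=
  Limits.biproduct.ι_π_self _ _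

theorem tiltIncl_tiltProj_ne {χ ψ : LambdaBar L p lam} (h : χ ≠ ψ) :
    tiltIncl L α p lam χ ≫ tiltProj L α p lam ψ = 0 :=
  Limits.biproduct.ι_π_ne _ h

/-- The endomorphism of `𝒯` with the given matrix. -/
def matrixToHom (F : semiInvMatrix L p lam α) : tilt L α p lam ⟶ tilt L α p lam :=
  Limits.biproduct.matrix fun χ ψ : LambdaBar L p lam =>
    (mulSemi (F.1 χ ψ) (F.2 χ ψ) : lineBundle L α χ.1 ⟶ lineBundle L α ψ.1)

theorem tiltComponent_matrixToHom (χ ψ : LambdaBar L p lam) (F : semiInvMatrix L p lam α) :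
    tiltComponent χ ψ (matrixToHom F) = mulSemi (F.1 χ ψ) (F.2 χ ψ) := by
  have := Limits.biproduct.matrix_components (fun χ ψ : LambdaBar L p lam =>
    (mulSemi (F.1 χ ψ) (F.2 χ ψ) : lineBundle L α χ.1 ⟶ lineBundle L α ψ.1)) χ ψ
  rw [Limits.biproduct.components] at this
  exact this

variable (L α p lam) in
/-- The ring of matrices of semi-invariants maps to the endomorphism ring with the product in which
the left factor is applied first. -/
def matrixToEnd : semiInvMatrix L p lam α →+* (End (tilt L α p lam))ᵐᵒᵖ where
  toFun F := MulOpposite.op (matrixToHom F)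
  map_one' := by
    refine congrArg MulOpposite.op (tilt_hom_ext fun χ ψ => ?_)
    rw [tiltComponent_matrixToHom]
    show _ = tiltIncl L α p lam χ ≫ 𝟙 _ ≫ tiltProj L α p lam ψ
    rw [Category.id_comp]
    by_cases h : χ = ψ
    · subst h
      rw [tiltIncl_tiltProj, ← mulSemi_one χ.1 (by
        rw [sub_self, ← monoT_zero]; exact monoT_mem_semiInv L α (by simp))]
      exact mulSemi_congr (Matrix.one_apply_eq χ) _
    · rw [tiltIncl_tiltProj_ne h, ← mulSemi_zero]
      exact mulSemi_congr (Matrix.one_apply_ne h) _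
  map_mul' F G := by
    refine congrArg MulOpposite.op (tilt_hom_ext fun χ ψ => ?_)
    show _ = tiltComponent χ ψ (matrixToHom F ≫ matrixToHom G)
    rw [tiltComponent_comp]
    simp only [tiltComponent_matrixToHom, mulSemi_comp]
    rw [← mulSemi_sum]
    exact mulSemi_congr (Matrix.mul_apply (M := F.1) (N := G.1)) _
  map_zero' := by
    refine congrArg MulOpposite.op (tilt_hom_ext fun χ ψ => ?_)
    rw [tiltComponent_matrixToHom]
    show _ = tiltIncl L α p lam χ ≫ 0 ≫ tiltProj L α p lam ψ
    rw [Limits.zero_comp, Limits.comp_zero, ← mulSemi_zero]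
    rfl
  map_add' F G := by
    refine congrArg MulOpposite.op (tilt_hom_ext fun χ ψ => ?_)
    show _ = tiltIncl L α p lam χ ≫ (matrixToHom F + matrixToHom G) ≫ tiltProj L α p lam ψ
    rw [Preadditive.add_comp, Preadditive.comp_add]
    show _ = tiltComponent χ ψ (matrixToHom F) + tiltComponent χ ψ (matrixToHom G)
    simp only [tiltComponent_matrixToHom]
    rw [← mulSemi_add]
    rfl

/-- The endomorphisms of `𝒯` are the matrices of semi-invariants. -/
theorem matrixToEnd_bijective (hL : IsSaturated L) (hU : IsUnimodular L) (hα : IsGeneric L α) :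
    Function.Bijective (matrixToEnd L α p lam) := by
  constructor
  · intro F G h
    have h' : matrixToHom F = matrixToHom G := congrArg MulOpposite.unop h
    refine Subtype.ext (Matrix.ext fun χ ψ => ?_)
    have e := congrArg (tiltComponent χ ψ) h'
    rw [tiltComponent_matrixToHom, tiltComponent_matrixToHom] at e
    exact mulSemi_injective hL hU hα (isAdmissible_sub χ.2 ψ.2) _ _ e
  · intro φ
    choose F hF hφ using fun χ ψ : LambdaBar L p lam => exists_eq_mulSemi hL hU hα
      (isAdmissible_sub χ.2 ψ.2) (inWindow_sub hL hU χ.2 ψ.2) (tiltComponent χ ψ φ.unop)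
    refine ⟨⟨Matrix.of F, hF⟩, MulOpposite.unop_injective (tilt_hom_ext fun χ ψ => ?_)⟩
    exact (tiltComponent_matrixToHom χ ψ _).trans (hφ χ ψ).symm

theorem tiltComponent_single_self (χ ψ : LambdaBar L p lam)
    (f : lineBundle L α χ.1 ⟶ lineBundle L α ψ.1) :
    tiltComponent χ ψ (tiltProj L α p lam χ ≫ f ≫ tiltIncl L α p lam ψ) = f := by
  rw [tiltComponent, Category.assoc, Category.assoc, tiltIncl_tiltProj, Category.comp_id,
    ← Category.assoc, tiltIncl_tiltProj, Category.id_comp]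

theorem tiltComponent_single_ne {χ ψ χ' ψ' : LambdaBar L p lam} (h : ¬(χ' = χ ∧ ψ' = ψ))
    (f : lineBundle L α χ'.1 ⟶ lineBundle L α ψ'.1) :
    tiltComponent χ ψ (tiltProj L α p lam χ' ≫ f ≫ tiltIncl L α p lam ψ') = 0 := by
  rw [tiltComponent, Category.assoc, Category.assoc]
  by_cases h1 : χ = χ'
  · rw [tiltIncl_tiltProj_ne fun h2 => h ⟨h1.symm, h2⟩, Limits.comp_zero, Limits.comp_zero,
      Limits.comp_zero]
  · rw [← Category.assoc, tiltIncl_tiltProj_ne h1, Limits.zero_comp]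

theorem matrixToEnd_single (x y : LambdaSet L p lam) (F : semiInvMatrix L p lam α)
    (hF : F.1 = genMatrix L p lam (.c x y)) :
    matrixToEnd L α p lam F = MulOpposite.op (monoEnd L α p lam x y) := by
  refine congrArg MulOpposite.op (tilt_hom_ext fun χ ψ => ?_)
  rw [tiltComponent_matrixToHom]
  have hF' : F.1 χ ψ = Matrix.single (toBar L p lam x) (toBar L p lam y)
    (monoT L (y.1 - x.1) 0) χ ψ := by rw [hF]; rfl
  by_cases h : toBar L p lam x = χ ∧ toBar L p lam y = ψ
  · obtain ⟨rfl, rfl⟩ := h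
    refine Eq.trans ?_ (tiltComponent_single_self (toBar L p lam x) (toBar L p lam y)
      (monoHom L α x.1 y.1)).symm
    refine Eq.trans (mulSemi_congr (r' := totalMk L (mono (y.1 - x.1))) (hF'.trans ?_) _) rfl
    rw [Matrix.single_apply_same, monoT, pow_zero, mul_one]
  · refine Eq.trans ?_ (tiltComponent_single_ne h (monoHom L α x.1 y.1)).symm
    rw [← mulSemi_zero]
    refine mulSemi_congr (hF'.trans ?_) _
    rw [Matrix.single_apply, if_neg h]

theorem matrixToEnd_algebraMap (i : Fin n) :
    matrixToEnd L α p lam (algebraMap (SymG L) _ (sElt L i)) =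
      MulOpposite.op (zwEnd L α p lam i) := by
  refine congrArg MulOpposite.op (tilt_hom_ext fun χ ψ => ?_)
  rw [tiltComponent_matrixToHom]
  have e : tiltComponent χ ψ (zwEnd L α p lam i) =
      zwHom L α χ.1 i ≫ tiltIncl L α p lam χ ≫ tiltProj L α p lam ψ := by
    rw [tiltComponent, ← Category.assoc, ← Category.assoc]
    congr 1
    exact Limits.biproduct.ι_map (fun χ : LambdaBar L p lam => zwHom L α χ.1 i) χ
  rw [e]
  by_cases h : χ = ψ
  · subst h
    rw [tiltIncl_tiltProj, Category.comp_id]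
    refine Eq.trans (mulSemi_congr (r' := totalMk L (zw i)) ?_ _) rfl
    show algebraMap (SymG L) (BarMatrix L p lam) (sElt L i) χ χ = _
    rw [Matrix.algebraMap_matrix_apply, if_pos rfl, algebraMap_sElt]
  · rw [tiltIncl_tiltProj_ne h, Limits.comp_zero, ← mulSemi_zero]
    refine mulSemi_congr ?_ _
    show algebraMap (SymG L) (BarMatrix L p lam) (sElt L i) χ ψ = _
    rw [Matrix.algebraMap_matrix_apply, if_neg h]

theorem matrixToEnd_mem_endWeight (hL : IsSaturated L) (hU : IsUnimodular L) (hα : IsGeneric L α)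
    (F : semiInvMatrix L p lam α) (d : ℕ) :
    MulOpposite.unop (matrixToEnd L α p lam F) ∈ endWeight L α p lam d ↔
      ∀ χ ψ, F.1 χ ψ ∈ weightPart L d := by
  refine forall_congr' fun χ => forall_congr' fun ψ => ?_
  have e : tiltIncl L α p lam χ ≫ MulOpposite.unop (matrixToEnd L α p lam F) ≫
      tiltProj L α p lam ψ = _ := tiltComponent_matrixToHom χ ψ F
  rw [e]
  exact ⟨mem_weightPart_of_homHasSWeight hL hU hα (isAdmissible_sub χ.2 ψ.2) _,
    homHasSWeight_mulSemi _⟩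

end EndMatrix

/-! ### Gradings -/

section Gradings

variable {n : ℕ} {L : Submodule ℤ (Fin n → ℤ)} {p : ℕ} {lam : Module.Dual ℤ L}
variable {R X : Type} [Ring R] [Algebra (SymG L) R] {gen : X → R} {deg : X → ℕ}

theorem one_mem_wordSpan : (1 : R) ∈ wordSpan L gen deg 0 :=
  Submodule.subset_span ⟨[], [], by simp, by simp⟩

theorem smul_mem_wordSpan (i : Fin n) {d : ℕ} {r : R} (hr : r ∈ wordSpan L gen deg d) :
    sElt L i • r ∈ wordSpan L gen deg (d + 2) := by
  induction hr using Submodule.span_induction with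
  | zero => rw [smul_zero]; exact zero_mem _
  | add a b _ _ ha hb => rw [smul_add]; exact add_mem ha hb
  | smul c a _ ha => rw [smul_comm]; exact Submodule.smul_mem _ c ha
  | mem r hr =>
    obtain ⟨l, w, hd, rfl⟩ := hr
    refine Submodule.subset_span ⟨i :: l, w, ?_, ?_⟩
    · rw [← hd, List.length_cons]
      ring
    · rw [Algebra.smul_def, ← mul_assoc, ← map_mul, List.map_cons, List.prod_cons]

theorem mul_gen_mem_wordSpan (g : X) {d : ℕ} {r : R} (hr : r ∈ wordSpan L gen deg d) :
    r * gen g ∈ wordSpan L gen deg (d + deg g) := by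
  induction hr using Submodule.span_induction with
  | zero => rw [zero_mul]; exact zero_mem _
  | add a b _ _ ha hb => rw [add_mul]; exact add_mem ha hb
  | smul c a _ ha => rw [smul_mul_assoc]; exact Submodule.smul_mem _ c ha
  | mem r hr =>
    obtain ⟨l, w, hd, rfl⟩ := hr
    refine Submodule.subset_span ⟨l, w ++ [g], ?_, ?_⟩
    · rw [← hd]
      simp
      ring
    · simp [mul_assoc]

theorem map_mem_iSup {ι M N : Type*} [AddCommGroup M] [AddCommGroup N] {V : ι → Submodule ℤ M}
    {W : Submodule ℤ N} (f : M →+ N) (h : ∀ i, ∀ m ∈ V i, f m ∈ W) {m : M} (hm : m ∈ ⨆ i, V i) :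
    f m ∈ W := by
  have : ⨆ i, V i ≤ W.comap f.toIntLinearMap := iSup_le h
  exact this hm

/-- Every element is a sum of words in the `s i` and the generators. -/
theorem iSup_wordSpan (hgen : Algebra.adjoin (SymG L) (Set.range gen) = ⊤) :
    ⨆ d, wordSpan L gen deg d = ⊤ := by
  have hs : ∀ s : SymG L, ∀ r ∈ ⨆ d, wordSpan L gen deg d, s • r ∈ ⨆ d, wordSpan L gen deg d := by
    intro s
    have hs : s ∈ Algebra.adjoin ℤ (Set.range (sElt L)) := by rw [adjoin_sElt]; trivial
    induction hs using Algebra.adjoin_induction with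
    | mem s hs =>
      obtain ⟨i, rfl⟩ := hs
      exact fun r hr => map_mem_iSup (DistribSMul.toAddMonoidHom R (sElt L i))
        (fun d r hr => Submodule.mem_iSup_of_mem (d + 2) (smul_mem_wordSpan i hr)) hr
    | algebraMap c =>
      intro r hr
      rw [algebraMap_smul]
      exact Submodule.smul_mem _ c hr
    | add s s' _ _ h h' =>
      intro r hr
      rw [add_smul]
      exact add_mem (h r hr) (h' r hr)
    | mul s s' _ _ h h' =>
      intro r hr
      rw [mul_smul]
      exact h _ (h' r hr)
  let M : Submodule (SymG L) R :=
    { carrier := {r | r ∈ ⨆ d, wordSpan L gen deg d}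
      add_mem' := fun ha hb => (⨆ d, wordSpan L gen deg d).add_mem ha hb
      zero_mem' := zero_mem (⨆ d, wordSpan L gen deg d)
      smul_mem' := fun s r hr => hs s r hr }
  have hM : M = ⊤ := submodule_eq_top_of_mul_mem hgen
    (Submodule.mem_iSup_of_mem (p := wordSpan L gen deg) 0 one_mem_wordSpan) fun r hr g =>
      map_mem_iSup (AddMonoidHom.mulRight (gen g))
        (fun d r hr => Submodule.mem_iSup_of_mem (d + deg g) (mul_gen_mem_wordSpan g hr)) hr
  refine eq_top_iff.2 fun r _ => ?_
  have : r ∈ M := hM ▸ Submodule.mem_top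
  exact this

theorem mul_mem_weightPart {d e : ℕ} {r r' : TotalRing L} (hr : r ∈ weightPart L d)
    (hr' : r' ∈ weightPart L e) : r * r' ∈ weightPart L (d + e) := by
  obtain ⟨f, hf, rfl⟩ := hr
  obtain ⟨g, hg, rfl⟩ := hr'
  exact ⟨f * g, MvPolynomial.IsWeightedHomogeneous.mul hf hg, rfl⟩

theorem one_mem_weightPart : (1 : TotalRing L) ∈ weightPart L 0 :=
  ⟨1, MvPolynomial.isWeightedHomogeneous_one _ _, (totalMk L).map_one⟩

theorem sElt_smul_mem_weightPart (i : Fin n) {d : ℕ} {r : TotalRing L} (hr : r ∈ weightPart L d) :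
    sElt L i • r ∈ weightPart L (2 + d) := by
  rw [Algebra.smul_def, algebraMap_sElt]
  refine mul_mem_weightPart ⟨zw i, ?_, rfl⟩ hr
  exact MvPolynomial.IsWeightedHomogeneous.mul (MvPolynomial.isWeightedHomogeneous_X ℤ wtS (.z i))
    (MvPolynomial.isWeightedHomogeneous_X ℤ wtS (.w i))

variable (f : R →ₐ[SymG L] BarMatrix L p lam)

theorem entry_mem_weightPart (hf : ∀ g χ ψ, f (gen g) χ ψ ∈ weightPart L (deg g)) {d : ℕ} {r : R}
    (hr : r ∈ wordSpan L gen deg d) (χ ψ : LambdaBar L p lam) : f r χ ψ ∈ weightPart L d := by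
  have hw : ∀ (w : List X) χ ψ, f (w.map gen).prod χ ψ ∈ weightPart L (w.map deg).sum := by
    intro w
    induction w with
    | nil =>
      intro χ ψ
      simp only [List.map_nil, List.prod_nil, map_one, List.sum_nil, Matrix.one_apply]
      split_ifs
      · exact one_mem_weightPart
      · exact zero_mem _
    | cons g w ih =>
      intro χ ψ
      simp only [List.map_cons, List.prod_cons, map_mul, List.sum_cons, Matrix.mul_apply]
      exact Submodule.sum_mem _ fun ξ _ => mul_mem_weightPart (hf g χ ξ) (ih ξ ψ)
  have hl : ∀ (l : List (Fin n)) (d : ℕ) (r : R), (∀ χ ψ, f r χ ψ ∈ weightPart L d) → ∀ χ ψ,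
      f (algebraMap (SymG L) R (l.map (sElt L)).prod * r) χ ψ ∈
        weightPart L (2 * l.length + d) := by
    intro l d r hr
    induction l with
    | nil => simpa using hr
    | cons i l ih =>
      intro χ ψ
      have e : algebraMap (SymG L) R ((i :: l).map (sElt L)).prod * r =
          sElt L i • (algebraMap (SymG L) R (l.map (sElt L)).prod * r) := by
        rw [Algebra.smul_def, List.map_cons, List.prod_cons, map_mul, mul_assoc]
      rw [e, map_smul, Matrix.smul_apply]
      have := sElt_smul_mem_weightPart i (ih χ ψ)
      rwa [← add_assoc, add_comm 2, ← Nat.mul_succ] at this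
  induction hr using Submodule.span_induction with
  | zero => rw [map_zero]; exact zero_mem _
  | add a b _ _ ha hb => rw [map_add]; exact add_mem ha hb
  | smul c a _ ha => rw [map_zsmul]; exact Submodule.smul_mem _ c ha
  | mem r hr =>
    obtain ⟨l, w, rfl, rfl⟩ := hr
    exact hl l _ _ (hw w) χ ψ

/-- The part of weight `d` of an entry of the matrix of an element. -/
def entryPart (χ ψ : LambdaBar L p lam) (d : ℕ) : R →+ TotalRing L where
  toFun r := (coact L (f r χ ψ)).coeff d
  map_zero' := by simp
  map_add' r r' := by simp

theorem entryPart_of_mem (hf : ∀ g χ ψ, f (gen g) χ ψ ∈ weightPart L (deg g)) {d : ℕ} {r : R}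
    (hr : r ∈ wordSpan L gen deg d) (χ ψ : LambdaBar L p lam) (e : ℕ) :
    entryPart f χ ψ e r = if e = d then f r χ ψ else 0 := by
  show (coact L (f r χ ψ)).coeff e = _
  rw [coact_of_mem (entry_mem_weightPart f hf hr χ ψ), Polynomial.X_pow_mul_C,
    Polynomial.coeff_C_mul_X_pow]

/-- A faithful representation by matrices in which the generators are homogeneous for the scaling
action identifies the grading by words with the grading by weights. -/
theorem mem_wordSpan_iff (hgen : Algebra.adjoin (SymG L) (Set.range gen) = ⊤)
    (hinj : Function.Injective f) (hf : ∀ g χ ψ, f (gen g) χ ψ ∈ weightPart L (deg g)) (d : ℕ)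
    (r : R) : r ∈ wordSpan L gen deg d ↔ ∀ χ ψ, f r χ ψ ∈ weightPart L d := by
  refine ⟨fun h => entry_mem_weightPart f hf h, fun h => ?_⟩
  have hr : r ∈ ⨆ d, wordSpan L gen deg d := by rw [iSup_wordSpan hgen]; trivial
  obtain ⟨c, hc, rfl⟩ := (Submodule.mem_iSup_iff_exists_finsupp _ _).1 hr
  have key : ∀ e χ ψ, entryPart f χ ψ e (c.sum fun _ m => m) = f (c e) χ ψ := by
    intro e χ ψ
    rw [Finsupp.sum, map_sum, Finset.sum_congr rfl fun e' _ =>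
      entryPart_of_mem f hf (hc e') χ ψ e, Finset.sum_ite_eq]
    split_ifs with he
    · rfl
    · rw [Finsupp.notMem_support_iff.1 he, map_zero]
      rfl
  have hzero : ∀ e, e ≠ d → c e = 0 := by
    intro e he
    refine (injective_iff_map_eq_zero f).1 hinj _ (Matrix.ext fun χ ψ => ?_)
    rw [← key]
    show (coact L (f _ χ ψ)).coeff e = _
    rw [coact_of_mem (h χ ψ), Polynomial.X_pow_mul_C, Polynomial.coeff_C_mul_X_pow, if_neg he]
    rfl
  have hsum : (c.sum fun _ m => m) = c d := by
    rw [Finsupp.sum, Finset.sum_eq_single d (fun e _ he => hzero e he)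
      fun hd => Finsupp.notMem_support_iff.1 hd]
  rw [hsum]
  exact hc d

/-- A faithful representation by matrices with homogeneous generators makes the grading by words a
direct sum decomposition: different degrees are separated by the weights of the entries. -/
theorem isInternal_wordSpan (hgen : Algebra.adjoin (SymG L) (Set.range gen) = ⊤)
    (hinj : Function.Injective f) (hf : ∀ g χ ψ, f (gen g) χ ψ ∈ weightPart L (deg g)) :
    DirectSum.IsInternal (wordSpan L gen deg) := by
  rw [DirectSum.isInternal_submodule_iff_iSupIndep_and_iSup_eq_top]
  refine ⟨fun d => ?_, iSup_wordSpan hgen⟩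
  rw [Submodule.disjoint_def]
  intro r hr hr'
  refine (injective_iff_map_eq_zero f).1 hinj _ (Matrix.ext fun χ ψ => ?_)
  have h1 := entryPart_of_mem f hf hr χ ψ d
  rw [if_pos rfl] at h1
  have hle : ⨆ e, ⨆ (_ : e ≠ d), wordSpan L gen deg e ≤
      LinearMap.ker (entryPart f χ ψ d).toIntLinearMap :=
    iSup_le fun e => iSup_le fun he y hy => by
      have := entryPart_of_mem f hf hy χ ψ d
      rwa [if_neg he.symm] at this
  exact h1.symm.trans (hle hr')

theorem genMatrix_mem_weightPart (g : Gen L p lam) (χ ψ : LambdaBar L p lam) :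
    genMatrix L p lam g χ ψ ∈ weightPart L (Gen.deg L p lam g) := by
  cases g with
  | idem ξ =>
    rw [genMatrix, Matrix.single_apply]
    split_ifs
    · exact one_mem_weightPart
    · exact zero_mem _
  | c x y =>
    rw [genMatrix, Matrix.single_apply]
    split_ifs
    · have : Gen.deg L p lam (.c x y) = absSum (y.1 - x.1) := by
        rw [Gen.deg, taxi, absSum]
        refine Finset.sum_congr rfl fun i _ => ?_
        rw [Pi.sub_apply]
        omega
      rw [this]
      exact monoT_mem_weightPart _ _
    · exact zero_mem _

end Gradings

/-! ### The isomorphisms for `H̄` -/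

section HBarIso

variable {n : ℕ} {L : Submodule ℤ (Fin n → ℤ)} {α : Module.Dual ℤ L} {p : ℕ}
  {lam : Module.Dual ℤ L}

/-- A faithful representation onto the algebra of matrices of semi-invariants in which the
generators are homogeneous yields a graded isomorphism with the endomorphism ring. -/
theorem exists_ringEquiv_end (hL : IsSaturated L) (hU : IsUnimodular L) (hα : IsGeneric L α)
    {R X : Type} [Ring R] [Algebra (SymG L) R] {gen : X → R} {deg : X → ℕ}
    (hgen : Algebra.adjoin (SymG L) (Set.range gen) = ⊤) (f : R →ₐ[SymG L] BarMatrix L p lam)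
    (hinj : Function.Injective f) (hrange : f.range = semiInvMatrix L p lam α)
    (hf : ∀ g χ ψ, f (gen g) χ ψ ∈ weightPart L (deg g)) :
    ∃ Φ : R ≃+* (End (tilt L α p lam))ᵐᵒᵖ,
      (∀ r x y, f r = genMatrix L p lam (.c x y) →
        Φ r = MulOpposite.op (monoEnd L α p lam x y)) ∧
      (∀ i, Φ (algebraMap (SymG L) R (sElt L i)) = MulOpposite.op (zwEnd L α p lam i)) ∧
      ∀ d h, h ∈ wordSpan L gen deg d ↔ MulOpposite.unop (Φ h) ∈ endWeight L α p lam d := by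
  have hmem : ∀ r, f r ∈ semiInvMatrix L p lam α := fun r => hrange ▸ ⟨r, rfl⟩
  let g : R →ₐ[SymG L] semiInvMatrix L p lam α := f.codRestrict _ hmem
  have hg : Function.Bijective g := by
    refine ⟨fun r r' h => hinj (congrArg Subtype.val h), fun F => ?_⟩
    obtain ⟨r, hr⟩ : F.1 ∈ f.range := by rw [hrange]; exact F.2
    exact ⟨r, Subtype.ext hr⟩
  refine ⟨RingEquiv.ofBijective ((matrixToEnd L α p lam).comp g.toRingHom)
    ((matrixToEnd_bijective hL hU hα).comp hg), fun r x y h => ?_, fun i => ?_, fun d h => ?_⟩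
  · exact matrixToEnd_single x y (g r) h
  · show matrixToEnd L α p lam (g (algebraMap (SymG L) R (sElt L i))) = _
    rw [g.commutes]
    exact matrixToEnd_algebraMap i
  · rw [mem_wordSpan_iff f hgen hinj hf]
    exact (matrixToEnd_mem_endWeight hL hU hα (g h) d).symm

variable (L p lam) in
/-- The involution on the generators of `H̄` that exchanges `c x y` and `c y x`. -/
def Gen.swap : Gen L p lam → Gen L p lam
  | .idem χ => .idem χ
  | .c x y => .c y x

theorem Gen.swap_swap (g : Gen L p lam) : Gen.swap L p lam (Gen.swap L p lam g) = g := by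
  cases g <;> rfl

theorem Gen.deg_swap (g : Gen L p lam) : Gen.deg L p lam (Gen.swap L p lam g) = Gen.deg L p lam g := by
  cases g with
  | idem χ => rfl
  | c x y =>
    show taxi y.1 x.1 = taxi x.1 y.1
    refine Finset.sum_congr rfl fun i _ => ?_
    omega

open HBar in
variable (L p lam) in
/-- The anti-involution of `H̄` that exchanges `c x y` and `c y x`. -/
def hbarSwap : HBar L p lam →ₐ[SymG L] (HBar L p lam)ᵐᵒᵖ :=
  RingQuot.liftAlgHom (SymG L) ⟨FreeAlgebra.lift (SymG L) fun g =>
    MulOpposite.op (gen L p lam (Gen.swap L p lam g)), by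
    intro a b h
    induction h with
    | sum_idem =>
      rw [map_sum, map_one]
      simp only [FreeAlgebra.lift_ι_apply, Gen.swap]
      rw [← Finset.op_sum, sum_gen_idem, MulOpposite.op_one]
    | idem_idem χ =>
      simp only [map_mul, FreeAlgebra.lift_ι_apply, Gen.swap]
      rw [← MulOpposite.op_mul, gen_idem_mul_self]
    | idem_ne χ ψ h =>
      simp only [map_mul, map_zero, FreeAlgebra.lift_ι_apply, Gen.swap]
      rw [← MulOpposite.op_mul, gen_idem_mul_idem h.symm, MulOpposite.op_zero]
    | idem_c x y =>
      simp only [map_mul, FreeAlgebra.lift_ι_apply, Gen.swap]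
      rw [← MulOpposite.op_mul, gen_c_mul_idem]
    | c_idem x y =>
      simp only [map_mul, FreeAlgebra.lift_ι_apply, Gen.swap]
      rw [← MulOpposite.op_mul, gen_idem_mul_c]
    | c_self x =>
      simp only [FreeAlgebra.lift_ι_apply, Gen.swap]
      rw [gen_c_self]
    | translate x y x' y' hx h =>
      simp only [FreeAlgebra.lift_ι_apply, Gen.swap]
      rw [gen_c_translate (h ▸ hx) h.symm]
    | c_c x y u =>
      simp only [map_mul, map_smul, FreeAlgebra.lift_ι_apply, Gen.swap]
      rw [← MulOpposite.op_mul, gen_c_mul_c, MulOpposite.op_smul,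
        Finset.prod_congr rfl fun i _ => by rw [eta_swap]]⟩

theorem hbarSwap_gen (g : Gen L p lam) : hbarSwap L p lam (HBar.gen L p lam g) =
    MulOpposite.op (HBar.gen L p lam (Gen.swap L p lam g)) := by
  show RingQuot.liftAlgHom (SymG L) _ (RingQuot.mkAlgHom _ _ _) = _
  rw [RingQuot.liftAlgHom_mkAlgHom_apply, FreeAlgebra.lift_ι_apply]

theorem hbarSwap_hbarSwap (h : HBar L p lam) :
    (hbarSwap L p lam (hbarSwap L p lam h).unop).unop = h := by
  have hh : h ∈ Algebra.adjoin (SymG L) (Set.range (HBar.gen L p lam)) :=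
    HBar.adjoin_gen ▸ Algebra.mem_top
  induction hh using Algebra.adjoin_induction with
  | mem h hh =>
    obtain ⟨g, rfl⟩ := hh
    rw [hbarSwap_gen, MulOpposite.unop_op, hbarSwap_gen, MulOpposite.unop_op, Gen.swap_swap]
  | algebraMap s =>
    rw [AlgHom.commutes, MulOpposite.algebraMap_apply, MulOpposite.unop_op, AlgHom.commutes,
      MulOpposite.algebraMap_apply, MulOpposite.unop_op]
  | add a b _ _ ha hb =>
    rw [map_add, MulOpposite.unop_add, map_add, MulOpposite.unop_add, ha, hb]
  | mul a b _ _ ha hb =>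
    rw [map_mul, MulOpposite.unop_mul, map_mul, MulOpposite.unop_mul, ha, hb]

variable (L p lam) in
/-- `H̄` is isomorphic to its opposite ring. -/
def hbarOp : HBar L p lam ≃+* (HBar L p lam)ᵐᵒᵖ where
  toFun := hbarSwap L p lam
  invFun h := (hbarSwap L p lam h.unop).unop
  left_inv := hbarSwap_hbarSwap
  right_inv h := MulOpposite.unop_injective (hbarSwap_hbarSwap h.unop)
  map_mul' := map_mul _
  map_add' := map_add _

theorem hbarSwap_mem_grade {d : ℕ} {h : HBar L p lam} (hh : h ∈ HBar.grade L p lam d) :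
    (hbarSwap L p lam h).unop ∈ HBar.grade L p lam d := by
  induction hh using Submodule.span_induction with
  | zero => rw [map_zero]; exact zero_mem _
  | add a b _ _ ha hb => rw [map_add]; exact add_mem ha hb
  | smul c a _ ha => rw [map_zsmul]; exact Submodule.smul_mem _ c ha
  | mem h hh =>
    obtain ⟨l, w, hd, rfl⟩ := hh
    refine Submodule.subset_span ⟨l, (w.map (Gen.swap L p lam)).reverse, ?_, ?_⟩
    · rw [List.map_reverse, List.sum_reverse, List.map_map, ← hd]
      congr 2
      exact List.map_congr_left fun g _ => Gen.deg_swap g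
    · rw [map_mul, MulOpposite.unop_mul, AlgHom.commutes, MulOpposite.algebraMap_apply,
        MulOpposite.unop_op, ← Algebra.commutes]
      congr 1
      clear hd
      induction w with
      | nil => rw [List.map_nil, List.prod_nil, map_one]; rfl
      | cons g w ih =>
        rw [List.map_cons, List.prod_cons, map_mul, MulOpposite.unop_mul, hbarSwap_gen,
          MulOpposite.unop_op, ih]
        simp

theorem hbarSwap_mem_grade_iff {d : ℕ} {h : HBar L p lam} :
    (hbarSwap L p lam h).unop ∈ HBar.grade L p lam d ↔ h ∈ HBar.grade L p lam d :=
  ⟨fun hh => hbarSwap_hbarSwap h ▸ hbarSwap_mem_grade hh, hbarSwap_mem_grade⟩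

end HBarIso

/-! ### Chambers for a smooth parameter -/

section Chambers

variable {n : ℕ} {L : Submodule ℤ (Fin n → ℤ)} {p : ℕ} {lam : Module.Dual ℤ L}

variable (lam) in
/-- The real vector `e`, viewed as a real character of `D`, restricts to `lam` on `T`. -/
def IsRealLift (e : Fin n → ℝ) : Prop := ∀ v : L, ∑ i, e i * (v.1 i : ℝ) = lam v

variable (p) in
/-- The closed cube of `x`. -/
def closedCube (x : Fin n → ℤ) : Set (Fin n → ℝ) :=
  {e | ∀ i, (p : ℝ) * x i ≤ e i ∧ e i ≤ p * x i + p}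

variable (p) in
/-- The open cube of `x`. -/
def openCube (x : Fin n → ℤ) : Set (Fin n → ℝ) :=
  {e | ∀ i, (p : ℝ) * x i < e i ∧ e i < p * x i + p}

theorem openCube_subset (x : Fin n → ℤ) : openCube p x ⊆ closedCube p x :=
  fun _ h i => ⟨(h i).1.le, (h i).2.le⟩

theorem IsRealLift.combine {e e' : Fin n → ℝ} (h : IsRealLift lam e) (h' : IsRealLift lam e')
    {s t : ℝ} (hst : s + t = 1) : IsRealLift lam fun i => s * e i + t * e' i := by
  intro v
  simp only [add_mul, Finset.sum_add_distrib, mul_assoc, ← Finset.mul_sum]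
  rw [h v, h' v, ← add_mul, hst, one_mul]

theorem le_combine {s t c u v : ℝ} (hs : 0 ≤ s) (ht : 0 ≤ t) (hst : s + t = 1) (hu : c ≤ u)
    (hv : c ≤ v) : c ≤ s * u + t * v := by
  calc c = s * c + t * c := by rw [← add_mul, hst, one_mul]
    _ ≤ s * u + t * v := by gcongr

theorem combine_le {s t c u v : ℝ} (hs : 0 ≤ s) (ht : 0 ≤ t) (hst : s + t = 1) (hu : u ≤ c)
    (hv : v ≤ c) : s * u + t * v ≤ c := by
  calc s * u + t * v ≤ s * c + t * c := by gcongr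
    _ = c := by rw [← add_mul, hst, one_mul]

variable (L) in
/-- The restriction of a real vector to `T`. -/
def realRes (e : Fin n → ℝ) : L →ₗ[ℤ] ℝ where
  toFun v := ∑ i, e i * (v.1 i : ℝ)
  map_add' v w := by simp [mul_add, Finset.sum_add_distrib]
  map_smul' c v := by simp [Finset.mul_sum, mul_left_comm]

/-- For a smooth parameter, small perturbations of a real lift do not change `Λ`. -/
theorem IsSmooth.exists_perturb (hs : IsSmooth L p lam) {e : Fin n → ℝ} (he : IsRealLift lam e)
    (w : Fin n → ℝ) {ε : ℝ} (hε : 0 < ε) : ∃ δ, 0 < δ ∧ δ < ε ∧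
      LambdaReal L p (realRes L fun i => e i - δ * w i) = LambdaSet L p lam := by
  obtain ⟨U, hU, hlam, h⟩ := hs
  let c : ℝ → L → ℝ := fun δ v => realRes L (fun i => e i - δ * w i) v
  have hc : Continuous c := by
    refine continuous_pi fun v => ?_
    show Continuous fun δ => ∑ i, (e i - δ * w i) * (v.1 i : ℝ)
    fun_prop
  have h0 : c 0 ∈ U := by
    convert hlam using 1
    funext v
    have := he v
    simpa [c, realRes] using this
  have hnhds : ∀ᶠ δ in nhdsWithin (0 : ℝ) (Set.Ioi 0), c δ ∈ U :=
    (hc.continuousAt.eventually (hU.mem_nhds h0)).filter_mono nhdsWithin_le_nhds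
  have hε' : ∀ᶠ δ in nhdsWithin (0 : ℝ) (Set.Ioi 0), δ ∈ Set.Ioo 0 ε := Ioo_mem_nhdsGT hε
  obtain ⟨δ, h1, h2⟩ := (hnhds.and hε').exists
  exact ⟨δ, h2.1, h2.2, h _ h1⟩

/-- For a smooth parameter, `Λ` consists of all closed cubes that meet the real lifts. -/
theorem IsSmooth.mem_of_closedCube (hs : IsSmooth L p lam) (hp : 0 < p) {e : Fin n → ℝ}
    (he : IsRealLift lam e) {x : Fin n → ℤ} (hx : e ∈ closedCube p x) : x ∈ LambdaSet L p lam := by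
  classical
  have hp' : (0 : ℝ) < p := by exact_mod_cast hp
  obtain ⟨δ, h0, h1, hΛ⟩ :=
    hs.exists_perturb he (fun i => if e i = p * x i + p then 1 else 0) hp'
  rw [← hΛ]
  refine ⟨_, fun v => rfl, fun i => ?_⟩
  obtain ⟨h2, h3⟩ := hx i
  split_ifs with h
  · constructor <;> linarith
  · have := lt_of_le_of_ne h3 h
    constructor <;> linarith

/-- For a smooth parameter, the open cubes of all elements of `Λ` meet the real lifts. -/
theorem IsSmooth.exists_openCube (hs : IsSmooth L p lam) {x : Fin n → ℤ}
    (hx : x ∈ LambdaSet L p lam) : ∃ e, IsRealLift lam e ∧ e ∈ openCube p x := by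
  have hx' := hx
  obtain ⟨a, ha, hax⟩ := hx
  have ha' : IsRealLift lam fun i => (a i : ℝ) := by
    intro v
    rw [← ha, charRes_apply]
    push_cast
    rfl
  obtain ⟨δ, h0, -, hΛ⟩ := hs.exists_perturb ha' (fun _ => 1) one_pos
  rw [← hΛ] at hx'
  obtain ⟨b, hb, hbx⟩ := hx'
  have hb' : IsRealLift lam fun i => b i + δ := by
    intro v
    have h1 := hb v
    have h2 := ha' v
    simp only [realRes, LinearMap.coe_mk, AddHom.coe_mk, sub_mul, Finset.sum_sub_distrib, mul_one]
      at h1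
    simp only [add_mul, Finset.sum_add_distrib]
    linarith
  -- The lift `b + δ` lies strictly above the lower walls, the lift `a` strictly below the upper
  -- ones; a point of the segment close to `a` satisfies both.
  have hev : ∀ᶠ s in nhdsWithin (0 : ℝ) (Set.Ioi 0), s ∈ Set.Ioo (0 : ℝ) 1 ∧
      ∀ i, (1 - s) * a i + s * (b i + δ) < p * x i + p := by
    refine Filter.Eventually.and (Ioo_mem_nhdsGT one_pos) (Filter.eventually_all.2 fun i => ?_)
    have hcont : Continuous fun s : ℝ => (1 - s) * a i + s * (b i + δ) := by fun_prop
    refine (hcont.continuousAt.eventually (Iio_mem_nhds ?_)).filter_mono nhdsWithin_le_nhds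
    have := (hax i).2
    simp only [sub_zero, one_mul, zero_mul, add_zero]
    exact_mod_cast this
  obtain ⟨s, ⟨hs0, hs1⟩, hlt⟩ := hev.exists
  refine ⟨_, ha'.combine hb' (sub_add_cancel 1 s), fun i => ⟨?_, hlt i⟩⟩
  have h1 : (p : ℝ) * x i ≤ a i := by exact_mod_cast (hax i).1
  have h2 := (hbx i).1
  nlinarith [mul_pos hs0 h0]

/-- The neighbour of `y` in the direction of `x` in the `k`-th coordinate. -/
def toward (x y : Fin n → ℤ) (k : Fin n) : Fin n → ℤ := y + Pi.single k (Int.sign (x k - y k))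

variable (p) in
/-- The position of the wall between `y` and its neighbour in the direction of `x`. -/
def wall (x y : Fin n → ℤ) (k : Fin n) : ℝ := if y k < x k then p * y k + p else p * y k

variable (p) in
/-- The parameter of the point where the segment from `b` to `a` crosses the `k`-th wall of `y`: the
crossing point divides the segment in the ratio `crossing : 1`. It is meaningful for `x k ≠ y k` and
`a` in the open cube of `x`, when the denominator does not vanish. -/
def crossing (x y : Fin n → ℤ) (a b : Fin n → ℝ) (k : Fin n) : ℝ :=
  (wall p x y k - b k) / (a k - wall p x y k)

theorem wall_lt {x y : Fin n → ℤ} {k : Fin n} {a : Fin n → ℝ} (ha : a ∈ openCube p x)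
    (h : y k < x k) : wall p x y k < a k := by
  rw [wall, if_pos h]
  have h1 : ((y k + 1 : ℤ) : ℝ) ≤ x k := by exact_mod_cast h
  have h2 := (ha k).1
  push_cast at h1
  nlinarith [(Nat.cast_nonneg p : (0 : ℝ) ≤ p)]

theorem lt_wall {x y : Fin n → ℤ} {k : Fin n} {a : Fin n → ℝ} (ha : a ∈ openCube p x)
    (h : x k < y k) : a k < wall p x y k := by
  rw [wall, if_neg h.le.not_gt]
  have h1 : ((x k + 1 : ℤ) : ℝ) ≤ y k := by exact_mod_cast h
  have h2 := (ha k).2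
  push_cast at h1
  nlinarith [(Nat.cast_nonneg p : (0 : ℝ) ≤ p)]

theorem sub_wall_ne_zero {x y : Fin n → ℤ} {k : Fin n} {a : Fin n → ℝ} (ha : a ∈ openCube p x)
    (h : x k ≠ y k) : a k - wall p x y k ≠ 0 := by
  rcases lt_or_gt_of_ne h with h | h
  · exact (sub_neg.2 (lt_wall ha h)).ne
  · exact (sub_pos.2 (wall_lt ha h)).ne'

theorem crossing_nonneg {x y : Fin n → ℤ} {k : Fin n} {a b : Fin n → ℝ} (ha : a ∈ openCube p x)
    (hb : b ∈ closedCube p y) (h : x k ≠ y k) : 0 ≤ crossing p x y a b k := by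
  rcases lt_or_gt_of_ne h with h | h
  · refine div_nonneg_of_nonpos ?_ (sub_neg.2 (lt_wall ha h)).le
    rw [wall, if_neg h.le.not_gt, sub_nonpos]
    exact (hb k).1
  · refine div_nonneg ?_ (sub_pos.2 (wall_lt ha h)).le
    rw [wall, if_pos h, sub_nonneg]
    exact (hb k).2

/-- The walls of `y` that the segment from `b` to `a` crosses first. -/
def IsFirst (p : ℕ) (x y : Fin n → ℤ) (a b : Fin n → ℝ) (k : Fin n) : Prop :=
  x k ≠ y k ∧ ∀ k', x k' ≠ y k' → crossing p x y a b k ≤ crossing p x y a b k'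

/-- The point where the segment leaves the cube of `y` belongs to all cubes across walls that are
crossed first, so these cubes belong to `Λ`. -/
theorem IsSmooth.mem_of_isFirst (hs : IsSmooth L p lam) (hp : 0 < p) {x y : Fin n → ℤ}
    {a b : Fin n → ℝ} (ha : a ∈ openCube p x) (ha' : IsRealLift lam a)
    (hb : b ∈ closedCube p y) (hb' : IsRealLift lam b) {k₀ : Fin n} (hk₀ : IsFirst p x y a b k₀)
    {z : Fin n → ℤ}
    (hz : ∀ k, z k = y k ∨ IsFirst p x y a b k ∧ z k = y k + Int.sign (x k - y k)) :
    z ∈ LambdaSet L p lam := by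
  set g := crossing p x y a b k₀ with hg
  have hg0 : 0 ≤ g := crossing_nonneg ha hb hk₀.1
  have hg1 : 0 < 1 + g := by linarith
  have hsum : 1 / (1 + g) + g / (1 + g) = 1 := by rw [← add_div, div_self hg1.ne']
  refine hs.mem_of_closedCube hp (hb'.combine ha' hsum) fun k => ?_
  set s := 1 / (1 + g)
  set t := g / (1 + g)
  have hs0 : 0 < s := by positivity
  have ht0 : 0 ≤ t := by positivity
  have hts : t = g * s := by simp only [s, t]; ring
  have hbk := hb k
  have hak := ha k
  dsimp only
  have hcr : x k ≠ y k → s * b k + t * a k - wall p x y k =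
      s * (a k - wall p x y k) * (g - crossing p x y a b k) := by
    intro h
    have h1 := sub_wall_ne_zero ha h
    have h2 : crossing p x y a b k * (a k - wall p x y k) = wall p x y k - b k :=
      div_mul_cancel₀ _ h1
    have hts' : g * s = 1 - s := by rw [← hts, ← hsum]; ring
    linear_combination a k * hsum - (a k - wall p x y k) * hts' + s * h2
  have hp' : (0 : ℝ) < p := by exact_mod_cast hp
  have hfirst : IsFirst p x y a b k → crossing p x y a b k = g := fun h =>
    le_antisymm (h.2 k₀ hk₀.1) (hk₀.2 k h.1)
  rcases lt_trichotomy (x k) (y k) with h | h | h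
  · have hc := hcr h.ne
    have hw := lt_wall ha h
    have hle := hk₀.2 k h.ne
    have hmul : 0 ≤ s * (a k - wall p x y k) * (g - crossing p x y a b k) := by
      refine mul_nonneg_of_nonpos_of_nonpos ?_ (sub_nonpos.2 hle)
      exact mul_nonpos_of_nonneg_of_nonpos hs0.le (sub_neg.2 hw).le
    have hwall : wall p x y k = p * y k := if_neg h.le.not_gt
    have hup : s * b k + t * a k ≤ p * y k + p :=
      combine_le hs0.le ht0 hsum hbk.2 (by linarith)
    rcases hz k with hzk | ⟨hf, hzk⟩
    · rw [hzk]
      constructor <;> linarith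
    · rw [hfirst hf, sub_self, mul_zero] at hc
      rw [hzk, Int.sign_eq_neg_one_of_neg (sub_neg.2 h)]
      push_cast
      constructor <;> linarith
  · have hzk : z k = y k := (hz k).resolve_right fun h' => h'.1.1 h
    rw [hzk]
    rw [h] at hak
    exact ⟨le_combine hs0.le ht0 hsum hbk.1 hak.1.le, combine_le hs0.le ht0 hsum hbk.2 hak.2.le⟩
  · have hc := hcr h.ne'
    have hw := wall_lt ha h
    have hle := hk₀.2 k h.ne'
    have hmul : s * (a k - wall p x y k) * (g - crossing p x y a b k) ≤ 0 :=
      mul_nonpos_of_nonneg_of_nonpos (mul_nonneg hs0.le (sub_pos.2 hw).le) (sub_nonpos.2 hle)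
    have hwall : wall p x y k = p * y k + p := if_pos h
    have hlow : p * y k ≤ s * b k + t * a k :=
      le_combine hs0.le ht0 hsum hbk.1 (by linarith)
    rcases hz k with hzk | ⟨hf, hzk⟩
    · rw [hzk]
      constructor <;> linarith
    · rw [hfirst hf, sub_self, mul_zero] at hc
      rw [hzk, Int.sign_eq_one_of_pos (sub_pos.2 h)]
      push_cast
      constructor <;> linarith

theorem toward_same (x y : Fin n → ℤ) (k : Fin n) :
    toward x y k k = y k + Int.sign (x k - y k) := by
  rw [toward, Pi.add_apply, Pi.single_eq_same]

theorem toward_ne (x y : Fin n → ℤ) {k i : Fin n} (h : i ≠ k) : toward x y k i = y i := by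
  rw [toward, Pi.add_apply, Pi.single_eq_of_ne h, add_zero]

theorem exists_isFirst (p : ℕ) {x y : Fin n → ℤ} (hxy : x ≠ y) (a b : Fin n → ℝ) :
    ∃ k, IsFirst p x y a b k := by
  classical
  obtain ⟨k, hk⟩ := Function.ne_iff.1 hxy
  obtain ⟨k₀, hk₀, hmin⟩ := Finset.exists_min_image (Finset.univ.filter fun k => x k ≠ y k)
    (crossing p x y a b) ⟨k, by simpa using hk⟩
  exact ⟨k₀, (Finset.mem_filter.1 hk₀).2, fun k' hk' => hmin k' (by simpa using hk')⟩

theorem IsSmooth.toward_mem_of_isFirst (hs : IsSmooth L p lam) (hp : 0 < p) {x y : Fin n → ℤ}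
    {a b : Fin n → ℝ} (ha : a ∈ openCube p x) (ha' : IsRealLift lam a)
    (hb : b ∈ closedCube p y) (hb' : IsRealLift lam b) {k : Fin n} (hk : IsFirst p x y a b k) :
    toward x y k ∈ LambdaSet L p lam := by
  refine hs.mem_of_isFirst hp ha ha' hb hb' hk fun i => ?_
  by_cases h : i = k
  · subst h
    exact Or.inr ⟨hk, toward_same x y i⟩
  · exact Or.inl (toward_ne x y h)

/-- Two different elements of `Λ` can be brought closer to each other within `Λ`. -/
theorem IsSmooth.exists_toward (hs : IsSmooth L p lam) (hp : 0 < p) {x y : Fin n → ℤ}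
    (hx : x ∈ LambdaSet L p lam) (hy : y ∈ LambdaSet L p lam) (hxy : x ≠ y) :
    ∃ k, x k ≠ y k ∧ toward x y k ∈ LambdaSet L p lam := by
  obtain ⟨a, ha', ha⟩ := hs.exists_openCube hx
  obtain ⟨b, hb', hb⟩ := hs.exists_openCube hy
  obtain ⟨k, hk⟩ := exists_isFirst p hxy a b
  exact ⟨k, hk.1, hs.toward_mem_of_isFirst hp ha ha' (openCube_subset y hb) hb' hk⟩

/-- If the neighbour across a wall belongs to `Λ`, then the wall contains a real lift in the cube,
and a segment starting there crosses this wall first. -/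
theorem IsSmooth.exists_facet (hs : IsSmooth L p lam) {x y : Fin n → ℤ} {a : Fin n → ℝ}
    (ha : a ∈ openCube p x) (hy : y ∈ LambdaSet L p lam) {k : Fin n} (hk : x k ≠ y k)
    (hyk : toward x y k ∈ LambdaSet L p lam) :
    ∃ b ∈ closedCube p y, IsRealLift lam b ∧ IsFirst p x y a b k := by
  obtain ⟨c, hc', hc⟩ := hs.exists_openCube hy
  obtain ⟨d, hd', hd⟩ := hs.exists_openCube hyk
  have hck := hc k
  have hdk := hd k
  rw [toward_same] at hdk
  -- The segment from `c` to `d` crosses the wall at the parameter `s`.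
  obtain ⟨s, t, hs0, ht0, hst, hw⟩ : ∃ s t : ℝ, 0 ≤ s ∧ 0 ≤ t ∧ s + t = 1 ∧
      s * c k + t * d k = wall p x y k := by
    have hseg : wall p x y k ∈ segment ℝ (c k) (d k) := by
      rw [segment_eq_uIcc, Set.mem_uIcc]
      rcases lt_or_gt_of_ne hk with h | h
      · rw [Int.sign_eq_neg_one_of_neg (sub_neg.2 h)] at hdk
        push_cast at hdk
        rw [wall, if_neg h.le.not_gt]
        right
        constructor <;> linarith
      · rw [Int.sign_eq_one_of_pos (sub_pos.2 h)] at hdk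
        push_cast at hdk
        rw [wall, if_pos h]
        left
        constructor <;> linarith
    obtain ⟨s, t, hs0, ht0, hst, hw⟩ := hseg
    exact ⟨s, t, hs0, ht0, hst, hw⟩
  have hb : (fun i => s * c i + t * d i) ∈ closedCube p y := by
    intro i
    dsimp only
    by_cases hi : i = k
    · subst hi
      rw [hw, wall]
      split_ifs
      · constructor <;> linarith
      · constructor <;> linarith
    · have hci := hc i
      have hdi := hd i
      rw [toward_ne x y hi] at hdi
      exact ⟨le_combine hs0 ht0 hst hci.1.le hdi.1.le, combine_le hs0 ht0 hst hci.2.le hdi.2.le⟩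
  refine ⟨_, hb, hc'.combine hd' hst, hk, fun k' hk' => ?_⟩
  refine le_trans (le_of_eq ?_) (crossing_nonneg ha hb hk')
  rw [crossing, hw, sub_self, zero_div]

/-- The neighbours of `y` in the direction of `x` are connected by squares in `Λ`: moving along a
segment between two facets of the cube of `y`, the set of walls crossed first changes by passing
through walls that are crossed simultaneously. -/
theorem IsSmooth.toward_induction (hs : IsSmooth L p lam) (hp : 0 < p) {x y : Fin n → ℤ}
    (hx : x ∈ LambdaSet L p lam) (hy : y ∈ LambdaSet L p lam) {Q : Fin n → Prop} {i j : Fin n}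
    (hi : x i ≠ y i) (hj : x j ≠ y j) (hyi : toward x y i ∈ LambdaSet L p lam)
    (hyj : toward x y j ∈ LambdaSet L p lam) (hQ : Q i)
    (hstep : ∀ k k', k ≠ k' → x k ≠ y k → x k' ≠ y k' → toward x y k ∈ LambdaSet L p lam →
      toward x y k' ∈ LambdaSet L p lam → toward x (toward x y k) k' ∈ LambdaSet L p lam →
      Q k → Q k') : Q j := by
  obtain ⟨a, ha', ha⟩ := hs.exists_openCube hx
  obtain ⟨b, hb, hb', hbi⟩ := hs.exists_facet ha hy hi hyi
  obtain ⟨c, hc, hc', hcj⟩ := hs.exists_facet ha hy hj hyj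
  let q : ℝ → Fin n → ℝ := fun s k => (1 - s) * b k + s * c k
  have hq : ∀ s ∈ Set.Icc (0 : ℝ) 1, q s ∈ closedCube p y := by
    intro s hs k
    have hbk := hb k
    have hck := hc k
    obtain ⟨h0, h1⟩ := hs
    exact ⟨le_combine (sub_nonneg.2 h1) h0 (sub_add_cancel 1 s) hbk.1 hck.1,
      combine_le (sub_nonneg.2 h1) h0 (sub_add_cancel 1 s) hbk.2 hck.2⟩
  have hq' : ∀ s, IsRealLift lam (q s) := fun s => hb'.combine hc' (sub_add_cancel 1 s)
  have hclosed : ∀ k, IsClosed {s | IsFirst p x y a (q s) k} := by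
    intro k
    have hcont : ∀ k, Continuous fun s => crossing p x y a (q s) k := by
      intro k
      simp only [crossing, q]
      fun_prop
    have : {s | IsFirst p x y a (q s) k} = {s | x k ≠ y k} ∩
        ⋂ k', ⋂ (_ : x k' ≠ y k'), {s | crossing p x y a (q s) k ≤ crossing p x y a (q s) k'} := by
      ext s
      simp [IsFirst]
    rw [this]
    exact isClosed_const.inter (isClosed_iInter fun k' => isClosed_iInter fun _ =>
      isClosed_le (hcont k) (hcont k'))
  by_contra hQj
  have hxy : x ≠ y := fun h => hi (congrFun h i)
  have key : ∀ s ∈ Set.Icc (0 : ℝ) 1, ∀ k k', IsFirst p x y a (q s) k →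
      IsFirst p x y a (q s) k' → Q k → Q k' := by
    intro s hsI k k' hk hk' hQk
    by_cases hkk : k = k'
    · exact hkk ▸ hQk
    refine hstep k k' hkk hk.1 hk'.1 (hs.toward_mem_of_isFirst hp ha ha' (hq s hsI) (hq' s) hk)
      (hs.toward_mem_of_isFirst hp ha ha' (hq s hsI) (hq' s) hk') ?_ hQk
    refine hs.mem_of_isFirst hp ha ha' (hq s hsI) (hq' s) hk fun l => ?_
    by_cases hl' : l = k'
    · subst hl'
      exact Or.inr ⟨hk', by rw [toward_same, toward_ne x y (Ne.symm hkk)]⟩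
    · rw [toward_ne x _ hl']
      by_cases hl : l = k
      · subst hl
        exact Or.inr ⟨hk, toward_same x y l⟩
      · exact Or.inl (toward_ne x y hl)
  -- The parameters at which a wall with `Q` is crossed first, and those at which one without `Q`
  -- is, form closed sets covering the interval, so they have a point in common.
  have hpre := isPreconnected_closed_iff.1 (isPreconnected_Icc (a := (0 : ℝ)) (b := 1))
    (⋃ k ∈ {k | Q k}, {s | IsFirst p x y a (q s) k})
    (⋃ k ∈ {k | ¬ Q k}, {s | IsFirst p x y a (q s) k})
    (Set.Finite.isClosed_biUnion (Set.toFinite _) fun k _ => hclosed k)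
    (Set.Finite.isClosed_biUnion (Set.toFinite _) fun k _ => hclosed k) ?_ ?_ ?_
  · obtain ⟨s, hsI, h1, h2⟩ := hpre
    simp only [Set.mem_iUnion, Set.mem_ofPred_eq, exists_prop] at h1 h2
    obtain ⟨k, hk, hk'⟩ := h1
    obtain ⟨l, hl, hl'⟩ := h2
    exact hl (key s hsI k l hk' hl' hk)
  · intro s _
    obtain ⟨k, hk⟩ := exists_isFirst p hxy a (q s)
    by_cases h : Q k
    · exact Or.inl (Set.mem_biUnion (x := k) h hk)
    · exact Or.inr (Set.mem_biUnion (x := k) h hk)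
  · refine ⟨0, ⟨le_rfl, zero_le_one⟩, Set.mem_biUnion (x := i) hQ ?_⟩
    have : q 0 = b := by funext k; simp [q]
    rw [Set.mem_ofPred_eq, this]
    exact hbi
  · refine ⟨1, ⟨zero_le_one, le_rfl⟩, Set.mem_biUnion (x := j) hQj ?_⟩
    have : q 1 = c := by funext k; simp [q]
    rw [Set.mem_ofPred_eq, this]
    exact hcj

end Chambers

/-! ### The quadratic algebra -/

section Quadratic

variable {n : ℕ} {L : Submodule ℤ (Fin n → ℤ)} {p : ℕ} {lam : Module.Dual ℤ L}

theorem HQuad.adjoin_gen : Algebra.adjoin (SymG L) (Set.range (HQuad.gen L p lam)) = ⊤ :=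
  adjoin_mkAlgHom_ι (QRel L p lam)

theorem HQuad.sum_gen_idem : ∑ χ, HQuad.gen L p lam (.idem χ) = 1 := by
  have := RingQuot.mkAlgHom_rel (SymG L) (QRel.sum_idem (L := L) (p := p) (lam := lam))
  rw [map_sum, map_one] at this
  exact this

theorem HQuad.gen_idem_mul_self (χ : LambdaBar L p lam) :
    HQuad.gen L p lam (.idem χ) * HQuad.gen L p lam (.idem χ) = HQuad.gen L p lam (.idem χ) := by
  have := RingQuot.mkAlgHom_rel (SymG L) (QRel.idem_idem χ)
  rw [map_mul] at this
  exact this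

theorem HQuad.gen_idem_mul_idem {χ ψ : LambdaBar L p lam} (h : χ ≠ ψ) :
    HQuad.gen L p lam (.idem χ) * HQuad.gen L p lam (.idem ψ) = 0 := by
  have := RingQuot.mkAlgHom_rel (SymG L) (QRel.idem_ne χ ψ h)
  rw [map_mul, map_zero] at this
  exact this

theorem HQuad.gen_idem_mul_plus (i : Fin n) (χ ψ : LambdaBar L p lam)
    (h : ψ.1 = χ.1 + charRes L (Pi.single i 1)) :
    HQuad.gen L p lam (.idem ψ) * HQuad.gen L p lam (.plus i χ ψ h) =
      HQuad.gen L p lam (.plus i χ ψ h) := by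
  have := RingQuot.mkAlgHom_rel (SymG L) (QRel.idem_plus i χ ψ h)
  rw [map_mul] at this
  exact this

theorem HQuad.gen_plus_mul_idem (i : Fin n) (χ ψ : LambdaBar L p lam)
    (h : ψ.1 = χ.1 + charRes L (Pi.single i 1)) :
    HQuad.gen L p lam (.plus i χ ψ h) * HQuad.gen L p lam (.idem χ) =
      HQuad.gen L p lam (.plus i χ ψ h) := by
  have := RingQuot.mkAlgHom_rel (SymG L) (QRel.plus_idem i χ ψ h)
  rw [map_mul] at this
  exact this

theorem HQuad.gen_idem_mul_minus (i : Fin n) (χ ψ : LambdaBar L p lam)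
    (h : χ.1 = ψ.1 + charRes L (Pi.single i 1)) :
    HQuad.gen L p lam (.idem ψ) * HQuad.gen L p lam (.minus i χ ψ h) =
      HQuad.gen L p lam (.minus i χ ψ h) := by
  have := RingQuot.mkAlgHom_rel (SymG L) (QRel.idem_minus i χ ψ h)
  rw [map_mul] at this
  exact this

theorem HQuad.gen_minus_mul_idem (i : Fin n) (χ ψ : LambdaBar L p lam)
    (h : χ.1 = ψ.1 + charRes L (Pi.single i 1)) :
    HQuad.gen L p lam (.minus i χ ψ h) * HQuad.gen L p lam (.idem χ) =
      HQuad.gen L p lam (.minus i χ ψ h) := by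
  have := RingQuot.mkAlgHom_rel (SymG L) (QRel.minus_idem i χ ψ h)
  rw [map_mul] at this
  exact this

theorem HQuad.gen_minus_mul_plus (i : Fin n) (χ ψ : LambdaBar L p lam)
    (h : ψ.1 = χ.1 + charRes L (Pi.single i 1)) :
    HQuad.gen L p lam (.minus i ψ χ h) * HQuad.gen L p lam (.plus i χ ψ h) =
      sElt L i • HQuad.gen L p lam (.idem χ) := by
  have := RingQuot.mkAlgHom_rel (SymG L) (QRel.minus_plus i χ ψ h)
  rw [map_mul, map_smul] at this
  exact this

theorem HQuad.gen_plus_mul_minus (i : Fin n) (χ ψ : LambdaBar L p lam)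
    (h : ψ.1 = χ.1 + charRes L (Pi.single i 1)) :
    HQuad.gen L p lam (.plus i χ ψ h) * HQuad.gen L p lam (.minus i ψ χ h) =
      sElt L i • HQuad.gen L p lam (.idem ψ) := by
  have := RingQuot.mkAlgHom_rel (SymG L) (QRel.plus_minus i χ ψ h)
  rw [map_mul, map_smul] at this
  exact this

open Classical in
variable (L p lam) in
/-- The element of the quadratic algebra that corresponds to `c x y` for neighbours `x` and `y`, and
zero for other pairs. -/
def quadStep (x y : LambdaSet L p lam) : HQuad L p lam :=
  if h : ∃ i, y.1 = x.1 + Pi.single i 1 then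
    HQuad.gen L p lam (.minus h.choose (toBar L p lam y) (toBar L p lam x)
      (toBar_add L p lam h.choose x y h.choose_spec))
  else if h : ∃ i, x.1 = y.1 + Pi.single i 1 then
    HQuad.gen L p lam (.plus h.choose (toBar L p lam y) (toBar L p lam x)
      (toBar_add L p lam h.choose y x h.choose_spec))
  else 0

theorem single_one_injective {i j : Fin n}
    (h : (Pi.single i 1 : Fin n → ℤ) = Pi.single j 1) : i = j := by
  by_contra hij
  have := congrFun h i
  rw [Pi.single_eq_same, Pi.single_eq_of_ne hij] at this
  exact one_ne_zero this

theorem quadStep_add {x y : LambdaSet L p lam} {i : Fin n} (h : y.1 = x.1 + Pi.single i 1) :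
    quadStep L p lam x y = HQuad.gen L p lam (.minus i (toBar L p lam y) (toBar L p lam x)
      (toBar_add L p lam i x y h)) := by
  have hex : ∃ i, y.1 = x.1 + Pi.single i 1 := ⟨i, h⟩
  have hi : hex.choose = i :=
    single_one_injective (add_left_cancel (hex.choose_spec.symm.trans h))
  rw [quadStep, dif_pos hex]
  congr 2

theorem quadStep_sub {x y : LambdaSet L p lam} {i : Fin n} (h : x.1 = y.1 + Pi.single i 1) :
    quadStep L p lam x y = HQuad.gen L p lam (.plus i (toBar L p lam y) (toBar L p lam x)
      (toBar_add L p lam i y x h)) := by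
  have hex : ∃ i, x.1 = y.1 + Pi.single i 1 := ⟨i, h⟩
  have hi : hex.choose = i :=
    single_one_injective (add_left_cancel (hex.choose_spec.symm.trans h))
  have hnot : ¬∃ i, y.1 = x.1 + Pi.single i 1 := by
    rintro ⟨j, hj⟩
    rw [h, add_assoc, left_eq_add] at hj
    have := congrFun hj i
    simp only [Pi.add_apply, Pi.single_eq_same, Pi.zero_apply, Pi.single_apply] at this
    split_ifs at this <;> omega
  rw [quadStep, dif_neg hnot, dif_pos hex]
  congr 2

/-- Crossing a wall and returning. -/
theorem quadStep_mul_quadStep {x y : LambdaSet L p lam} {i : Fin n}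
    (h : y.1 = x.1 + Pi.single i 1 ∨ x.1 = y.1 + Pi.single i 1) :
    quadStep L p lam x y * quadStep L p lam y x =
      sElt L i • HQuad.gen L p lam (.idem (toBar L p lam x)) := by
  rcases h with h | h
  · rw [quadStep_add h, quadStep_sub h, HQuad.gen_minus_mul_plus]
  · rw [quadStep_add h, quadStep_sub h, HQuad.gen_plus_mul_minus]

theorem quadStep_mul_idem (x y : LambdaSet L p lam) :
    quadStep L p lam x y * HQuad.gen L p lam (.idem (toBar L p lam y)) = quadStep L p lam x y := by
  rw [quadStep]
  split_ifs
  · exact HQuad.gen_minus_mul_idem _ _ _ _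
  · exact HQuad.gen_plus_mul_idem _ _ _ _
  · exact zero_mul _

theorem toBar_corner {z zi zj zij : LambdaSet L p lam} {i j : Fin n}
    (hi : zi.1 = z.1 + Pi.single i 1) (hj : zj.1 = z.1 + Pi.single j 1)
    (hij : zij.1 = z.1 + Pi.single i 1 + Pi.single j 1) :
    zij.1 = zi.1 + Pi.single j 1 ∧ zij.1 = zj.1 + Pi.single i 1 := by
  rw [hi, hj, hij]
  exact ⟨rfl, add_right_comm _ _ _⟩

theorem quadStep_square_up {z zi zj zij : LambdaSet L p lam} {i j : Fin n} (h : i ≠ j)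
    (hi : zi.1 = z.1 + Pi.single i 1) (hj : zj.1 = z.1 + Pi.single j 1)
    (hij : zij.1 = z.1 + Pi.single i 1 + Pi.single j 1) :
    quadStep L p lam z zi * quadStep L p lam zi zij =
      quadStep L p lam z zj * quadStep L p lam zj zij := by
  obtain ⟨h1, h2⟩ := toBar_corner hi hj hij
  have := RingQuot.mkAlgHom_rel (SymG L) (QRel.minus_minus i j h _ _ _ _
    (toBar_add L p lam i z zi hi) (toBar_add L p lam j z zj hj) (toBar_add L p lam j zi zij h1)
    (toBar_add L p lam i zj zij h2))
  rw [map_mul, map_mul] at this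
  rw [quadStep_add hi, quadStep_add hj, quadStep_add h1, quadStep_add h2]
  exact this.symm

theorem quadStep_square_down {z zi zj zij : LambdaSet L p lam} {i j : Fin n} (h : i ≠ j)
    (hi : zi.1 = z.1 + Pi.single i 1) (hj : zj.1 = z.1 + Pi.single j 1)
    (hij : zij.1 = z.1 + Pi.single i 1 + Pi.single j 1) :
    quadStep L p lam zij zi * quadStep L p lam zi z =
      quadStep L p lam zij zj * quadStep L p lam zj z := by
  obtain ⟨h1, h2⟩ := toBar_corner hi hj hij
  have := RingQuot.mkAlgHom_rel (SymG L) (QRel.plus_plus i j h _ _ _ _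
    (toBar_add L p lam i z zi hi) (toBar_add L p lam j z zj hj) (toBar_add L p lam j zi zij h1)
    (toBar_add L p lam i zj zij h2))
  rw [map_mul, map_mul] at this
  rw [quadStep_sub hi, quadStep_sub hj, quadStep_sub h1, quadStep_sub h2]
  exact this

theorem quadStep_square_mixed {z zi zj zij : LambdaSet L p lam} {i j : Fin n} (h : i ≠ j)
    (hi : zi.1 = z.1 + Pi.single i 1) (hj : zj.1 = z.1 + Pi.single j 1)
    (hij : zij.1 = z.1 + Pi.single i 1 + Pi.single j 1) :
    quadStep L p lam zi zij * quadStep L p lam zij zj =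
      quadStep L p lam zi z * quadStep L p lam z zj := by
  obtain ⟨h1, h2⟩ := toBar_corner hi hj hij
  have := RingQuot.mkAlgHom_rel (SymG L) (QRel.minus_plus' i j h _ _ _ _
    (toBar_add L p lam i z zi hi) (toBar_add L p lam j z zj hj) (toBar_add L p lam j zi zij h1)
    (toBar_add L p lam i zj zij h2))
  rw [map_mul, map_mul] at this
  rw [quadStep_sub hi, quadStep_add hj, quadStep_add h1, quadStep_sub h2]
  exact this

theorem sign_eq_or {a : ℤ} (h : a ≠ 0) : Int.sign a = 1 ∨ Int.sign a = -1 := by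
  rcases lt_or_gt_of_ne h with h | h
  · exact Or.inr (Int.sign_eq_neg_one_of_neg h)
  · exact Or.inl (Int.sign_eq_one_of_pos h)

theorem toward_toward (x y : Fin n → ℤ) {k k' : Fin n} (h : k ≠ k') :
    toward x (toward x y k) k' =
      y + Pi.single k (Int.sign (x k - y k)) + Pi.single k' (Int.sign (x k' - y k')) := by
  rw [toward, toward_ne x y h.symm, toward]

theorem toward_comm (x y : Fin n → ℤ) {k k' : Fin n} (h : k ≠ k') :
    toward x (toward x y k) k' = toward x (toward x y k') k := by
  rw [toward_toward x y h, toward_toward x y h.symm, add_right_comm]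

theorem toward_eq (x y : Fin n → ℤ) {k : Fin n} (hk : x k ≠ y k) :
    toward x y k = y + Pi.single k 1 ∨ y = toward x y k + Pi.single k 1 := by
  rcases sign_eq_or (sub_ne_zero.2 hk) with h | h
  · exact Or.inl (by rw [toward, h])
  · right
    rw [toward, h, add_assoc, ← Pi.single_add, neg_add_cancel, Pi.single_zero, add_zero]

/-- Going around a square of `Λ`. -/
theorem quadStep_square {x : Fin n → ℤ} {y y₁ y₂ z : LambdaSet L p lam} {k k' : Fin n}
    (hkk : k ≠ k') (hk : x k ≠ y.1 k) (hk' : x k' ≠ y.1 k') (h₁ : y₁.1 = toward x y.1 k)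
    (h₂ : y₂.1 = toward x y.1 k') (hz : z.1 = toward x (toward x y.1 k) k') :
    quadStep L p lam z y₁ * quadStep L p lam y₁ y = quadStep L p lam z y₂ * quadStep L p lam y₂ y := by
  rw [toward_toward x y.1 hkk] at hz
  rw [toward] at h₁ h₂
  have hneg : ∀ k : Fin n, (Pi.single k (-1) : Fin n → ℤ) = -Pi.single k 1 := fun k => by
    rw [← Pi.single_neg]
  rcases sign_eq_or (sub_ne_zero.2 hk) with h | h <;>
    rcases sign_eq_or (sub_ne_zero.2 hk') with h' | h' <;> rw [h, h'] at hz <;>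
    rw [h] at h₁ <;> rw [h'] at h₂ <;> try simp only [hneg] at h₁ h₂ hz
  · exact quadStep_square_down hkk h₁ h₂ hz
  · refine quadStep_square_mixed (z := y₂) (i := k) (j := k') hkk ?_ ?_ ?_
    · rw [hz, h₂, add_right_comm]
    · rw [h₂, neg_add_cancel_right]
    · rw [h₁, h₂, add_right_comm, neg_add_cancel_right]
  · refine (quadStep_square_mixed (z := y₁) (i := k') (j := k) hkk.symm ?_ ?_ ?_).symm
    · rw [hz, h₁]
    · rw [h₁, neg_add_cancel_right]
    · rw [h₁, h₂, add_right_comm, neg_add_cancel_right]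
  · refine quadStep_square_up (i := k') (j := k) hkk.symm ?_ ?_ ?_
    · rw [h₁, hz, neg_add_cancel_right]
    · rw [h₂, hz, add_right_comm, neg_add_cancel_right]
    · rw [hz, neg_add_cancel_right, neg_add_cancel_right]

/-- The products of generators of the quadratic algebra along shortest paths in `Λ` from `x`. The
last step leads to `y` from the neighbour `y'` of `y` in the direction of `x`. -/
inductive IsGeodesic (x : LambdaSet L p lam) : LambdaSet L p lam → HQuad L p lam → Prop
  | refl : IsGeodesic x x (HQuad.gen L p lam (.idem (toBar L p lam x)))
  | step (y' y : LambdaSet L p lam) (k : Fin n) (hk : x.1 k ≠ y.1 k)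
      (h : y'.1 = toward x.1 y.1 k) (w : HQuad L p lam) (hw : IsGeodesic x y' w) :
      IsGeodesic x y (w * quadStep L p lam y' y)

theorem taxi_toward_lt {x y : Fin n → ℤ} {k : Fin n} (hk : x k ≠ y k) :
    taxi x (toward x y k) < taxi x y := by
  refine Finset.sum_lt_sum (fun i _ => ?_) ⟨k, Finset.mem_univ k, ?_⟩
  · by_cases h : i = k
    · subst h
      rw [toward_same]
      rcases lt_or_gt_of_ne hk with h | h
      · rw [Int.sign_eq_neg_one_of_neg (sub_neg.2 h)]
        omega
      · rw [Int.sign_eq_one_of_pos (sub_pos.2 h)]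
        omega
    · rw [toward_ne x y h]
  · rw [toward_same]
    rcases lt_or_gt_of_ne hk with h | h
    · rw [Int.sign_eq_neg_one_of_neg (sub_neg.2 h)]
      omega
    · rw [Int.sign_eq_one_of_pos (sub_pos.2 h)]
      omega

/-- For a smooth parameter, any two elements of `Λ` are joined by a shortest path. -/
theorem exists_isGeodesic (hs : IsSmooth L p lam) (hp : 0 < p) (x y : LambdaSet L p lam) :
    ∃ w, IsGeodesic x y w := by
  by_cases hxy : x = y
  · subst hxy
    exact ⟨_, .refl⟩
  obtain ⟨k, hk, hmem⟩ := hs.exists_toward hp x.2 y.2 fun h => hxy (Subtype.ext h)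
  obtain ⟨w, hw⟩ := exists_isGeodesic hs hp x ⟨_, hmem⟩
  exact ⟨_, .step ⟨_, hmem⟩ y k hk rfl w hw⟩
termination_by taxi x.1 y.1
decreasing_by exact taxi_toward_lt hk

/-- The product along a shortest path depends only on the endpoints. -/
theorem IsGeodesic.unique (hs : IsSmooth L p lam) (hp : 0 < p) {x y : LambdaSet L p lam}
    {w w' : HQuad L p lam} (hw : IsGeodesic x y w) (hw' : IsGeodesic x y w') : w = w' := by
  induction N : taxi x.1 y.1 using Nat.strong_induction_on generalizing y w w' with
  | _ N ih =>
    subst N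
    cases hw with
    | refl =>
      cases hw' with
      | refl => rfl
      | step y' _ k hk => exact absurd rfl hk
    | step y₁ _ k₁ hk₁ h₁ w₁ hw₁ =>
      cases hw' with
      | refl => exact absurd rfl hk₁
      | step y₂ _ k₂ hk₂ h₂ w₂ hw₂ =>
        have hlt : ∀ {y' : LambdaSet L p lam} {k : Fin n}, x.1 k ≠ y.1 k →
            y'.1 = toward x.1 y.1 k → taxi x.1 y'.1 < taxi x.1 y.1 := fun hk h =>
          h ▸ taxi_toward_lt hk
        -- All shortest paths with last step from a neighbour `k` have the same product; the
        -- property is carried over to other neighbours by prolonging one path to the opposite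
        -- corner of a square.
        have key := hs.toward_induction hp x.2 y.2 (i := k₁) (j := k₂)
          (Q := fun k => ∀ (y' : LambdaSet L p lam) (w' : HQuad L p lam),
            y'.1 = toward x.1 y.1 k → IsGeodesic x y' w' →
            w' * quadStep L p lam y' y = w₁ * quadStep L p lam y₁ y)
          hk₁ hk₂ (h₁ ▸ y₁.2) (h₂ ▸ y₂.2) ?_ ?_
        · exact (key y₂ w₂ h₂ hw₂).symm
        · intro y' w' h' hw'
          obtain rfl : y' = y₁ := Subtype.ext (h'.trans h₁.symm)
          rw [ih _ (hlt hk₁ h₁) hw' hw₁ rfl]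
        · intro k k' hkk hk hk' hyk hyk' hykk hQ y' w' h' hw'
          obtain ⟨v, hv⟩ := exists_isGeodesic hs hp x ⟨_, hykk⟩
          have hg := IsGeodesic.step ⟨_, hykk⟩ ⟨_, hyk⟩ k'
            (by
              show x.1 k' ≠ toward x.1 y.1 k k'
              rwa [toward_ne x.1 y.1 hkk.symm]) rfl v hv
          have hg' := IsGeodesic.step ⟨_, hykk⟩ y' k
            (by rwa [h', toward_ne x.1 y.1 hkk]) (by rw [h']; exact toward_comm _ _ hkk) v hv
          rw [ih _ (hlt hk' h') hw' hg' rfl, ← hQ ⟨_, hyk⟩ _ rfl hg, mul_assoc, mul_assoc,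
            quadStep_square (z := ⟨_, hykk⟩) (y₂ := ⟨_, hyk⟩) hkk.symm hk' hk h' rfl
              (toward_comm _ _ hkk)]

theorem IsGeodesic.mul_idem {x y : LambdaSet L p lam} {w : HQuad L p lam}
    (hw : IsGeodesic x y w) : w * HQuad.gen L p lam (.idem (toBar L p lam y)) = w := by
  cases hw with
  | refl => exact HQuad.gen_idem_mul_self _
  | step y' _ k hk h w hw => rw [mul_assoc, quadStep_mul_idem]

/-- Prolonging a shortest path by a neighbour gives a shortest path, or a multiple of one. -/
theorem IsGeodesic.mul_quadStep (hs : IsSmooth L p lam) (hp : 0 < p) {x y u : LambdaSet L p lam}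
    {w : HQuad L p lam} (hw : IsGeodesic x y w) {i : Fin n}
    (h : u.1 = y.1 + Pi.single i 1 ∨ y.1 = u.1 + Pi.single i 1) :
    ∃ (s : SymG L) (w' : HQuad L p lam), IsGeodesic x u w' ∧
      w * quadStep L p lam y u = s • w' := by
  -- If `u` is closer to `x` than `y`, then a shortest path to `y` through `u` is used.
  by_cases hcase : x.1 i ≠ y.1 i ∧ u.1 = toward x.1 y.1 i
  · obtain ⟨w', hw'⟩ := exists_isGeodesic hs hp x u
    refine ⟨sElt L i, w', hw', ?_⟩
    rw [hw.unique hs hp (.step u y i hcase.1 hcase.2 w' hw'), mul_assoc,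
      quadStep_mul_quadStep (i := i) h.symm, mul_smul_comm, hw'.mul_idem]
  · have hsub : ∀ {a b : Fin n → ℤ}, a = b + Pi.single i 1 → b = a + Pi.single i (-1) := by
      rintro a b rfl
      rw [add_assoc, ← Pi.single_add, add_neg_cancel, Pi.single_zero, add_zero]
    obtain ⟨h1, h2⟩ : x.1 i ≠ u.1 i ∧ y.1 = toward x.1 u.1 i := by
      rcases h with h | h
      · have hu : u.1 i = y.1 i + 1 := by rw [h, Pi.add_apply, Pi.single_eq_same]
        have hle : x.1 i ≤ y.1 i := by
          by_contra hlt
          push Not at hlt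
          refine hcase ⟨hlt.ne', ?_⟩
          rw [toward, Int.sign_eq_one_of_pos (sub_pos.2 hlt), h]
        refine ⟨by omega, ?_⟩
        rw [toward, Int.sign_eq_neg_one_of_neg (by omega)]
        exact hsub h
      · have hu : y.1 i = u.1 i + 1 := by rw [h, Pi.add_apply, Pi.single_eq_same]
        have hle : y.1 i ≤ x.1 i := by
          by_contra hlt
          push Not at hlt
          refine hcase ⟨hlt.ne, ?_⟩
          rw [toward, Int.sign_eq_neg_one_of_neg (sub_neg.2 hlt)]
          exact hsub h
        refine ⟨by omega, ?_⟩
        rw [toward, Int.sign_eq_one_of_pos (by omega), h]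
    exact ⟨1, _, .step y u i h1 h2 w hw, (one_smul _ _).symm⟩

theorem exists_sub_single (i : Fin n) {χ : LambdaBar L p lam} {y : LambdaSet L p lam}
    (h : (toBar L p lam y).1 = χ.1 + charRes L (Pi.single i 1)) :
    ∃ u : LambdaSet L p lam, toBar L p lam u = χ ∧ y.1 = u.1 + Pi.single i 1 := by
  have hu : charRes L (y.1 - Pi.single i 1) = χ.1 := by
    rw [map_sub, sub_eq_iff_eq_add]
    exact h
  exact ⟨⟨y.1 - Pi.single i 1, mem_LambdaSet_iff.2 (hu ▸ χ.2)⟩, Subtype.ext hu,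
    (sub_add_cancel _ _).symm⟩

theorem exists_add_single (i : Fin n) {χ : LambdaBar L p lam} {y : LambdaSet L p lam}
    (h : χ.1 = (toBar L p lam y).1 + charRes L (Pi.single i 1)) :
    ∃ u : LambdaSet L p lam, toBar L p lam u = χ ∧ u.1 = y.1 + Pi.single i 1 := by
  have hu : charRes L (y.1 + Pi.single i 1) = χ.1 := by
    rw [map_add]
    exact h.symm
  exact ⟨⟨y.1 + Pi.single i 1, mem_LambdaSet_iff.2 (hu ▸ χ.2)⟩, Subtype.ext hu, rfl⟩

/-- The product along a shortest path. -/
def geodesic (hs : IsSmooth L p lam) (hp : 0 < p) (x y : LambdaSet L p lam) : HQuad L p lam :=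
  (exists_isGeodesic hs hp x y).choose

theorem isGeodesic_geodesic (hs : IsSmooth L p lam) (hp : 0 < p) (x y : LambdaSet L p lam) :
    IsGeodesic x y (geodesic hs hp x y) :=
  (exists_isGeodesic hs hp x y).choose_spec

/-- The products along shortest paths that start at representatives of `LambdaBar` span the
quadratic algebra. -/
theorem span_geodesic (hs : IsSmooth L p lam) (hp : 0 < p) :
    Submodule.span (SymG L) (Set.range fun q : LambdaBar L p lam × LambdaSet L p lam =>
      geodesic hs hp (barRep L p lam q.1) q.2) = ⊤ := by
  refine submodule_eq_top_of_mul_mem HQuad.adjoin_gen ?_ ?_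
  · rw [← HQuad.sum_gen_idem]
    refine Submodule.sum_mem _ fun χ _ => Submodule.subset_span ⟨(χ, barRep L p lam χ), ?_⟩
    have := (isGeodesic_geodesic hs hp (barRep L p lam χ) (barRep L p lam χ)).unique hs hp .refl
    rwa [toBar_barRep] at this
  · intro m hm g
    induction hm using Submodule.span_induction with
    | zero => rw [zero_mul]; exact zero_mem _
    | add a b _ _ ha hb => rw [add_mul]; exact add_mem ha hb
    | smul s a _ ha => rw [smul_mul_assoc]; exact Submodule.smul_mem _ s ha
    | mem m hm =>
      obtain ⟨⟨χ, y⟩, rfl⟩ := hm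
      have hgeo := isGeodesic_geodesic hs hp (barRep L p lam χ) y
      dsimp only
      have hzero : ∀ {ψ : LambdaBar L p lam} {r : HQuad L p lam}, toBar L p lam y ≠ ψ →
          HQuad.gen L p lam (.idem ψ) * r = r → geodesic hs hp (barRep L p lam χ) y * r = 0 := by
        intro ψ r hne hr
        rw [← hgeo.mul_idem, ← hr, mul_assoc,
          ← mul_assoc (HQuad.gen L p lam (.idem (toBar L p lam y))), HQuad.gen_idem_mul_idem hne,
          zero_mul, mul_zero]
      have hstep : ∀ {u : LambdaSet L p lam} {i : Fin n},
          u.1 = y.1 + Pi.single i 1 ∨ y.1 = u.1 + Pi.single i 1 →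
          geodesic hs hp (barRep L p lam χ) y * quadStep L p lam y u ∈
            Submodule.span (SymG L) (Set.range fun q : LambdaBar L p lam × LambdaSet L p lam =>
              geodesic hs hp (barRep L p lam q.1) q.2) := by
        intro u i h
        obtain ⟨s, w', hw', e⟩ := hgeo.mul_quadStep hs hp h
        rw [e, hw'.unique hs hp (isGeodesic_geodesic hs hp _ u)]
        exact Submodule.smul_mem _ _ (Submodule.subset_span ⟨(χ, u), rfl⟩)
      cases g with
      | idem ψ =>
        by_cases h : toBar L p lam y = ψ
        · subst h
          rw [hgeo.mul_idem]
          exact Submodule.subset_span ⟨(χ, y), rfl⟩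
        · rw [hzero h (HQuad.gen_idem_mul_self ψ)]
          exact zero_mem _
      | plus i ξ ψ hξ =>
        by_cases h : toBar L p lam y = ψ
        · subst h
          obtain ⟨u, rfl, hu⟩ := exists_sub_single i hξ
          rw [← quadStep_sub hu]
          exact hstep (Or.inr hu)
        · rw [hzero h (HQuad.gen_idem_mul_plus i ξ ψ hξ)]
          exact zero_mem _
      | minus i ξ ψ hξ =>
        by_cases h : toBar L p lam y = ψ
        · subst h
          obtain ⟨u, rfl, hu⟩ := exists_add_single i hξ
          rw [← quadStep_add hu]
          exact hstep (Or.inl hu)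
        · rw [hzero h (HQuad.gen_idem_mul_minus i ξ ψ hξ)]
          exact zero_mem _

end Quadratic

/-! ### Comparison of the two presentations -/

section Comparison

variable {n : ℕ} {L : Submodule ℤ (Fin n → ℤ)} {p : ℕ} {lam : Module.Dual ℤ L}

/-- The elements `c` multiply without a factor from `S` when `y` lies between `x` and `u`. -/
theorem HBar.gen_c_mul_c_of_between {x y u : LambdaSet L p lam}
    (h : ∀ i, x.1 i ≤ y.1 i ∧ y.1 i ≤ u.1 i ∨ u.1 i ≤ y.1 i ∧ y.1 i ≤ x.1 i) :
    HBar.gen L p lam (.c x y) * HBar.gen L p lam (.c y u) = HBar.gen L p lam (.c x u) := by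
  rw [HBar.gen_c_mul_c, Finset.prod_eq_one, one_smul]
  intro i _
  have : eta x.1 y.1 u.1 i = 0 := by
    have := h i
    simp only [eta]
    omega
  rw [this, pow_zero]

theorem HBar.gen_c_mul_c_neighbour {x y : LambdaSet L p lam} {i : Fin n}
    (h : y.1 = x.1 + Pi.single i 1 ∨ x.1 = y.1 + Pi.single i 1) :
    HBar.gen L p lam (.c x y) * HBar.gen L p lam (.c y x) =
      sElt L i • HBar.gen L p lam (.idem (toBar L p lam x)) := by
  rw [HBar.gen_c_mul_c, HBar.gen_c_self, Finset.prod_eq_single i]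
  · have : eta x.1 y.1 x.1 i = 1 := by
      simp only [eta]
      rcases h with h | h <;> rw [h, Pi.add_apply, Pi.single_eq_same] <;> omega
    rw [this, pow_one]
  · intro j _ hj
    have : eta x.1 y.1 x.1 j = 0 := by
      simp only [eta]
      rcases h with h | h <;> rw [h, Pi.add_apply, Pi.single_eq_of_ne hj] <;> omega
    rw [this, pow_zero]
  · exact fun h => absurd (Finset.mem_univ i) h

variable (L p lam) in
/-- The elements of `H̄` that correspond to the generators of the quadratic algebra: `c x y` for a
pair of neighbours over the given classes. The choice of the pair does not matter, by
`quadImage_plus` and `quadImage_minus`. -/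
def quadImage : QGen L p lam → HBar L p lam
  | .idem χ => HBar.gen L p lam (.idem χ)
  | .plus i χ ψ h =>
    have hex := exists_add_single (y := barRep L p lam χ) i (χ := ψ) (by rw [toBar_barRep, h])
    HBar.gen L p lam (.c hex.choose (barRep L p lam χ))
  | .minus i χ ψ h =>
    have hex := exists_add_single (y := barRep L p lam ψ) i (χ := χ) (by rw [toBar_barRep, h])
    HBar.gen L p lam (.c (barRep L p lam ψ) hex.choose)

theorem quadImage_plus {x y : LambdaSet L p lam} {i : Fin n} (h : y.1 = x.1 + Pi.single i 1)
    {χ ψ : LambdaBar L p lam} (hχ : toBar L p lam x = χ)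
    (h' : ψ.1 = χ.1 + charRes L (Pi.single i 1)) :
    quadImage L p lam (.plus i χ ψ h') = HBar.gen L p lam (.c y x) := by
  have hex := exists_add_single (y := barRep L p lam χ) i (χ := ψ) (by rw [toBar_barRep, h'])
  have hx : charRes L ((barRep L p lam χ).1 - x.1) = 0 := by
    rw [map_sub, charRes_barRep, ← hχ]
    exact sub_self _
  have e : hex.choose.1 - y.1 = (barRep L p lam χ).1 - x.1 := by
    rw [hex.choose_spec.2, h, add_sub_add_right_eq_sub]
  exact HBar.gen_c_translate (e ▸ hx) e

theorem quadImage_minus {x y : LambdaSet L p lam} {i : Fin n} (h : y.1 = x.1 + Pi.single i 1)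
    {χ ψ : LambdaBar L p lam} (hψ : toBar L p lam x = ψ)
    (h' : χ.1 = ψ.1 + charRes L (Pi.single i 1)) :
    quadImage L p lam (.minus i χ ψ h') = HBar.gen L p lam (.c x y) := by
  have hex := exists_add_single (y := barRep L p lam ψ) i (χ := χ) (by rw [toBar_barRep, h'])
  have hx : charRes L ((barRep L p lam ψ).1 - x.1) = 0 := by
    rw [map_sub, charRes_barRep, ← hψ]
    exact sub_self _
  have e : (barRep L p lam ψ).1 - x.1 = hex.choose.1 - y.1 := by
    rw [hex.choose_spec.2, h, add_sub_add_right_eq_sub]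
  exact HBar.gen_c_translate hx e

/-- A square in `LambdaBar` lifts to a square in `Λ`. -/
theorem exists_corner {i j : Fin n} {χ χi χj χij : LambdaBar L p lam}
    (hi : χi.1 = χ.1 + charRes L (Pi.single i 1)) (hj : χj.1 = χ.1 + charRes L (Pi.single j 1))
    (hij : χij.1 = χi.1 + charRes L (Pi.single j 1)) :
    ∃ z zi zj zij : LambdaSet L p lam, toBar L p lam z = χ ∧ toBar L p lam zi = χi ∧
      toBar L p lam zj = χj ∧ toBar L p lam zij = χij ∧ zi.1 = z.1 + Pi.single i 1 ∧
      zj.1 = z.1 + Pi.single j 1 ∧ zij.1 = z.1 + Pi.single i 1 + Pi.single j 1 := by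
  obtain ⟨z, rfl⟩ : ∃ z, toBar L p lam z = χ := ⟨_, toBar_barRep χ⟩
  obtain ⟨zi, rfl, hzi⟩ := exists_add_single i hi
  obtain ⟨zj, rfl, hzj⟩ := exists_add_single j hj
  obtain ⟨zij, rfl, hzij⟩ := exists_add_single j hij
  exact ⟨z, zi, zj, zij, rfl, rfl, rfl, rfl, hzi, hzj, by rw [hzij, hzi]⟩

open HBar in
variable (L p lam) in
/-- The homomorphism from the quadratic algebra to `H̄`. -/
def quadToHBar : HQuad L p lam →ₐ[SymG L] HBar L p lam :=
  RingQuot.liftAlgHom (SymG L) ⟨FreeAlgebra.lift (SymG L) (quadImage L p lam), by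
    intro a b h
    induction h with
    | sum_idem =>
      rw [map_sum, map_one]
      simp only [FreeAlgebra.lift_ι_apply]
      exact sum_gen_idem
    | idem_idem χ =>
      simp only [map_mul, FreeAlgebra.lift_ι_apply]
      exact gen_idem_mul_self χ
    | idem_ne χ ψ h =>
      simp only [map_mul, map_zero, FreeAlgebra.lift_ι_apply]
      exact gen_idem_mul_idem h
    | idem_plus i χ ψ h =>
      simp only [map_mul, FreeAlgebra.lift_ι_apply]
      obtain ⟨x, rfl⟩ : ∃ z, toBar L p lam z = χ := ⟨_, toBar_barRep χ⟩
      obtain ⟨y, rfl, hy⟩ := exists_add_single i h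
      rw [quadImage_plus hy rfl]
      exact gen_idem_mul_c y x
    | plus_idem i χ ψ h =>
      simp only [map_mul, FreeAlgebra.lift_ι_apply]
      obtain ⟨x, rfl⟩ : ∃ z, toBar L p lam z = χ := ⟨_, toBar_barRep χ⟩
      obtain ⟨y, rfl, hy⟩ := exists_add_single i h
      rw [quadImage_plus hy rfl]
      exact gen_c_mul_idem y x
    | idem_minus i χ ψ h =>
      simp only [map_mul, FreeAlgebra.lift_ι_apply]
      obtain ⟨x, rfl⟩ : ∃ z, toBar L p lam z = ψ := ⟨_, toBar_barRep ψ⟩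
      obtain ⟨y, rfl, hy⟩ := exists_add_single i h
      rw [quadImage_minus hy rfl]
      exact gen_idem_mul_c x y
    | minus_idem i χ ψ h =>
      simp only [map_mul, FreeAlgebra.lift_ι_apply]
      obtain ⟨x, rfl⟩ : ∃ z, toBar L p lam z = ψ := ⟨_, toBar_barRep ψ⟩
      obtain ⟨y, rfl, hy⟩ := exists_add_single i h
      rw [quadImage_minus hy rfl]
      exact gen_c_mul_idem x y
    | minus_plus i χ ψ h =>
      simp only [map_mul, map_smul, FreeAlgebra.lift_ι_apply]
      obtain ⟨x, rfl⟩ : ∃ z, toBar L p lam z = χ := ⟨_, toBar_barRep χ⟩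
      obtain ⟨y, rfl, hy⟩ := exists_add_single i h
      rw [quadImage_plus hy rfl, quadImage_minus hy rfl]
      exact gen_c_mul_c_neighbour (Or.inl hy)
    | plus_minus i χ ψ h =>
      simp only [map_mul, map_smul, FreeAlgebra.lift_ι_apply]
      obtain ⟨x, rfl⟩ : ∃ z, toBar L p lam z = χ := ⟨_, toBar_barRep χ⟩
      obtain ⟨y, rfl, hy⟩ := exists_add_single i h
      rw [quadImage_plus hy rfl, quadImage_minus hy rfl]
      exact gen_c_mul_c_neighbour (Or.inr hy)
    | plus_plus i j hne χ χi χj χij hi hj hij hji =>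
      simp only [map_mul, FreeAlgebra.lift_ι_apply]
      obtain ⟨z, zi, zj, zij, rfl, rfl, rfl, rfl, h1, h2, h3⟩ := exists_corner hi hj hij
      obtain ⟨h4, h5⟩ := toBar_corner h1 h2 h3
      rw [quadImage_plus h4 rfl, quadImage_plus h1 rfl, quadImage_plus h5 rfl,
        quadImage_plus h2 rfl, gen_c_mul_c_of_between, gen_c_mul_c_of_between] <;>
      · intro l
        simp only [h1, h2, h3, Pi.add_apply, Pi.single_apply]
        split_ifs <;> omega
    | minus_minus i j hne χ χi χj χij hi hj hij hji =>
      simp only [map_mul, FreeAlgebra.lift_ι_apply]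
      obtain ⟨z, zi, zj, zij, rfl, rfl, rfl, rfl, h1, h2, h3⟩ := exists_corner hi hj hij
      obtain ⟨h4, h5⟩ := toBar_corner h1 h2 h3
      rw [quadImage_minus h4 rfl, quadImage_minus h1 rfl, quadImage_minus h5 rfl,
        quadImage_minus h2 rfl, gen_c_mul_c_of_between, gen_c_mul_c_of_between] <;>
      · intro l
        simp only [h1, h2, h3, Pi.add_apply, Pi.single_apply]
        split_ifs <;> omega
    | minus_plus' i j hne χ χi χj χij hi hj hij hji =>
      simp only [map_mul, FreeAlgebra.lift_ι_apply]
      obtain ⟨z, zi, zj, zij, rfl, rfl, rfl, rfl, h1, h2, h3⟩ := exists_corner hi hj hij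
      obtain ⟨h4, h5⟩ := toBar_corner h1 h2 h3
      rw [quadImage_minus h4 rfl, quadImage_plus h1 rfl, quadImage_plus h5 rfl,
        quadImage_minus h2 rfl, gen_c_mul_c_of_between, gen_c_mul_c_of_between] <;>
      · intro l
        simp only [h1, h2, h3, Pi.add_apply, Pi.single_apply]
        split_ifs <;> omega⟩

theorem quadToHBar_gen (g : QGen L p lam) :
    quadToHBar L p lam (HQuad.gen L p lam g) = quadImage L p lam g := by
  show RingQuot.liftAlgHom (SymG L) _ (RingQuot.mkAlgHom _ _ _) = _
  rw [RingQuot.liftAlgHom_mkAlgHom_apply, FreeAlgebra.lift_ι_apply]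

theorem quadToHBar_quadStep {x y : LambdaSet L p lam} {i : Fin n}
    (h : y.1 = x.1 + Pi.single i 1 ∨ x.1 = y.1 + Pi.single i 1) :
    quadToHBar L p lam (quadStep L p lam x y) = HBar.gen L p lam (.c x y) := by
  rcases h with h | h
  · rw [quadStep_add h, quadToHBar_gen, quadImage_minus h rfl]
  · rw [quadStep_sub h, quadToHBar_gen, quadImage_plus h rfl]

theorem IsGeodesic.quadToHBar_eq {x y : LambdaSet L p lam} {w : HQuad L p lam}
    (hw : IsGeodesic x y w) : quadToHBar L p lam w = HBar.gen L p lam (.c x y) := by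
  induction hw with
  | refl =>
    rw [quadToHBar_gen, HBar.gen_c_self]
    rfl
  | step y' y k hk h w hw ih =>
    rw [map_mul, ih, quadToHBar_quadStep (i := k)
      ((h ▸ toward_eq x.1 y.1 hk : y'.1 = y.1 + _ ∨ y.1 = y'.1 + _).symm)]
    refine HBar.gen_c_mul_c_of_between fun i => ?_
    rw [h]
    by_cases hi : i = k
    · subst hi
      rw [toward_same]
      rcases lt_or_gt_of_ne hk with hlt | hlt
      · rw [Int.sign_eq_neg_one_of_neg (sub_neg.2 hlt)]
        omega
      · rw [Int.sign_eq_one_of_pos (sub_pos.2 hlt)]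
        omega
    · rw [toward_ne x.1 y.1 hi]
      omega

variable (L p lam) in
/-- The representation of the quadratic algebra by matrices. -/
def quadToMatrix : HQuad L p lam →ₐ[SymG L] BarMatrix L p lam :=
  (hbarToMatrix L p lam).comp (quadToHBar L p lam)

theorem quadToMatrix_injective (hL : IsSaturated L) (hs : IsSmooth L p lam) (hp : 0 < p) :
    Function.Injective (quadToMatrix L p lam) := by
  refine injective_of_linearIndependent (span_geodesic hs hp) (quadToMatrix L p lam).toLinearMap ?_
  have := linearIndependent_genMatrix (p := p) (lam := lam) hL
  have e : ∀ x y, quadToMatrix L p lam (geodesic hs hp x y) = genMatrix L p lam (.c x y) := by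
    intro x y
    rw [quadToMatrix, AlgHom.comp_apply, (isGeodesic_geodesic hs hp x y).quadToHBar_eq,
      hbarToMatrix_gen]
  simpa only [AlgHom.toLinearMap_apply, e] using this

theorem quadToHBar_surjective (hs : IsSmooth L p lam) (hp : 0 < p) :
    Function.Surjective (quadToHBar L p lam) := by
  rw [← AlgHom.range_eq_top, eq_top_iff, ← HBar.adjoin_gen]
  refine Algebra.adjoin_le ?_
  rintro _ ⟨g, rfl⟩
  cases g with
  | idem χ => exact ⟨HQuad.gen L p lam (.idem χ), quadToHBar_gen _⟩
  | c x y => exact ⟨_, (isGeodesic_geodesic hs hp x y).quadToHBar_eq⟩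

theorem range_quadToMatrix (α : Module.Dual ℤ L) (hs : IsSmooth L p lam) (hp : 0 < p) :
    (quadToMatrix L p lam).range = semiInvMatrix L p lam α := by
  rw [← range_hbarToMatrix α, quadToMatrix, AlgHom.range_comp,
    (AlgHom.range_eq_top _).2 (quadToHBar_surjective hs hp), Algebra.map_top]

theorem quadToMatrix_gen_mem_weightPart (g : QGen L p lam) (χ ψ : LambdaBar L p lam) :
    quadToMatrix L p lam (HQuad.gen L p lam g) χ ψ ∈ weightPart L (QGen.deg L p lam g) := by
  have hdeg : ∀ {x y : LambdaSet L p lam} {i : Fin n}, y.1 = x.1 + Pi.single i 1 →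
      taxi x.1 y.1 = 1 ∧ taxi y.1 x.1 = 1 := by
    intro x y i h
    have h1 : ∀ j, (x.1 j - y.1 j).natAbs = if j = i then 1 else 0 := fun j => by
      rw [h, Pi.add_apply, Pi.single_apply]
      split_ifs <;> omega
    have h2 : ∀ j, (y.1 j - x.1 j).natAbs = if j = i then 1 else 0 := fun j => by
      rw [← h1 j]
      omega
    simp only [taxi, h1, h2, Finset.sum_ite_eq', Finset.mem_univ, if_true, and_self]
  rw [quadToMatrix, AlgHom.comp_apply, quadToHBar_gen]
  cases g with
  | idem ξ =>
    have := genMatrix_mem_weightPart (.idem ξ) χ ψ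
    rwa [← hbarToMatrix_gen] at this
  | plus i ξ ζ h =>
    obtain ⟨x, rfl⟩ : ∃ z, toBar L p lam z = ξ := ⟨_, toBar_barRep ξ⟩
    obtain ⟨y, rfl, hy⟩ := exists_add_single i h
    rw [quadImage_plus hy rfl, hbarToMatrix_gen]
    have := genMatrix_mem_weightPart (.c y x) χ ψ
    rwa [Gen.deg, (hdeg hy).2] at this
  | minus i ξ ζ h =>
    obtain ⟨x, rfl⟩ : ∃ z, toBar L p lam z = ζ := ⟨_, toBar_barRep ζ⟩
    obtain ⟨y, rfl, hy⟩ := exists_add_single i h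
    rw [quadImage_minus hy rfl, hbarToMatrix_gen]
    have := genMatrix_mem_weightPart (.c x y) χ ψ
    rwa [Gen.deg, (hdeg hy).1] at this

end Comparison

end Hypertoric

end

open Hypertoric

theorem mainTheorem8 {n : ℕ} (L : Submodule ℤ (Fin n → ℤ)) (hL : IsSaturated L)
    (hU : IsUnimodular L) (α : Module.Dual ℤ L) (hα : IsGeneric L α)
    (p : ℕ) (hp : p.Prime) (lam : Module.Dual ℤ L) :
    DirectSum.IsInternal (HBar.grade L p lam) ∧
    (∃ Φ : HBar L p lam ≃+* (CategoryTheory.End (tilt L α p lam))ᵐᵒᵖ,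
      (∀ x y, Φ (HBar.gen L p lam (.c x y)) = MulOpposite.op (monoEnd L α p lam x y)) ∧
      (∀ i, Φ (algebraMap (SymG L) _ (sElt L i)) = MulOpposite.op (zwEnd L α p lam i)) ∧
      ∀ d h, h ∈ HBar.grade L p lam d ↔ MulOpposite.unop (Φ h) ∈ endWeight L α p lam d) ∧
    (∃ Ψ : HBar L p lam ≃+* CategoryTheory.End (tilt L α p lam),
      (∀ x y, Ψ (HBar.gen L p lam (.c x y)) = monoEnd L α p lam y x) ∧
      (∀ i, Ψ (algebraMap (SymG L) _ (sElt L i)) = zwEnd L α p lam i) ∧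
      ∀ d h, h ∈ HBar.grade L p lam d ↔ Ψ h ∈ endWeight L α p lam d) ∧
    (IsSmooth L p lam →
      ∃ Θ : HQuad L p lam ≃+* (CategoryTheory.End (tilt L α p lam))ᵐᵒᵖ,
        (∀ (i : Fin n) (x y : LambdaSet L p lam) (h : y.1 = x.1 + Pi.single i 1),
          Θ (HQuad.gen L p lam (.plus i (toBar L p lam x) (toBar L p lam y)
              (toBar_add L p lam i x y h))) = MulOpposite.op (monoEnd L α p lam y x) ∧
          Θ (HQuad.gen L p lam (.minus i (toBar L p lam y) (toBar L p lam x)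
              (toBar_add L p lam i x y h))) = MulOpposite.op (monoEnd L α p lam x y)) ∧
        (∀ i, Θ (algebraMap (SymG L) _ (sElt L i)) = MulOpposite.op (zwEnd L α p lam i)) ∧
        ∀ d h, h ∈ HQuad.grade L p lam d ↔ MulOpposite.unop (Θ h) ∈ endWeight L α p lam d) := by
  have hp' : 0 < p := hp.pos
  have hdeg : ∀ g χ ψ, hbarToMatrix L p lam (HBar.gen L p lam g) χ ψ ∈
      weightPart L (Gen.deg L p lam g) := fun g χ ψ => by
    rw [hbarToMatrix_gen]
    exact genMatrix_mem_weightPart g χ ψ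
  obtain ⟨Φ, hΦc, hΦs, hΦd⟩ := exists_ringEquiv_end hL hU hα HBar.adjoin_gen
    (hbarToMatrix L p lam) (hbarToMatrix_injective hL) (range_hbarToMatrix α) hdeg
  have hΦc' : ∀ x y, Φ (HBar.gen L p lam (.c x y)) = MulOpposite.op (monoEnd L α p lam x y) :=
    fun x y => hΦc _ x y (hbarToMatrix_gen _)
  refine ⟨isInternal_wordSpan (hbarToMatrix L p lam) HBar.adjoin_gen (hbarToMatrix_injective hL)
    hdeg, ⟨Φ, hΦc', hΦs, hΦd⟩, ⟨(hbarOp L p lam).trans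
    ((RingEquiv.op Φ).trans (RingEquiv.opOp _).symm), fun x y => ?_, fun i => ?_, fun d h => ?_⟩,
    fun hs => ?_⟩
  · show MulOpposite.unop (Φ (MulOpposite.unop (hbarSwap L p lam (HBar.gen L p lam (.c x y))))) = _
    rw [hbarSwap_gen, MulOpposite.unop_op]
    exact congrArg MulOpposite.unop (hΦc' y x)
  · show MulOpposite.unop (Φ (MulOpposite.unop (hbarSwap L p lam _))) = _
    rw [AlgHom.commutes, MulOpposite.algebraMap_apply, MulOpposite.unop_op, hΦs,
      MulOpposite.unop_op]
  · rw [← hbarSwap_mem_grade_iff]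
    exact hΦd d _
  · obtain ⟨Θ, hΘc, hΘs, hΘd⟩ := exists_ringEquiv_end hL hU hα HQuad.adjoin_gen
      (quadToMatrix L p lam) (quadToMatrix_injective hL hs hp') (range_quadToMatrix α hs hp')
      quadToMatrix_gen_mem_weightPart
    refine ⟨Θ, fun i x y h => ⟨hΘc _ y x ?_, hΘc _ x y ?_⟩, hΘs, hΘd⟩
    · rw [quadToMatrix, AlgHom.comp_apply, quadToHBar_gen, quadImage_plus h rfl, hbarToMatrix_gen]
    · rw [quadToMatrix, AlgHom.comp_apply, quadToHBar_gen, quadImage_minus h rfl, hbarToMatrix_gen]
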